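/- **Setting.** Let $\mathbb{A}$ be a structure (operations and relations allowed) with underlying set $A$, whose elements are called atoms. $\mathrm{Aut}(\mathbb{A})$ carries the topology induced by the product topology on $A^A$ ($A$ discrete). For finite $S\subseteq A$, $\mathbb{A}\sqcup S$ is $\mathbb{A}$ expanded by a constant for every element of $S$. Let $V(A)$ be the cumulative hierarchy of sets with atoms from $A$, on which $\mathrm{Aut}(\mathbb{A})$ acts through the atoms. An $X\in V(A)$ is *symmetric* if for $X$ and for all its hereditary elements $Y$ the stabiliser $\{\pi:\pi\cdot Y=Y\}$ is open; $\mathrm{ZFA}(\mathbb{A})$ is the category of symmetric sets and of functions whose graph is symmetric. A set (or a function, through its graph) is *$S$-equivariant* if it is moreover fixed by $\mathrm{Aut}(\mathbb{A}\sqcup S)$; $\mathrm{ZFA}_S(\mathbb{A})$ is the resulting non-full subcategory. For a topological group $G$, $\mathrm{Cont}(G)$ is the category of continuous actions of $G$ on discrete sets and equivariant functions. For $S\subseteq T$ let $\Theta_{S,T}:\mathrm{Cont}(\mathrm{Aut}(\mathbb{A}\sqcup S))\to\mathrm{Cont}(\mathrm{Aut}(\mathbb{A}\sqcup T))$ be restriction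 of the action. $\mathbf{Log}$ is the 2-category of elementary toposes, logical functors and natural transformations. A category is *finitely generated* if it has finitely many objects and finitely many morphisms of which every morphism is a composite. **Theorem (Transfer principle).** 1. All $\mathrm{Cont}(\mathrm{Aut}(\mathbb{A}\sqcup S))$ and $\mathrm{ZFA}(\mathbb{A})$ are elementary toposes, the functors $\Theta_{S,T}$ are logical, and the functors $\mathrm{ZFA}_S(\mathbb{A})\to\mathrm{Cont}(\mathrm{Aut}(\mathbb{A}\sqcup S))$ sending a set to the action on its elements are equivalences. The canonical embeddings $J_S:\mathrm{Cont}(\mathrm{Aut}(\mathbb{A}\sqcup S))\simeq\mathrm{ZFA}_S(\mathbb{A})\hookrightarrow\mathrm{ZFA}(\mathbb{A})$ are logical, faithful and reflect isomorphisms, and form a pseudo-cocone on $S\mapsto\mathrm{Cont}(\mathrm{Aut}(\mathbb{A}\sqcup S))$ (indexed by the filtered poset of finite subsets of $A$), compatibly with the inclusions $\mathrm{ZFA}_S(\mathbb{A})\subseteq\mathrm{ZFA}_T(\mathbb{A})$ for $S\subseteq T$. This pseudo-cocone exhibits $\mathrm{ZFA}(\mathbb{A})$ as the colimit of the diagram in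 $\mathbf{Log}$: for every elementary topos $\mathcal{E}$ (of the same size), composition with it is an equivalence from the category of logical functors $\mathrm{ZFA}(\mathbb{A})\to\mathcal{E}$ to the category of pseudo-cocones of logical functors to $\mathcal{E}$. 2. For every category $\mathcal{C}$, every diagram $D_0:\mathcal{C}\to\mathrm{Cont}(\mathrm{Aut}(\mathbb{A}\sqcup S))$ and every statement $\varphi$ about diagrams of shape $\mathcal{C}$ that is a Boolean combination of assertions of the following kinds, $\varphi$ holds for $D_0$ if and only if it holds for $J_S\circ D_0$: two morphisms are equal; a morphism is a monomorphism, an epimorphism or an isomorphism; a finite (co)cone is a (co)limit; given parts of the diagram form an exponential, a power object with its membership relation, or a subobject classifier; a subobject is the existential or the universal quantification of a given subobject along a given morphism; a subobject is the join of, or the implication between, two given subobjects. 3. Let $\mathcal{C}$ be a finitely generated category. For every diagram $D:\mathcal{C}\to\mathrm{ZFA}(\mathbb{A})$ there are a finite $S\subseteq A$ and a diagram $D_0:\mathcal{C}\to\mathrm{Cont}(\mathrm{Aut}(\mathbb{A}\sqcup S))$ with $J_S\circ D_0\cong D$, and every statement $\varphi$ as in 2 holds for $D_0$ if and only if it holds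 for $D$. Moreover, for diagrams $D_0,D_1:\mathcal{C}\to\mathrm{Cont}(\mathrm{Aut}(\mathbb{A}\sqcup S))$, every natural transformation $J_S\circ D_0\to J_S\circ D_1$ is induced, for some finite $T\supseteq S$, by a natural transformation $\Theta_{S,T}\circ D_0\to\Theta_{S,T}\circ D_1$. -/

import Mathlib

universe v u w₁ w₂ w₃ w₄

open CategoryTheory CategoryTheory.Limits FirstOrder

/-! ## The cumulative hierarchy of sets with atoms -/

/-- Codes for the elements of the cumulative hierarchy over a set `A` of atoms: an atom, or a small
family of codes (standing for the set of its entries). -/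
inductive PreVA (A : Type u) : Type (u + 1)
  | atom (a : A) : PreVA A
  | set (ι : Type u) (x : ι → PreVA A) : PreVA A

namespace PreVA

variable {A B : Type u}

/-- Extensional equality of codes: atoms are compared by equality, sets by their elements, and an
atom is never equal to a set. -/
def Ext : PreVA A → PreVA A → Prop
  | atom a, atom b => a = b
  | set _ x, set _ y => (∀ i, ∃ j, Ext (x i) (y j)) ∧ (∀ j, ∃ i, Ext (x i) (y j))
  | atom _, set _ _ => False
  | set _ _, atom _ => False

theorem Ext.refl : ∀ x : PreVA A, Ext x x
  | atom _ => rfl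
  | set _ x => ⟨fun i => ⟨i, Ext.refl (x i)⟩, fun i => ⟨i, Ext.refl (x i)⟩⟩

theorem Ext.symm : ∀ {x y : PreVA A}, Ext x y → Ext y x
  | atom _, atom _, h => Eq.symm h
  | set _ _, set _ _, h =>
    ⟨fun j => let ⟨i, hi⟩ := h.2 j; ⟨i, Ext.symm hi⟩,
      fun i => let ⟨j, hj⟩ := h.1 i; ⟨j, Ext.symm hj⟩⟩
  | atom _, set _ _, h => h.elim
  | set _ _, atom _, h => h.elim

theorem Ext.trans : ∀ {x y z : PreVA A}, Ext x y → Ext y z → Ext x z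
  | atom _, atom _, atom _, h, h' => Eq.trans h h'
  | set _ _, set _ _, set _ _, h, h' =>
    ⟨fun i => let ⟨j, hj⟩ := h.1 i; let ⟨k, hk⟩ := h'.1 j; ⟨k, Ext.trans hj hk⟩,
      fun k => let ⟨j, hj⟩ := h'.2 k; let ⟨i, hi⟩ := h.2 j; ⟨i, Ext.trans hi hj⟩⟩
  | atom _, set _ _, _, h, _ => h.elim
  | set _ _, atom _, _, h, _ => h.elim
  | atom _, atom _, set _ _, _, h => h.elim
  | set _ _, set _ _, atom _, _, h => h.elim

instance setoid (A : Type u) : Setoid (PreVA A) :=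
  ⟨Ext, Ext.refl, Ext.symm, Ext.trans⟩

/-- Membership of codes; atoms have no elements. -/
def Mem (y : PreVA A) : PreVA A → Prop
  | atom _ => False
  | set _ x => ∃ i, Ext y (x i)

theorem Mem.congr : ∀ {y y' x x' : PreVA A}, Ext y y' → Ext x x' → Mem y x → Mem y' x'
  | _, _, set _ _, set _ _, hy, hx, ⟨i, hi⟩ =>
    let ⟨j, hj⟩ := hx.1 i
    ⟨j, hy.symm.trans (hi.trans hj)⟩
  | _, _, atom _, _, _, _, h => h.elim
  | _, _, set _ _, atom _, _, hx, _ => hx.elim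

/-- Apply a function to all the atoms occurring hereditarily in a code. -/
def map (e : A → B) : PreVA A → PreVA B
  | atom a => atom (e a)
  | set ι x => set ι fun i => map e (x i)

theorem map_congr (e : A → B) : ∀ {x y : PreVA A}, Ext x y → Ext (map e x) (map e y)
  | atom _, atom _, h => congrArg e h
  | set _ _, set _ _, h =>
    ⟨fun i => let ⟨j, hj⟩ := h.1 i; ⟨j, map_congr e hj⟩,
      fun j => let ⟨i, hi⟩ := h.2 j; ⟨i, map_congr e hi⟩⟩
  | atom _, set _ _, h => h.elim
  | set _ _, atom _, h => h.elim

end PreVA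

/-- The cumulative hierarchy `V(A)` of sets with atoms in `A`: its elements are the atoms, and the
sets all of whose elements lie in the hierarchy. -/
def VA (A : Type u) : Type (u + 1) := Quotient (PreVA.setoid A)

namespace VA

variable {A B : Type u}

/-- The element of the hierarchy with a given code. -/
def mk (x : PreVA A) : VA A := Quotient.mk _ x

theorem ind {p : VA A → Prop} (h : ∀ x, p (mk x)) (x : VA A) : p x := Quotient.ind h x

theorem mk_eq {x y : PreVA A} : mk x = mk y ↔ PreVA.Ext x y := Quotient.eq

/-- An atom, as an element of the hierarchy. -/
def atom (a : A) : VA A := mk (PreVA.atom a)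

/-- The set `{x i | i ∈ ι}`. -/
noncomputable def range {ι : Type u} (x : ι → VA A) : VA A :=
  mk (PreVA.set ι fun i => Quotient.out (x i))

/-- The membership relation. -/
def Mem (y x : VA A) : Prop :=
  Quotient.liftOn₂ y x PreVA.Mem fun _ _ _ _ hy hx =>
    propext ⟨PreVA.Mem.congr hy hx, PreVA.Mem.congr (Setoid.symm hy) (Setoid.symm hx)⟩

instance : Membership (VA A) (VA A) := ⟨fun x y => Mem y x⟩

/-- An element of the hierarchy is a set if it is not an atom. -/
def IsSet (x : VA A) : Prop := ∀ a : A, x ≠ atom a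

/-- The action of a function on atoms, extended to the whole hierarchy. -/
def map (e : A → B) (x : VA A) : VA B :=
  Quotient.map (PreVA.map e) (fun _ _ h => PreVA.map_congr e h) x

theorem notMem_atom (y : VA A) (a : A) : ¬ y ∈ atom a := by
  induction y using VA.ind
  exact id

theorem range_isSet {ι : Type u} (x : ι → VA A) : (range x).IsSet := fun _ h =>
  mk_eq.1 h

theorem mem_mk {ι : Type u} {x : ι → PreVA A} {y : VA A} :
    y ∈ mk (PreVA.set ι x) ↔ ∃ i, mk (x i) = y := by
  induction y using VA.ind with
  | _ y =>
    constructor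
    · rintro ⟨i, hi⟩
      exact ⟨i, mk_eq.2 (PreVA.Ext.symm hi)⟩
    · rintro ⟨i, hi⟩
      exact ⟨i, PreVA.Ext.symm (mk_eq.1 hi)⟩

theorem mem_range {ι : Type u} {x : ι → VA A} {y : VA A} : y ∈ range x ↔ ∃ i, x i = y := by
  have h : ∀ i, mk (Quotient.out (x i)) = x i := fun i => Quotient.out_eq (x i)
  refine mem_mk.trans ?_
  simp only [h]

theorem isSet_mk {ι : Type u} (x : ι → PreVA A) :
    IsSet (mk (PreVA.set ι x)) := fun _ h =>
  mk_eq.1 h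

theorem isSet_cases {x : VA A} (hx : x.IsSet) :
    ∃ (ι : Type u) (f : ι → PreVA A), x = mk (PreVA.set ι f) := by
  induction x using VA.ind with
  | _ x =>
    cases x with
    | atom a => exact absurd rfl (hx a)
    | set ι f => exact ⟨ι, f, rfl⟩

theorem ext {x y : VA A} (hx : x.IsSet) (hy : y.IsSet) (h : ∀ z, z ∈ x ↔ z ∈ y) : x = y := by
  obtain ⟨ι, f, rfl⟩ := isSet_cases hx
  obtain ⟨κ, g, rfl⟩ := isSet_cases hy
  refine mk_eq.2 ⟨fun i => ?_, fun j => ?_⟩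
  · obtain ⟨j, hj⟩ := mem_mk.1 ((h _).1 (mem_mk.2 ⟨i, rfl⟩))
    exact ⟨j, PreVA.Ext.symm (mk_eq.1 hj)⟩
  · obtain ⟨i, hi⟩ := mem_mk.1 ((h _).2 (mem_mk.2 ⟨j, rfl⟩))
    exact ⟨i, mk_eq.1 hi⟩

theorem isSet_of_mem {x y : VA A} (h : y ∈ x) : x.IsSet := by
  rintro a rfl
  exact notMem_atom _ _ h

theorem map_isSet (e : A → B) {x : VA A} (hx : x.IsSet) : (map e x).IsSet := by
  obtain ⟨ι, f, rfl⟩ := isSet_cases hx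
  exact isSet_mk _

theorem mem_map {e : A → B} {x : VA A} {y : VA B} :
    y ∈ map e x ↔ ∃ z ∈ x, map e z = y := by
  induction x using VA.ind with
  | _ x =>
    cases x with
    | atom a =>
      constructor
      · exact fun h => (notMem_atom y (e a) h).elim
      · rintro ⟨z, hz, -⟩
        exact (notMem_atom z a hz).elim
    | set ι f =>
      refine Iff.trans (mem_mk (x := fun i => PreVA.map e (f i))) ?_
      constructor
      · rintro ⟨i, rfl⟩
        exact ⟨mk (f i), mem_mk.2 ⟨i, rfl⟩, rfl⟩
      · rintro ⟨z, hz, rfl⟩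
        obtain ⟨i, rfl⟩ := mem_mk.1 hz
        exact ⟨i, rfl⟩

theorem map_map {C : Type u} (e : A → B) (e' : B → C) (x : VA A) :
    map e' (map e x) = map (e' ∘ e) x := by
  induction x using VA.ind with
  | _ x =>
    refine congrArg mk ?_
    induction x with
    | atom a => rfl
    | set ι f ih => exact congrArg (PreVA.set ι) (funext ih)

theorem map_id (x : VA A) : map id x = x := by
  induction x using VA.ind with
  | _ x =>
    refine congrArg mk ?_
    induction x with
    | atom a => rfl
    | set ι f ih => exact congrArg (PreVA.set ι) (funext ih)

instance small_elements (x : VA A) : Small.{u} {y : VA A // y ∈ x} := by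
  by_cases hx : x.IsSet
  · obtain ⟨ι, f, rfl⟩ := isSet_cases hx
    refine small_of_surjective (α := ι)
      (f := fun i => ⟨mk (f i), mem_mk.2 ⟨i, rfl⟩⟩) ?_
    rintro ⟨y, hy⟩
    obtain ⟨i, hi⟩ := mem_mk.1 hy
    exact ⟨i, Subtype.ext hi⟩
  · have : IsEmpty {y : VA A // y ∈ x} := ⟨fun y => hx (isSet_of_mem y.2)⟩
    infer_instance

/-- The elements of `x`, as a type. -/
abbrev Elem (x : VA A) : Type u := Shrink.{u} {y : VA A // y ∈ x}

/-- The element of the hierarchy named by `i : x.Elem`. -/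
noncomputable def Elem.val {x : VA A} (i : x.Elem) : VA A := ((equivShrink _).symm i).1

theorem Elem.val_mem {x : VA A} (i : x.Elem) : i.val ∈ x := ((equivShrink _).symm i).2

/-- The element of the type `x.Elem` given by an element of `x`. -/
noncomputable def Elem.mk {x : VA A} (y : VA A) (hy : y ∈ x) : x.Elem := equivShrink _ ⟨y, hy⟩

@[simp] theorem Elem.val_mk {x : VA A} (y : VA A) (hy : y ∈ x) : (Elem.mk y hy).val = y := by
  simp [Elem.mk, Elem.val]

@[ext] theorem Elem.ext {x : VA A} {i j : x.Elem} (h : i.val = j.val) : i = j :=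
  (equivShrink _).symm.injective (Subtype.ext h)

/-- The unordered pair `{x, y}`. -/
noncomputable def upair (x y : VA A) : VA A := range fun b : ULift.{u} Bool => cond b.down x y

theorem mem_upair {x y z : VA A} : z ∈ upair x y ↔ z = x ∨ z = y := by
  refine mem_range.trans ⟨?_, ?_⟩
  · rintro ⟨⟨_ | _⟩, rfl⟩
    · exact Or.inr rfl
    · exact Or.inl rfl
  · rintro (rfl | rfl)
    · exact ⟨⟨true⟩, rfl⟩
    · exact ⟨⟨false⟩, rfl⟩

/-- The Kuratowski ordered pair `{{x}, {x, y}}`. -/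
noncomputable def pair (x y : VA A) : VA A := upair (upair x x) (upair x y)

theorem upair_inj {x y x' y' : VA A} (h : upair x y = upair x' y') :
    (x = x' ∧ y = y') ∨ (x = y' ∧ y = x') := by
  have hx : x = x' ∨ x = y' := mem_upair.1 (h ▸ mem_upair.2 (Or.inl rfl))
  have hy : y = x' ∨ y = y' := mem_upair.1 (h ▸ mem_upair.2 (Or.inr rfl))
  have hx' : x' = x ∨ x' = y := mem_upair.1 (h ▸ mem_upair.2 (Or.inl rfl))
  have hy' : y' = x ∨ y' = y := mem_upair.1 (h ▸ mem_upair.2 (Or.inr rfl))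
  grind

theorem pair_inj {x y x' y' : VA A} (h : pair x y = pair x' y') : x = x' ∧ y = y' := by
  rcases upair_inj h with ⟨h₁, h₂⟩ | ⟨h₁, h₂⟩ <;>
    rcases upair_inj h₁ with h₁ | h₁ <;> rcases upair_inj h₂ with h₂ | h₂ <;> grind

theorem map_upair (e : A → B) (x y : VA A) : map e (upair x y) = upair (map e x) (map e y) := by
  refine ext (map_isSet e (range_isSet _)) (range_isSet _) fun z => ?_
  rw [mem_map, mem_upair]
  constructor
  · rintro ⟨z, hz, rfl⟩
    rcases mem_upair.1 hz with rfl | rfl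
    · exact Or.inl rfl
    · exact Or.inr rfl
  · rintro (rfl | rfl)
    · exact ⟨x, mem_upair.2 (Or.inl rfl), rfl⟩
    · exact ⟨y, mem_upair.2 (Or.inr rfl), rfl⟩

theorem map_pair (e : A → B) (x y : VA A) : map e (pair x y) = pair (map e x) (map e y) := by
  simp [pair, map_upair]

/-- The graph of a function between sets with atoms, as a set of ordered pairs. -/
noncomputable def graph {x y : VA A} (f : x.Elem → y.Elem) : VA A :=
  range fun i : x.Elem => pair i.val (f i).val

theorem mem_graph {x y : VA A} {f : x.Elem → y.Elem} {z : VA A} :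
    z ∈ graph f ↔ ∃ i : x.Elem, pair i.val (f i).val = z :=
  mem_range

end VA

/-! ## Automorphism groups and their topology -/

section Automorphisms

variable {L : FirstOrder.Language.{w₁, w₂}} {L' : FirstOrder.Language.{w₃, w₄}} {M : Type u} [L.Structure M]
  [L'.Structure M]

/-- The automorphisms of a structure form a group under composition. -/
instance autGroup : Group (M ≃[L] M) where
  mul f g := f.comp g
  one := FirstOrder.Language.Equiv.refl L M
  inv f := f.symm
  mul_assoc _ _ _ := rfl
  one_mul _ := rfl
  mul_one _ := rfl
  inv_mul_cancel f := f.symm_comp_self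

/-- The canonical topology on the automorphism group of a structure `M`: the one induced by the
product topology on `M → M`, where `M` is discrete. -/
instance autTopology : TopologicalSpace (M ≃[L] M) :=
  TopologicalSpace.induced (fun (π : M ≃[L] M) (a : M) => π a) (@Pi.topologicalSpace M _ fun _ => ⊥)

theorem aut_mul_apply (f g : M ≃[L] M) (a : M) : (f * g) a = f (g a) := rfl

/-- A map into the automorphism group is continuous when all its evaluations are. -/
theorem continuous_aut {X : Type*} [TopologicalSpace X] {f : X → (M ≃[L] M)}
    (hf : ∀ a : M, @Continuous X M _ ⊥ fun x => f x a) : Continuous f := by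
  let _ : TopologicalSpace M := ⊥
  exact continuous_induced_rng.2 (continuous_pi hf)

theorem continuous_aut_apply (a : M) : @Continuous (M ≃[L] M) M _ ⊥ fun π => π a := by
  let _ : TopologicalSpace M := ⊥
  exact (continuous_apply a).comp continuous_induced_dom

theorem continuous_aut_mul_left (σ : M ≃[L] M) : Continuous fun π : M ≃[L] M => σ * π := by
  let _ : TopologicalSpace M := ⊥
  exact continuous_aut fun a => (continuous_bot (f := σ)).comp (continuous_aut_apply a)

/-- An automorphism for a larger language is an automorphism for a smaller one. -/
def reductAut (φ : L →ᴸ L') [φ.IsExpansionOn M] : (M ≃[L'] M) →* (M ≃[L] M) where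
  toFun π :=
    { π.toEquiv with
      map_fun' := fun f x => by
        have h := π.map_fun' (φ.onFunction f) x
        simpa using h
      map_rel' := fun r x => by
        have h := π.map_rel' (φ.onRelation r) x
        simpa using h }
  map_one' := rfl
  map_mul' _ _ := rfl

theorem reductAut_apply (φ : L →ᴸ L') [φ.IsExpansionOn M] (π : M ≃[L'] M) (a : M) :
    reductAut φ π a = π a := rfl

theorem continuous_reductAut (φ : L →ᴸ L') [φ.IsExpansionOn M] :
    Continuous (reductAut (M := M) φ) :=
  continuous_aut fun a => continuous_aut_apply (L := L') a

/-- Automorphisms act on the cumulative hierarchy of sets with atoms. -/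
instance autMulAction : MulAction (M ≃[L] M) (VA M) where
  smul π x := VA.map π x
  one_smul x := VA.map_id x
  mul_smul π σ x := (VA.map_map σ π x).symm

theorem aut_smul_def (π : M ≃[L] M) (x : VA M) : π • x = VA.map π x := rfl

/-- A subgroup of the automorphism group that contains an open subgroup is open. -/
theorem isOpen_of_le {H K : Subgroup (M ≃[L] M)} (hH : IsOpen (H : Set (M ≃[L] M))) (h : H ≤ K) :
    IsOpen (K : Set (M ≃[L] M)) := by
  refine isOpen_iff_forall_mem_open.2 fun k hk => ?_
  refine ⟨(fun π => k⁻¹ * π) ⁻¹' H, fun π hπ => ?_, hH.preimage (continuous_aut_mul_left _), ?_⟩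
  · have := K.mul_mem hk (h hπ)
    rwa [mul_inv_cancel_left] at this
  · simp [H.one_mem]

end Automorphisms

/-- The group of automorphisms of the structure `A ⊔ S`, that is, of `A` expanded by a constant for
every element of the finite set `S` of atoms. -/
abbrev AutOver (L : FirstOrder.Language.{w₁, w₂}) {A : Type u} [L.Structure A] (S : Finset A) : Type u :=
  A ≃[L[[(S : Set A)]]] A

/-- The inclusion `Aut(A ⊔ T) → Aut(A ⊔ S)` for `S ⊆ T`. -/
def autOverRestrict (L : FirstOrder.Language.{w₁, w₂}) {A : Type u} [L.Structure A] {S T : Finset A}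
    (h : S ≤ T) : AutOver L T →* AutOver L S :=
  reductAut (L.lhomWithConstantsMap (Set.inclusion (Finset.coe_subset.2 h)))

/-- The inclusion `Aut(A ⊔ S) → Aut(A)`. -/
def autOverForget (L : FirstOrder.Language.{w₁, w₂}) {A : Type u} [L.Structure A] (S : Finset A) :
    AutOver L S →* (A ≃[L] A) :=
  reductAut (L.lhomWithConstants (S : Set A))

/-! ## Continuous actions of a topological group on discrete sets -/

/-- A set with an action of the topological group `G` that is continuous for the discrete topology
on the set. -/
structure ContSet (G : Type u) [Group G] [TopologicalSpace G] : Type (u + 1) where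
  carrier : Type u
  [action : MulAction G carrier]
  continuous_smul : @Continuous (G × carrier) carrier (@instTopologicalSpaceProd _ _ _ ⊥) ⊥
    fun p => p.1 • p.2

namespace ContSet

attribute [instance] ContSet.action

variable {G H : Type u} [Group G] [TopologicalSpace G] [Group H] [TopologicalSpace H]

/-- Morphisms are the equivariant functions. -/
@[ext]
structure Hom (X Y : ContSet G) : Type u where
  toFun : X.carrier → Y.carrier
  map_smul : ∀ (g : G) (x : X.carrier), toFun (g • x) = g • toFun x

/-- The category `Cont(G)` of continuous actions of `G` on discrete sets. -/
instance : Category.{u, u + 1} (ContSet G) where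
  Hom X Y := Hom X Y
  id X := ⟨id, fun _ _ => rfl⟩
  comp f g := ⟨g.toFun ∘ f.toFun, fun a x => by
    simp only [Function.comp_apply, f.map_smul, g.map_smul]⟩

@[ext] theorem hom_ext {X Y : ContSet G} {f g : X ⟶ Y} (h : f.toFun = g.toFun) : f = g :=
  Hom.ext h

/-- Restriction of continuous actions along a continuous homomorphism. -/
def restrict (φ : H →* G) (hφ : Continuous φ) : ContSet G ⥤ ContSet H where
  obj X :=
    { carrier := X.carrier
      action := MulAction.compHom X.carrier φ
      continuous_smul := by
        let _ : TopologicalSpace X.carrier := ⊥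
        exact X.continuous_smul.comp (hφ.prodMap continuous_id) }
  map f := ⟨f.toFun, fun g x => f.map_smul (φ g) x⟩

end ContSet

/-! ## Symmetric sets -/

/-- An element `x` of the hierarchy is symmetric if the stabiliser in `Aut(A)` of each of its
hereditary elements (`x` included) is open. -/
def IsSymmetric (L : FirstOrder.Language.{w₁, w₂}) {A : Type u} [L.Structure A] (x : VA A) : Prop :=
  ∀ y : VA A, Relation.ReflTransGen (fun y z : VA A => y ∈ z) y x →
    IsOpen (MulAction.stabilizer (A ≃[L] A) y : Set (A ≃[L] A))

section Symmetric

variable {L : FirstOrder.Language.{w₁, w₂}} {A : Type u} [L.Structure A]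

theorem isSymmetric_iff {x : VA A} : IsSymmetric L x ↔
    IsOpen (MulAction.stabilizer (A ≃[L] A) x : Set (A ≃[L] A)) ∧ ∀ y ∈ x, IsSymmetric L y := by
  constructor
  · exact fun h => ⟨h x .refl, fun y hy z hz => h z (hz.tail hy)⟩
  · rintro ⟨h, h'⟩ z hz
    rcases Relation.ReflTransGen.cases_tail hz with rfl | ⟨y, hzy, hy⟩
    · exact h
    · exact h' y hy z hzy

theorem IsSymmetric.mem {x y : VA A} (h : IsSymmetric L x) (hy : y ∈ x) : IsSymmetric L y :=
  (isSymmetric_iff.1 h).2 y hy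

theorem IsSymmetric.isOpen {x : VA A} (h : IsSymmetric L x) :
    IsOpen (MulAction.stabilizer (A ≃[L] A) x : Set (A ≃[L] A)) :=
  (isSymmetric_iff.1 h).1

theorem IsSymmetric.upair {x y : VA A} (hx : IsSymmetric L x) (hy : IsSymmetric L y) :
    IsSymmetric L (VA.upair x y) := by
  refine isSymmetric_iff.2 ⟨?_, fun z hz => ?_⟩
  · refine isOpen_of_le (H := MulAction.stabilizer (A ≃[L] A) x ⊓ MulAction.stabilizer (A ≃[L] A) y)
      (hx.isOpen.inter hy.isOpen) ?_
    rintro π ⟨h₁, h₂⟩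
    have h₁ : VA.map π x = x := h₁
    have h₂ : VA.map π y = y := h₂
    change VA.map π _ = _
    rw [VA.map_upair, h₁, h₂]
  · rcases VA.mem_upair.1 hz with rfl | rfl <;> assumption

theorem IsSymmetric.pair {x y : VA A} (hx : IsSymmetric L x) (hy : IsSymmetric L y) :
    IsSymmetric L (VA.pair x y) :=
  (hx.upair hx).upair (hx.upair hy)

theorem mem_smul_iff {π : A ≃[L] A} {x y : VA A} : π • y ∈ π • x ↔ y ∈ x := by
  have key : ∀ (π : A ≃[L] A) (x y : VA A), y ∈ x → π • y ∈ π • x :=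
    fun π x y h => VA.mem_map.2 ⟨y, h, rfl⟩
  refine ⟨fun h => ?_, key π x y⟩
  simpa using key π⁻¹ _ _ h

/-- An automorphism fixes the graph of `f` exactly when it maps the domain onto itself and `f`
commutes with it. -/
theorem smul_graph_eq_iff {x y : VA A} (hx : x.IsSet) {f : x.Elem → y.Elem} {π : A ≃[L] A} :
    π • VA.graph f = VA.graph f ↔ π • x = x ∧
      ∀ i j : x.Elem, j.val = π • i.val → (f j).val = π • (f i).val := by
  constructor
  · intro h
    have key : ∀ σ : A ≃[L] A, σ • VA.graph f = VA.graph f → ∀ i : x.Elem,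
        ∃ j : x.Elem, j.val = σ • i.val ∧ (f j).val = σ • (f i).val := by
      intro σ h i
      have h₁ : σ • VA.pair i.val (f i).val ∈ VA.graph f := by
        rw [← h]
        exact mem_smul_iff.2 (VA.mem_graph.2 ⟨i, rfl⟩)
      obtain ⟨j, hj⟩ := VA.mem_graph.1 h₁
      rw [aut_smul_def, VA.map_pair] at hj
      exact ⟨j, VA.pair_inj hj⟩
    have h' : π⁻¹ • VA.graph f = VA.graph f := by
      rw [inv_smul_eq_iff, h]
    have sub : ∀ σ : A ≃[L] A, σ • VA.graph f = VA.graph f → ∀ z ∈ x, σ • z ∈ x := by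
      intro σ h z hz
      obtain ⟨j, hj, -⟩ := key σ h (VA.Elem.mk z hz)
      rw [VA.Elem.val_mk] at hj
      exact hj ▸ j.val_mem
    refine ⟨VA.ext (VA.map_isSet _ hx) hx fun z => ⟨fun hz => ?_, fun hz => ?_⟩, fun i j hij => ?_⟩
    · obtain ⟨w, hw, rfl⟩ := VA.mem_map.1 hz
      exact sub π h w hw
    · exact VA.mem_map.2 ⟨π⁻¹ • z, sub _ h' z hz, smul_inv_smul π z⟩
    · obtain ⟨k, hk, hk'⟩ := key π h i
      obtain rfl : k = j := VA.Elem.ext (hk.trans hij.symm)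
      exact hk'
  · rintro ⟨hπ, hf⟩
    refine VA.ext (VA.map_isSet _ (VA.range_isSet _)) (VA.range_isSet _) fun z => ?_
    constructor
    · intro hz
      obtain ⟨w, hw, rfl⟩ := VA.mem_map.1 hz
      obtain ⟨i, rfl⟩ := VA.mem_graph.1 hw
      have hm : π • i.val ∈ x := by
        have := (mem_smul_iff (π := π)).2 i.val_mem
        rwa [hπ] at this
      refine VA.mem_graph.2 ⟨VA.Elem.mk _ hm, ?_⟩
      rw [hf i _ (VA.Elem.val_mk _ hm), VA.Elem.val_mk, VA.map_pair]
      rfl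
    · intro hz
      obtain ⟨j, rfl⟩ := VA.mem_graph.1 hz
      have hm : π⁻¹ • j.val ∈ x := by
        rw [← mem_smul_iff (π := π), hπ, smul_inv_smul]
        exact j.val_mem
      refine VA.mem_map.2 ⟨_, VA.mem_graph.2 ⟨VA.Elem.mk _ hm, rfl⟩, ?_⟩
      rw [VA.map_pair, VA.Elem.val_mk, ← aut_smul_def, ← aut_smul_def, smul_inv_smul,
        ← hf (VA.Elem.mk _ hm) j (by rw [VA.Elem.val_mk, smul_inv_smul])]

theorem isSymmetric_graph_iff {x y : VA A} (hx : IsSymmetric L x) (hy : IsSymmetric L y)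
    {f : x.Elem → y.Elem} : IsSymmetric L (VA.graph f) ↔
      IsOpen (MulAction.stabilizer (A ≃[L] A) (VA.graph f) : Set (A ≃[L] A)) := by
  refine ⟨fun h => h.isOpen, fun h => isSymmetric_iff.2 ⟨h, fun z hz => ?_⟩⟩
  obtain ⟨i, rfl⟩ := VA.mem_graph.1 hz
  exact (hx.mem i.val_mem).pair (hy.mem (f i).val_mem)

theorem smul_graph_id {x : VA A} (hx : x.IsSet) {π : A ≃[L] A} (h : π • x = x) :
    π • VA.graph (id : x.Elem → x.Elem) = VA.graph (id : x.Elem → x.Elem) :=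
  (smul_graph_eq_iff hx).2 ⟨h, fun _ _ hij => hij⟩

theorem smul_graph_comp {x y z : VA A} (hx : x.IsSet) (hy : y.IsSet) {f : x.Elem → y.Elem}
    {g : y.Elem → z.Elem} {π : A ≃[L] A} (hf : π • VA.graph f = VA.graph f)
    (hg : π • VA.graph g = VA.graph g) : π • VA.graph (g ∘ f) = VA.graph (g ∘ f) := by
  rw [smul_graph_eq_iff hx] at hf ⊢
  rw [smul_graph_eq_iff hy] at hg
  exact ⟨hf.1, fun i j hij => hg.2 _ _ (hf.2 i j hij)⟩

end Symmetric

/-- The objects of `ZFA(A)`: the symmetric sets. -/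
structure ZFA (L : FirstOrder.Language.{w₁, w₂}) (A : Type u) [L.Structure A] : Type (u + 1) where
  set : VA A
  isSet : set.IsSet
  symmetric : IsSymmetric L set

namespace ZFA

variable {L : FirstOrder.Language.{w₁, w₂}} {A : Type u} [L.Structure A]

/-- The morphisms of `ZFA(A)`: the functions whose graphs are symmetric sets. -/
@[ext]
structure Hom (X Y : ZFA L A) : Type u where
  toFun : X.set.Elem → Y.set.Elem
  symmetric : IsSymmetric L (VA.graph toFun)

/-- The category of symmetric sets and symmetric functions. -/
instance : Category.{u, u + 1} (ZFA L A) where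
  Hom X Y := Hom X Y
  id X := ⟨id, (isSymmetric_graph_iff X.symmetric X.symmetric).2
    (isOpen_of_le X.symmetric.isOpen fun _ hπ => smul_graph_id X.isSet hπ)⟩
  comp {X Y Z} f g := ⟨g.toFun ∘ f.toFun, (isSymmetric_graph_iff X.symmetric Z.symmetric).2
    (isOpen_of_le
      (H := MulAction.stabilizer (A ≃[L] A) (VA.graph f.toFun) ⊓
        MulAction.stabilizer (A ≃[L] A) (VA.graph g.toFun))
      (f.symmetric.isOpen.inter g.symmetric.isOpen)
      fun _ hπ => smul_graph_comp X.isSet Y.isSet hπ.1 hπ.2)⟩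

@[ext] theorem hom_ext {X Y : ZFA L A} {f g : X ⟶ Y} (h : f.toFun = g.toFun) : f = g :=
  Hom.ext h

end ZFA

/-- The objects of the category of `S`-equivariant sets, for a finite set `S` of atoms: the
symmetric sets that are fixed by all automorphisms of `A ⊔ S`. -/
structure EquivariantZFA (L : FirstOrder.Language.{w₁, w₂}) {A : Type u} [L.Structure A] (S : Finset A) :
    Type (u + 1) where
  obj : ZFA L A
  equivariant : ∀ π : AutOver L S, π • obj.set = obj.set

namespace EquivariantZFA

variable {L : FirstOrder.Language.{w₁, w₂}} {A : Type u} [L.Structure A] {S T : Finset A}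

/-- The `S`-equivariant functions: those whose graphs are `S`-equivariant. -/
@[ext]
structure Hom (X Y : EquivariantZFA L S) : Type u where
  hom : X.obj ⟶ Y.obj
  equivariant : ∀ π : AutOver L S, π • VA.graph hom.toFun = VA.graph hom.toFun

/-- The category of `S`-equivariant sets and `S`-equivariant functions. -/
instance : Category.{u, u + 1} (EquivariantZFA L S) where
  Hom X Y := Hom X Y
  id X := ⟨𝟙 X.obj, fun π => smul_graph_id X.obj.isSet (X.equivariant π)⟩
  comp {X Y _} f g := ⟨f.hom ≫ g.hom, fun π =>
    smul_graph_comp X.obj.isSet Y.obj.isSet (f.equivariant π) (g.equivariant π)⟩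

@[ext] theorem hom_ext {X Y : EquivariantZFA L S} {f g : X ⟶ Y} (h : f.hom = g.hom) : f = g :=
  Hom.ext h

variable (L S) in
/-- The (non-full) inclusion of the `S`-equivariant sets into `ZFA(A)`. -/
def inclusion : EquivariantZFA L S ⥤ ZFA L A where
  obj X := X.obj
  map f := f.hom

variable (L) in
/-- For `S ⊆ T`, every `S`-equivariant set is `T`-equivariant. -/
def enlarge (h : S ≤ T) : EquivariantZFA L S ⥤ EquivariantZFA L T where
  obj X := ⟨X.obj, fun π => X.equivariant (autOverRestrict L h π)⟩
  map f := ⟨f.hom, fun π => f.equivariant (autOverRestrict L h π)⟩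

/-- The action of `Aut(A ⊔ S)` on the elements of an `S`-equivariant set. -/
noncomputable instance elemAction (X : EquivariantZFA L S) :
    MulAction (AutOver L S) X.obj.set.Elem where
  smul π i := VA.Elem.mk (π • i.val) (by
    have h := mem_smul_iff (π := π).2 i.val_mem
    rwa [X.equivariant] at h)
  one_smul i := VA.Elem.ext ((VA.Elem.val_mk _ _).trans (one_smul _ _))
  mul_smul π σ i := VA.Elem.ext <| (VA.Elem.val_mk _ _).trans <| (mul_smul π σ _).trans <|
    (congrArg (π • ·) (VA.Elem.val_mk _ _).symm).trans (VA.Elem.val_mk _ _).symm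

theorem val_smul (X : EquivariantZFA L S) (π : AutOver L S) (i : X.obj.set.Elem) :
    (π • i).val = π • i.val :=
  VA.Elem.val_mk _ _

theorem continuous_elem_smul (X : EquivariantZFA L S) :
    @Continuous (AutOver L S × X.obj.set.Elem) X.obj.set.Elem
      (@instTopologicalSpaceProd _ _ _ ⊥) ⊥ fun p => p.1 • p.2 := by
  let _ : TopologicalSpace X.obj.set.Elem := ⊥
  have : DiscreteTopology X.obj.set.Elem := ⟨rfl⟩
  refine continuous_prod_of_discrete_right.2 fun i => ?_
  refine continuous_discrete_rng.2 fun j => ?_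
  refine isOpen_iff_forall_mem_open.2 fun σ hσ => ?_
  refine ⟨(fun π => autOverForget L S (σ⁻¹ * π)) ⁻¹' MulAction.stabilizer (A ≃[L] A) i.val,
    fun π hπ => ?_,
    (X.obj.symmetric.mem i.val_mem).isOpen.preimage
      ((continuous_reductAut _).comp (continuous_aut_mul_left _)), ?_⟩
  · have hπ : (σ⁻¹ * π) • i.val = i.val := hπ
    have hσ : σ • i = j := hσ
    rw [mul_smul, inv_smul_eq_iff] at hπ
    change π • i = j
    rw [← hσ]
    exact VA.Elem.ext (by rw [val_smul, val_smul, hπ])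
  · change (σ⁻¹ * σ) • i.val = i.val
    rw [inv_mul_cancel, one_smul]

variable (L S) in
/-- The functor from `S`-equivariant sets to continuous actions of `Aut(A ⊔ S)` that sends a set to
the natural action on its elements. -/
noncomputable def toCont : EquivariantZFA L S ⥤ ContSet (AutOver L S) where
  obj X := { carrier := X.obj.set.Elem, continuous_smul := X.continuous_elem_smul }
  map {X Y} f := ⟨f.hom.toFun, fun π i => VA.Elem.ext (by
    have h := ((smul_graph_eq_iff (π := π) X.obj.isSet).1 (f.equivariant π)).2 i (π • i)
      (val_smul X π i)
    exact h.trans (val_smul Y π _).symm)⟩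

end EquivariantZFA

/-! ## Elementary toposes and logical functors -/

section ToposNotions

variable {C : Type w₁} [Category.{w₂} C]

/-- `p` and `q` exhibit `P` as a product of `X` and `Y`. -/
def IsBinaryProduct {P X Y : C} (p : P ⟶ X) (q : P ⟶ Y) : Prop :=
  Nonempty (IsLimit (BinaryFan.mk p q))

/-- `E` is the exponential `B ^ A`, with evaluation `ev : P ⟶ B` defined on the product
`E ⟵ P ⟶ A`: every `g : Z × A ⟶ B` is `ev ∘ (h × A)` for a unique `h : Z ⟶ E`. -/
def IsExponential {P E A B : C} (p : P ⟶ E) (q : P ⟶ A) (ev : P ⟶ B) : Prop :=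
  IsBinaryProduct p q ∧
    ∀ ⦃Q Z : C⦄ (z : Q ⟶ Z) (a : Q ⟶ A), IsBinaryProduct z a → ∀ g : Q ⟶ B,
      ∃! h : Z ⟶ E, ∃ k : Q ⟶ P, k ≫ p = z ≫ h ∧ k ≫ q = a ∧ k ≫ ev = g

/-- `r` and `s` exhibit `R` as a relation between `X` and `Y`: they are jointly monic. -/
def IsRelation {R X Y : C} (r : R ⟶ X) (s : R ⟶ Y) : Prop :=
  ∀ ⦃Z : C⦄ (f g : Z ⟶ R), f ≫ r = g ≫ r → f ≫ s = g ≫ s → f = g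

/-- `PX` is the power object of `X`, with membership relation `X ⟵ M ⟶ PX`: every relation
`X ⟵ R ⟶ Y` is the pullback of the membership relation along a unique `χ : Y ⟶ PX`. -/
def IsPowerObject {M X PX : C} (m : M ⟶ X) (n : M ⟶ PX) : Prop :=
  IsRelation m n ∧
    ∀ ⦃R Y : C⦄ (r : R ⟶ X) (s : R ⟶ Y), IsRelation r s →
      ∃! χ : Y ⟶ PX, ∃ t : R ⟶ M, t ≫ m = r ∧ IsPullback s t χ n

/-- `t : T ⟶ Ω` is a subobject classifier: `T` is terminal, and every monomorphism is the pullback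
of `t` along a unique morphism. -/
def IsSubobjectClassifier {T Ω : C} (t : T ⟶ Ω) : Prop :=
  Nonempty (IsTerminal T) ∧
    ∀ ⦃U X : C⦄ (m : U ⟶ X), Mono m → ∃! χ : X ⟶ Ω, ∃ k : U ⟶ T, IsPullback m k χ t

/-- The subobject `n` of `Y` is the image `∃_f m` of the subobject `m` of `X` along `f : X ⟶ Y`:
it is contained in a subobject `w` iff `m` is contained in the inverse image of `w`. -/
def IsExistsAlong {U X Y V : C} (m : U ⟶ X) (f : X ⟶ Y) (n : V ⟶ Y) : Prop :=
  Mono m ∧ Mono n ∧ ∀ ⦃W : C⦄ (w : W ⟶ Y), Mono w →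
    ((∃ k : V ⟶ W, k ≫ w = n) ↔ ∃ l : U ⟶ W, l ≫ w = m ≫ f)

/-- The subobject `n` of `Y` is the dual image `∀_f m` of the subobject `m` of `X` along
`f : X ⟶ Y`: it contains a subobject `w` iff `m` contains the inverse image of `w`. -/
def IsForallAlong {U X Y V : C} (m : U ⟶ X) (f : X ⟶ Y) (n : V ⟶ Y) : Prop :=
  Mono m ∧ Mono n ∧ ∀ ⦃W Q : C⦄ (w : W ⟶ Y) (a : Q ⟶ W) (b : Q ⟶ X), Mono w →
    IsPullback a b w f → ((∃ k : W ⟶ V, k ≫ n = w) ↔ ∃ l : Q ⟶ U, l ≫ m = b)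

/-- The subobject `w` of `X` is the join of the subobjects `m` and `n`. -/
def IsSubobjectSup {U V W X : C} (m : U ⟶ X) (n : V ⟶ X) (w : W ⟶ X) : Prop :=
  Mono m ∧ Mono n ∧ Mono w ∧ ∀ ⦃T : C⦄ (t : T ⟶ X), Mono t →
    ((∃ k : W ⟶ T, k ≫ t = w) ↔ (∃ k : U ⟶ T, k ≫ t = m) ∧ ∃ k : V ⟶ T, k ≫ t = n)

/-- The subobject `w` of `X` is the Heyting implication `m ⇒ n` of the subobjects `m` and `n`. -/
def IsSubobjectImp {U V W X : C} (m : U ⟶ X) (n : V ⟶ X) (w : W ⟶ X) : Prop :=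
  Mono m ∧ Mono n ∧ Mono w ∧ ∀ ⦃T Q : C⦄ (t : T ⟶ X) (a : Q ⟶ T) (b : Q ⟶ U), Mono t →
    IsPullback a b t m → ((∃ k : T ⟶ W, k ≫ w = t) ↔ ∃ l : Q ⟶ V, l ≫ n = b ≫ m)

end ToposNotions

/-- An elementary topos: a category with finite limits, exponentials and a subobject classifier. -/
structure IsElementaryTopos (E : Type u) [Category.{v} E] : Prop where
  hasFiniteLimits : HasFiniteLimits E
  exponential : ∀ A B : E, ∃ (P X : E) (p : P ⟶ X) (q : P ⟶ A) (ev : P ⟶ B), IsExponential p q ev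
  classifier : HasSubobjectClassifier E

/-- A functor is logical if it preserves finite limits, exponentials and subobject classifiers. -/
structure IsLogical {E : Type w₁} [Category.{w₂} E] {F : Type w₃} [Category.{w₄} F]
    (G : E ⥤ F) : Prop where
  preservesFiniteLimits : PreservesFiniteLimits G
  exponential : ∀ {P X A B : E} (p : P ⟶ X) (q : P ⟶ A) (ev : P ⟶ B),
    IsExponential p q ev → IsExponential (G.map p) (G.map q) (G.map ev)
  classifier : ∀ {T Ω : E} (t : T ⟶ Ω), IsSubobjectClassifier t → IsSubobjectClassifier (G.map t)

set_option linter.checkUnivs false in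
/-- The objects of the 2-category `Log`: elementary toposes. -/
structure ElemTopos : Type (max (u + 1) (v + 1)) where
  carrier : Type u
  [category : Category.{v} carrier]
  isElementaryTopos : IsElementaryTopos carrier

namespace ElemTopos

attribute [instance] ElemTopos.category

/-- The 1-cells of `Log`: logical functors. -/
structure Hom (E F : ElemTopos.{v, u}) : Type (max u v) where
  functor : E.carrier ⥤ F.carrier
  isLogical : IsLogical functor

/-- The 2-cells of `Log`: natural transformations. -/
instance (E F : ElemTopos.{v, u}) : Category.{max u v} (Hom E F) where
  Hom G H := G.functor ⟶ H.functor
  id G := 𝟙 G.functor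
  comp α β := NatTrans.vcomp α β

/-- A natural isomorphism, as an invertible 2-cell of `Log`. -/
def isoMk {E F : ElemTopos.{v, u}} {G H : Hom E F} (α : G.functor ≅ H.functor) : G ≅ H where
  hom := α.hom
  inv := α.inv
  hom_inv_id := α.hom_inv_id
  inv_hom_id := α.inv_hom_id

theorem isLogical_id (E : ElemTopos.{v, u}) : IsLogical (𝟭 E.carrier) where
  preservesFiniteLimits := inferInstance
  exponential _ _ _ h := h
  classifier _ h := h

theorem isLogical_comp {E F K : ElemTopos.{v, u}} (G : Hom E F) (H : Hom F K) :
    IsLogical (G.functor ⋙ H.functor) where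
  preservesFiniteLimits :=
    have := G.isLogical.preservesFiniteLimits
    have := H.isLogical.preservesFiniteLimits
    comp_preservesFiniteLimits _ _
  exponential _ _ _ h := H.isLogical.exponential _ _ _ (G.isLogical.exponential _ _ _ h)
  classifier _ h := H.isLogical.classifier _ (G.isLogical.classifier _ h)

instance : CategoryStruct.{max u v} ElemTopos.{v, u} where
  Hom E F := Hom E F
  id E := ⟨𝟭 E.carrier, isLogical_id E⟩
  comp G H := ⟨G.functor ⋙ H.functor, isLogical_comp G H⟩

/-- The 2-category `Log` of elementary toposes, logical functors and natural transformations. -/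
instance : Bicategory.{max u v, max u v} ElemTopos.{v, u} where
  homCategory E F := inferInstanceAs (Category (Hom E F))
  whiskerLeft G _ _ η := (Functor.whiskerLeft (Hom.functor G) η :)
  whiskerRight η H := (Functor.whiskerRight η (Hom.functor H) :)
  associator G H K :=
    isoMk (Functor.associator (Hom.functor G) (Hom.functor H) (Hom.functor K))
  leftUnitor G := isoMk (Functor.leftUnitor (Hom.functor G))
  rightUnitor G := isoMk (Functor.rightUnitor (Hom.functor G))
  whiskerLeft_id _ _ := Functor.whiskerLeft_id' _
  whiskerLeft_comp _ _ _ _ _ _ := Functor.whiskerLeft_comp _ _ _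
  id_whiskerLeft _ := NatTrans.ext (funext fun _ =>
    ((Category.id_comp _).trans (Category.comp_id _)).symm)
  comp_whiskerLeft _ _ _ _ _ := NatTrans.ext (funext fun _ =>
    ((Category.id_comp _).trans (Category.comp_id _)).symm)
  id_whiskerRight _ _ := Functor.whiskerRight_id' _
  comp_whiskerRight _ _ _ := Functor.whiskerRight_comp _ _ _
  whiskerRight_id _ := NatTrans.ext (funext fun _ =>
    ((Category.id_comp _).trans (Category.comp_id _)).symm)
  whiskerRight_comp _ _ _ := NatTrans.ext (funext fun _ =>
    ((Category.id_comp _).trans (Category.comp_id _)).symm)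
  whisker_assoc _ _ _ _ _ := NatTrans.ext (funext fun _ =>
    ((Category.id_comp _).trans (Category.comp_id _)).symm)
  whisker_exchange _ θ := NatTrans.ext (funext fun _ => (NatTrans.naturality θ _).symm)
  pentagon _ _ _ _ := Functor.pentagon _ _ _ _
  triangle _ _ := Functor.triangle _ _

end ElemTopos

/-! ## Colimits in bicategories -/

open Bicategory

/-- A pseudo-cocone from a diagram `D` to `c`: 1-cells `D j ⟶ c`, commuting with the transition
1-cells of `D` up to coherent invertible 2-cells. -/
structure PseudoCocone {J : Type w₁} [Bicategory.{w₂, w₃} J] {B : Type u} [Bicategory.{v, w₄} B]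
    (D : J ⥤ᵖ B) (c : B) where
  app (j : J) : D.obj j ⟶ c
  naturality {i j : J} (f : i ⟶ j) : D.map f ≫ app j ≅ app i
  naturality_naturality {i j : J} {f g : i ⟶ j} (η : f ⟶ g) :
    D.map₂ η ▷ app j ≫ (naturality g).hom = (naturality f).hom
  naturality_id (i : J) :
    (naturality (𝟙 i)).hom = (D.mapId i).hom ▷ app i ≫ (λ_ (app i)).hom
  naturality_comp {i j k : J} (f : i ⟶ j) (g : j ⟶ k) :
    (naturality (f ≫ g)).hom = (D.mapComp f g).hom ▷ app k ≫ (α_ _ _ _).hom ≫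
      D.map f ◁ (naturality g).hom ≫ (naturality f).hom

namespace PseudoCocone

variable {J : Type w₁} [Bicategory.{w₂, w₃} J] {B : Type u} [Bicategory.{v, w₄} B]
  {D : J ⥤ᵖ B} {c d : B}

/-- Morphisms of pseudo-cocones: compatible families of 2-cells. -/
@[ext]
structure Hom (X Y : PseudoCocone D c) where
  app (j : J) : X.app j ⟶ Y.app j
  naturality {i j : J} (f : i ⟶ j) :
    (X.naturality f).hom ≫ app i = D.map f ◁ app j ≫ (Y.naturality f).hom

/-- The category of pseudo-cocones from `D` to `c`. -/
instance : Category (PseudoCocone D c) where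
  Hom X Y := Hom X Y
  id X := ⟨fun j => 𝟙 (X.app j), fun f => by simp⟩
  comp {X Y Z} α β := ⟨fun j => α.app j ≫ β.app j, fun f => by
    rw [← Category.assoc, α.naturality, Category.assoc, β.naturality, whiskerLeft_comp,
      Category.assoc]⟩
  id_comp _ := Hom.ext (funext fun _ => Category.id_comp _)
  comp_id _ := Hom.ext (funext fun _ => Category.comp_id _)
  assoc _ _ _ := Hom.ext (funext fun _ => Category.assoc _ _ _)

/-- Composition of a pseudo-cocone with 1-cells out of its vertex. -/
def precomp (X : PseudoCocone D c) (d : B) : (c ⟶ d) ⥤ PseudoCocone D d where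
  obj f :=
    { app := fun j => X.app j ≫ f
      naturality := fun g => (α_ _ _ _).symm ≪≫ whiskerRightIso (X.naturality g) f
      naturality_naturality := fun η => by
        simp [← X.naturality_naturality η]
      naturality_id := fun i => by
        simp [X.naturality_id i]
      naturality_comp := fun f g => by
        simp [X.naturality_comp f g] }
  map η := ⟨fun j => X.app j ◁ η, fun f => by
    simp [← whisker_exchange]⟩
  map_id _ := Hom.ext (funext fun _ => whiskerLeft_id _ _)
  map_comp _ _ := Hom.ext (funext fun _ => whiskerLeft_comp _ _ _)

/-- A pseudo-cocone is a colimit in the 2-categorical sense when, for every `d`, composition with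
it is an equivalence from the category of 1-cells `c ⟶ d` to the category of pseudo-cocones
from `D` to `d`. -/
def IsBicolimit (X : PseudoCocone D c) : Prop :=
  ∀ d : B, (X.precomp d).IsEquivalence

end PseudoCocone

/-! ## Statements about diagrams -/

/-- A finitely generated category: finitely many objects, and finitely many morphisms of which
every morphism is a composite. -/
def IsFinitelyGenerated (C : Type w₁) [Category.{w₂} C] : Prop :=
  Finite C ∧ ∃ W : MorphismProperty C,
    {f : Arrow C | W f.hom}.Finite ∧ W.multiplicativeClosure = ⊤

/-- Statements about diagrams of shape `C` in an elementary topos: Boolean combinations of the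
assertions that given parts of the diagram are related by the elementary topos operations. -/
inductive ToposStatement (C : Type w₁) [Category.{w₂} C] : Type (max w₁ w₂ 1)
  /-- Two parallel morphisms are equal. -/
  | eq {X Y : C} (f g : X ⟶ Y)
  /-- A morphism is a monomorphism. -/
  | mono {X Y : C} (f : X ⟶ Y)
  /-- A morphism is an epimorphism. -/
  | epi {X Y : C} (f : X ⟶ Y)
  /-- A morphism is an isomorphism. -/
  | iso {X Y : C} (f : X ⟶ Y)
  /-- A cone on a finite subdiagram is a limit. -/
  | limit (I : Type) [SmallCategory I] [FinCategory I] (K : I ⥤ C) (c : Cone K)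
  /-- A cocone on a finite subdiagram is a colimit. -/
  | colimit (I : Type) [SmallCategory I] [FinCategory I] (K : I ⥤ C) (c : Cocone K)
  /-- A product with an evaluation morphism is an exponential. -/
  | exponential {P E A B : C} (p : P ⟶ E) (q : P ⟶ A) (ev : P ⟶ B)
  /-- A relation is the membership relation of a power object. -/
  | power {M X PX : C} (m : M ⟶ X) (n : M ⟶ PX)
  /-- A morphism is a subobject classifier. -/
  | classifier {T Ω : C} (t : T ⟶ Ω)
  /-- A subobject is the existential quantification of a subobject along a morphism. -/
  | existsAlong {U X Y V : C} (m : U ⟶ X) (f : X ⟶ Y) (n : V ⟶ Y)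
  /-- A subobject is the universal quantification of a subobject along a morphism. -/
  | forallAlong {U X Y V : C} (m : U ⟶ X) (f : X ⟶ Y) (n : V ⟶ Y)
  /-- A subobject is the join of two subobjects. -/
  | sup {U V W X : C} (m : U ⟶ X) (n : V ⟶ X) (w : W ⟶ X)
  /-- A subobject is the Heyting implication of two subobjects. -/
  | imp {U V W X : C} (m : U ⟶ X) (n : V ⟶ X) (w : W ⟶ X)
  /-- Negation of statements. -/
  | not (φ : ToposStatement C)
  /-- Conjunction of statements. -/
  | and (φ ψ : ToposStatement C)

/-- A statement holds for a diagram `D` of shape `C` in a category `E`. -/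
def ToposStatement.Holds {C : Type w₁} [Category.{w₂} C] {E : Type w₃} [Category.{w₄} E]
    (D : C ⥤ E) : ToposStatement C → Prop
  | eq f g => D.map f = D.map g
  | mono f => Mono (D.map f)
  | epi f => Epi (D.map f)
  | iso f => IsIso (D.map f)
  | limit _ _ c => Nonempty (IsLimit (D.mapCone c))
  | colimit _ _ c => Nonempty (IsColimit (D.mapCocone c))
  | exponential p q ev => IsExponential (D.map p) (D.map q) (D.map ev)
  | power m n => IsPowerObject (D.map m) (D.map n)
  | classifier t => IsSubobjectClassifier (D.map t)
  | existsAlong m f n => IsExistsAlong (D.map m) (D.map f) (D.map n)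
  | forallAlong m f n => IsForallAlong (D.map m) (D.map f) (D.map n)
  | sup m n w => IsSubobjectSup (D.map m) (D.map n) (D.map w)
  | imp m n w => IsSubobjectImp (D.map m) (D.map n) (D.map w)
  | not φ => ¬ φ.Holds D
  | and φ ψ => φ.Holds D ∧ ψ.Holds D

/-! ## The diagram of toposes of continuous actions -/

section Diagram

variable (L : FirstOrder.Language.{w₁, w₂}) (A : Type u) [L.Structure A]

/-- For `S ⊆ T`, the functor `Cont(Aut(A ⊔ S)) ⥤ Cont(Aut(A ⊔ T))` restricting actions along
`Aut(A ⊔ T) → Aut(A ⊔ S)`. -/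
def contRestrict {A : Type u} [L.Structure A] {S T : Finset A} (h : S ≤ T) :
    ContSet (AutOver L S) ⥤ ContSet (AutOver L T) :=
  ContSet.restrict (autOverRestrict L h) (continuous_reductAut _)

variable {A} in
/-- Passing to the action on elements commutes with enlarging the finite set of atoms. -/
noncomputable def toContEnlargeIso {S T : Finset A} (h : S ≤ T) :
    EquivariantZFA.toCont L S ⋙ contRestrict L h ≅
      EquivariantZFA.enlarge L h ⋙ EquivariantZFA.toCont L T :=
  NatIso.ofComponents
    (fun X =>
      { hom := ⟨id, fun _ _ => rfl⟩
        inv := ⟨id, fun _ _ => rfl⟩ })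
    (fun _ => rfl)

/-- The diagram `S ↦ Cont(Aut(A ⊔ S))` of elementary toposes and logical functors, indexed by the
poset of finite sets of atoms (given that its values are elementary toposes and logical
functors). -/
def contDiagram (hC : ∀ S : Finset A, IsElementaryTopos (ContSet (AutOver L S)))
    (hR : ∀ (S T : Finset A) (h : S ≤ T), IsLogical (contRestrict L h)) :
    LocallyDiscrete (Finset A) ⥤ᵖ ElemTopos.{u, u + 1} :=
  pseudofunctorOfIsLocallyDiscrete
    (fun S => ⟨ContSet (AutOver L S.as), hC S.as⟩)
    (fun f => ⟨contRestrict L (leOfHom f.as), hR _ _ _⟩)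
    (fun S => ElemTopos.isoMk (NatIso.ofComponents
      (fun X =>
        { hom := ⟨id, fun _ _ => rfl⟩
          inv := ⟨id, fun _ _ => rfl⟩ })
      (fun _ => rfl)))
    (fun f g => ElemTopos.isoMk (NatIso.ofComponents
      (fun X =>
        { hom := ⟨id, fun _ _ => rfl⟩
          inv := ⟨id, fun _ _ => rfl⟩ })
      (fun _ => rfl)))
    (fun f g h => rfl)
    (fun f => rfl)
    (fun f => rfl)

variable {L A} {hC : ∀ S : Finset A, IsElementaryTopos (ContSet (AutOver L S))}
  {hR : ∀ (S T : Finset A) (h : S ≤ T), IsLogical (contRestrict L h)} {E : ElemTopos.{u, u + 1}}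

/-- The component at `S` of a pseudo-cocone on the diagram of toposes of continuous actions. -/
def PseudoCocone.leg (J : PseudoCocone (contDiagram L A hC hR) E) (S : Finset A) :
    ContSet (AutOver L S) ⥤ E.carrier :=
  (J.app ⟨S⟩).functor

/-- The structural isomorphisms of such a pseudo-cocone. -/
def PseudoCocone.legIso (J : PseudoCocone (contDiagram L A hC hR) E) {S T : Finset A}
    (h : S ≤ T) : contRestrict L h ⋙ J.leg T ≅ J.leg S where
  hom := (J.naturality (i := ⟨S⟩) (j := ⟨T⟩) (homOfLE h).toLoc).hom
  inv := (J.naturality (i := ⟨S⟩) (j := ⟨T⟩) (homOfLE h).toLoc).inv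
  hom_inv_id := (J.naturality (i := ⟨S⟩) (j := ⟨T⟩) (homOfLE h).toLoc).hom_inv_id
  inv_hom_id := (J.naturality (i := ⟨S⟩) (j := ⟨T⟩) (homOfLE h).toLoc).inv_hom_id

end Diagram

/-! ## Elementary topos notions in terms of underlying functions -/

section ConcreteNotions

/-! In both kinds of topos the operations are computed on underlying sets. Finite limits and
colimits, images, quantifiers and the operations on subobjects are the set-theoretic ones, and the
subobject classifier has two elements. Exponentials and power objects consist of those functions or
subsets that are compatible with all group elements in some neighbourhood of the identity. Since
`Aut(A ⊔ S)` is open in `Aut(A)`, this condition means the same at every stage and in `ZFA(A)`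
(`eventually_autOver_iff`, `eventually_autOver_restrict_iff`). Hence restriction of actions and the
embeddings into `ZFA(A)` keep, up to bijection, both the underlying sets and the internal functions
and subsets. They therefore preserve and reflect every statement (`DiagramEquiv.holds_iff`) and in
particular are logical.

`SupportedCategory` treats both cases at once. Each group element acts on the underlying sets by a
map that need only be well behaved for elements in `hom`. For actions of `G`, `hom` is the trivial
filter `⊤` and `supp` is `𝓝 1`; for `ZFA(A)`, where a given automorphism may fail to preserve a
given set, both are `𝓝 1`. A set-theoretic construction always satisfies the categorical universal
property. Conversely, once the constructions exist (`HasConcreteOperations`), a universal object is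
isomorphic to the constructed one, and isomorphisms are bijections; this turns each categorical
notion into a condition on functions.

Every continuous action of `Aut(A ⊔ S)` is the action on the elements of some symmetric set. Choose
a finite support for each `x`, and tag `x` with the restriction of `π` to this support, spelled out
with atoms. An element is represented by the set of all tags `(z, π)` with `π • z` equal to it.
Automorphisms then act on representatives in the right way (`smul_encode`) and the representation is
faithful (`encode_injective`). This makes `toCont` an equivalence and defines the embeddings.

A symmetric set or function is fixed by `Aut(A ⊔ S)` for some finite `S`, so finitely many of them
live at one stage (`exists_stageRealization`, `exists_lift`). This yields the operations of
`ZFA(A)`, the descent of finitely generated diagrams, and the colimit property. A pseudo-cocone acts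
on a symmetric function by lifting it to a stage and applying the leg there, between the structural
isomorphisms. Coherence makes the result independent of the stage (`atStage_eq`), and functoriality
is checked at a common stage. As every symmetric set is isomorphic to a realised one, this defines a
functor; it is logical because finite limits, exponentials and classifiers also come from a stage.
-/

/-- `p`, `q` and `ev` present `E` as the set of the functions `A → B` that belong to `S`. -/
structure ConcreteExponential {P E A B : Type u} (S : Set (A → B)) (p : P → E) (q : P → A)
    (ev : P → B) : Prop where
  pair : Function.Bijective fun r => (p r, q r)
  inj : ∀ e e', (∀ r r', p r = e → p r' = e' → q r = q r' → ev r = ev r') → e = e'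
  mem : ∀ f, f ∈ S ↔ ∃ e, ∀ r, p r = e → ev r = f (q r)

/-- `m` and `n` present `Q` as the set of the subsets of `X` that belong to `S`. -/
structure ConcretePower {M X Q : Type u} (S : Set (Set X)) (m : M → X) (n : M → Q) : Prop where
  pair : Function.Injective fun r => (m r, n r)
  inj : ∀ y y', (∀ x, (∃ r, m r = x ∧ n r = y) ↔ ∃ r, m r = x ∧ n r = y') → y = y'
  mem : ∀ s, s ∈ S ↔ ∃ y, ∀ x, x ∈ s ↔ ∃ r, m r = x ∧ n r = y

/-- `T` has one element, and `Ω` has exactly one further element. -/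
def ConcreteClassifier {T Ω : Type u} (t : T → Ω) : Prop :=
  ∃ τ, (∀ τ', τ' = τ) ∧ ∃ ω, ω ≠ t τ ∧ ∀ w, w = t τ ∨ w = ω

/-- Every compatible family is given by a unique element of `P`. -/
def ConcreteLimit {I : Type} [SmallCategory I] {K : I → Type u} (k : ∀ i j, (i ⟶ j) → K i → K j)
    {P : Type u} (π : ∀ i, P → K i) : Prop :=
  (∀ i j (f : i ⟶ j) y, k i j f (π i y) = π j y) ∧
  ∀ x : ∀ i, K i, (∀ i j (f : i ⟶ j), k i j f (x i) = x j) → ∃! y, ∀ i, π i y = x i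

/-- Every compatible family of functions factors uniquely through `P`. -/
def ConcreteColimit {I : Type} [SmallCategory I] {K : I → Type u}
    (k : ∀ i j, (i ⟶ j) → K i → K j) {P : Type u} (ι : ∀ i, K i → P) : Prop :=
  (∀ i j (f : i ⟶ j) x, ι j (k i j f x) = ι i x) ∧
  ∀ (Z : Type u) (s : ∀ i, K i → Z), (∀ i j (f : i ⟶ j) x, s j (k i j f x) = s i x) →
    ∃! h : P → Z, ∀ i x, h (ι i x) = s i x

/-- Every pair of elements with the same image comes from a unique element of `P`. -/
def ConcretePullback {P X Y Z : Type u} (p : P → X) (q : P → Y) (f : X → Z) (g : Y → Z) : Prop :=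
  (∀ r, f (p r) = g (q r)) ∧ ∀ x y, f x = g y → ∃! r, p r = x ∧ q r = y

/-- A point outside all the images could be separated from the constant predicate `True` without
changing the composites with the coprojections, contradicting uniqueness of the induced map into
propositions. -/
theorem ConcreteColimit.jointly_surjective {I : Type} [SmallCategory I] {K : I → Type u}
    {k : ∀ i j, (i ⟶ j) → K i → K j} {P : Type u} {ι : ∀ i, K i → P} (h : ConcreteColimit k ι)
    (y : P) : ∃ i x, ι i x = y := by
  classical
  by_contra hy
  obtain ⟨_, -, hu⟩ := h.2 (ULift Prop) (fun _ _ => ⟨True⟩) (fun _ _ _ _ => rfl)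
  have h₁ := hu (fun _ => ⟨True⟩) (fun _ _ => rfl)
  have h₂ := hu (fun z => ⟨z ≠ y⟩) (fun i x => by
    have : ι i x ≠ y := fun e => hy ⟨i, x, e⟩
    simp [this])
  have h₃ := congrFun (h₁.trans h₂.symm) y
  simpa using congrArg ULift.down h₃

end ConcreteNotions

/-! ## Categories of sets with partially defined actions -/

/-- A category of sets and functions in which the morphisms are the functions that commute with the
action of `hom`-almost all elements of `Γ`. A second filter `supp` describes which
functions and subsets are internal. -/
class SupportedCategory (C : Type (u + 1)) [Category.{u} C] where
  car : C → Type u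
  fn : ∀ {X Y : C}, (X ⟶ Y) → car X → car Y
  fn_id : ∀ X : C, fn (𝟙 X) = id
  fn_comp : ∀ {X Y Z : C} (f : X ⟶ Y) (g : Y ⟶ Z), fn (f ≫ g) = fn g ∘ fn f
  fn_injective : ∀ {X Y : C}, Function.Injective (fn (X := X) (Y := Y))
  Γ : Type u
  act : ∀ X : C, Γ → car X → car X
  hom : Filter Γ
  supp : Filter Γ
  supp_le : supp ≤ hom
  act_bijective : ∀ X : C, ∀ᶠ g in hom, Function.Bijective (act X g)
  act_eq_self : ∀ (X : C) (x : car X), ∀ᶠ g in supp, act X g x = x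
  fn_act : ∀ {X Y : C} (f : X ⟶ Y), ∀ᶠ g in hom, ∀ x, fn f (act X g x) = act Y g (fn f x)
  exists_hom : ∀ {X Y : C} (h : car X → car Y),
    (∀ᶠ g in hom, ∀ x, h (act X g x) = act Y g (h x)) → ∃ f : X ⟶ Y, fn f = h

namespace SupportedCategory

section

variable {C : Type (u + 1)} [Category.{u} C] [SupportedCategory C]

/-- The internal functions. -/
def suppFun (X Y : C) : Set (car X → car Y) :=
  {f | ∀ᶠ g in supp (C := C), ∀ x, f (act X g x) = act Y g (f x)}

/-- The internal subsets. -/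
def suppSet (X : C) : Set (Set (car X)) :=
  {s | ∀ᶠ g in supp (C := C), ∀ x, act X g x ∈ s ↔ x ∈ s}

theorem fn_comp_apply {X Y Z : C} (f : X ⟶ Y) (g : Y ⟶ Z) (x : car X) :
    fn (f ≫ g) x = fn g (fn f x) :=
  congrFun (fn_comp f g) x

theorem fn_id_apply (X : C) (x : car X) : fn (𝟙 X) x = x := congrFun (fn_id X) x

theorem hom_ext {X Y : C} {f g : X ⟶ Y} (h : ∀ x, fn f x = fn g x) : f = g :=
  fn_injective (funext h)

theorem fn_congr {X Y : C} {f g : X ⟶ Y} (h : f = g) (x : car X) : fn f x = fn g x := by rw [h]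

/-- The inverse function commutes with every group element with which the function itself commutes,
so it underlies a morphism. -/
theorem isIso_of_bijective {X Y : C} (f : X ⟶ Y) (hf : Function.Bijective (fn f)) : IsIso f := by
  obtain ⟨h, hl, hr⟩ := Function.bijective_iff_has_inverse.1 hf
  obtain ⟨k, hk⟩ := exists_hom (X := Y) (Y := X) h (by
    filter_upwards [fn_act f] with g hg y
    apply hf.1
    rw [hr, hg, hr])
  refine ⟨k, hom_ext fun x => ?_, hom_ext fun x => ?_⟩
  · rw [fn_comp_apply, hk, hl, fn_id_apply]
  · rw [fn_comp_apply, hk, hr, fn_id_apply]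

theorem bijective_of_isIso {X Y : C} (f : X ⟶ Y) [IsIso f] : Function.Bijective (fn f) := by
  refine Function.bijective_iff_has_inverse.2 ⟨fn (inv f), fun x => ?_, fun x => ?_⟩
  · rw [← fn_comp_apply, IsIso.hom_inv_id, fn_id_apply]
  · rw [← fn_comp_apply, IsIso.inv_hom_id, fn_id_apply]

theorem isIso_iff {X Y : C} (f : X ⟶ Y) : IsIso f ↔ Function.Bijective (fn f) :=
  ⟨fun _ => bijective_of_isIso f, isIso_of_bijective f⟩

/-- A function determined by an injective morphism is a morphism. -/
theorem exists_factor {X Y V : C} (m : V ⟶ Y) (hm : Function.Injective (fn m)) (f : X ⟶ Y)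
    (hf : ∀ x, ∃ v, fn m v = fn f x) : ∃ k : X ⟶ V, k ≫ m = f := by
  choose h hh using hf
  obtain ⟨k, hk⟩ := exists_hom (X := X) (Y := V) h (by
    filter_upwards [fn_act f, fn_act m] with g h₁ h₂ x
    apply hm
    rw [hh, h₁, h₂, hh])
  exact ⟨k, hom_ext fun x => by rw [fn_comp_apply, hk, hh]⟩

theorem exists_factor_iff {X Y V : C} (m : V ⟶ Y) (hm : Function.Injective (fn m)) (f : X ⟶ Y) :
    (∃ k : X ⟶ V, k ≫ m = f) ↔ Set.range (fn f) ⊆ Set.range (fn m) := by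
  constructor
  · rintro ⟨k, rfl⟩ _ ⟨x, rfl⟩
    exact ⟨fn k x, (fn_comp_apply k m x).symm⟩
  · exact fun h => exists_factor m hm f fun x => h ⟨x, rfl⟩

theorem fn_cone_w {I : Type} [SmallCategory I] {K : I ⥤ C} (c : Cone K) {i j : I} (f : i ⟶ j)
    (y : car c.pt) : fn (K.map f) (fn (c.π.app i) y) = fn (c.π.app j) y :=
  (fn_comp_apply (c.π.app i) (K.map f) y).symm.trans (fn_congr (c.w f) y)

theorem fn_cocone_w {I : Type} [SmallCategory I] {K : I ⥤ C} (c : Cocone K) {i j : I} (f : i ⟶ j)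
    (x : car (K.obj i)) : fn (c.ι.app j) (fn (K.map f) x) = fn (c.ι.app i) x :=
  (fn_comp_apply (K.map f) (c.ι.app j) x).symm.trans (fn_congr (c.w f) x)

/-- The induced function commutes with the action because it is unique. Finiteness of the shape lets
the filter conditions for the separate components be imposed simultaneously. -/
theorem isLimit_of_concrete {I : Type} [SmallCategory I] [FinCategory I] {K : I ⥤ C} (c : Cone K)
    (hc : ConcreteLimit (fun _ _ f => fn (K.map f)) fun i => fn (c.π.app i)) :
    Nonempty (IsLimit c) := by
  have key : ∀ s : Cone K, ∃ l : s.pt ⟶ c.pt, ∀ i, l ≫ c.π.app i = s.π.app i := by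
    intro s
    have h₁ : ∀ y : car s.pt, ∃! z : car c.pt, ∀ i, fn (c.π.app i) z = fn (s.π.app i) y := fun y =>
      hc.2 (fun i => fn (s.π.app i) y) fun i j f => fn_cone_w s f y
    choose h hh hu using h₁
    obtain ⟨l, hl⟩ := exists_hom (X := s.pt) (Y := c.pt) h (by
      filter_upwards [Filter.eventually_all.2 fun i => fn_act (s.π.app i),
        Filter.eventually_all.2 fun i => fn_act (c.π.app i)] with g h₁ h₂ y
      refine (hu _ _ fun i => ?_).symm
      exact (h₂ i (h y)).trans ((congrArg (act (K.obj i) g) (hh y i)).trans (h₁ i y).symm))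
    exact ⟨l, fun i => hom_ext fun y => by rw [fn_comp_apply, hl, hh]⟩
  choose l hl using key
  refine ⟨⟨l, hl, fun s m hm => hom_ext fun y => ?_⟩⟩
  refine (hc.2 (fun i => fn (s.π.app i) y) fun i j f =>
    fn_cone_w s f y).unique (fun i => ?_) fun i => ?_
  · rw [← hm, fn_comp_apply]
  · rw [← hl, fn_comp_apply]

/-- Compatibility of the induced function with the action can be tested on the images of the
coprojections, since these cover the vertex. -/
theorem isColimit_of_concrete {I : Type} [SmallCategory I] [FinCategory I] {K : I ⥤ C}
    (c : Cocone K) (hc : ConcreteColimit (fun _ _ f => fn (K.map f)) fun i => fn (c.ι.app i)) :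
    Nonempty (IsColimit c) := by
  have key : ∀ s : Cocone K, ∃ l : c.pt ⟶ s.pt, ∀ i, c.ι.app i ≫ l = s.ι.app i := by
    intro s
    obtain ⟨h, hh, -⟩ := hc.2 (car s.pt) (fun i => fn (s.ι.app i)) fun i j f x =>
      fn_cocone_w s f x
    obtain ⟨l, hl⟩ := exists_hom (X := c.pt) (Y := s.pt) h (by
      filter_upwards [Filter.eventually_all.2 fun i => fn_act (s.ι.app i),
        Filter.eventually_all.2 fun i => fn_act (c.ι.app i)] with g h₁ h₂ y
      obtain ⟨i, x, rfl⟩ := hc.jointly_surjective y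
      exact (congrArg h (h₂ i x).symm).trans
        ((hh i _).trans ((h₁ i x).trans (congrArg (act s.pt g) (hh i x).symm))))
    exact ⟨l, fun i => hom_ext fun y => by rw [fn_comp_apply, hl, hh]⟩
  choose l hl using key
  refine ⟨⟨l, hl, fun s m hm => hom_ext fun y => ?_⟩⟩
  obtain ⟨i, x, rfl⟩ := hc.jointly_surjective y
  rw [← fn_comp_apply, ← fn_comp_apply, hm, hl]

theorem isBinaryProduct_of_bijective {P X Y : C} (p : P ⟶ X) (q : P ⟶ Y)
    (h : Function.Bijective fun r => (fn p r, fn q r)) : IsBinaryProduct p q := by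
  refine isLimit_of_concrete _ ⟨?_, fun x _ => ?_⟩
  · exact fun i j f y => fn_cone_w (BinaryFan.mk p q) f y
  · obtain ⟨r, hr, hu⟩ := h.existsUnique (x ⟨.left⟩, x ⟨.right⟩)
    refine ⟨r, ?_, fun r' hr' => hu r' (Prod.ext (hr' ⟨.left⟩) (hr' ⟨.right⟩))⟩
    rintro ⟨_ | _⟩
    · exact congrArg Prod.fst hr
    · exact congrArg Prod.snd hr

theorem isTerminal_of_unique {T : C} (τ : car T) (h : ∀ τ', τ' = τ) : Nonempty (IsTerminal T) := by
  have key : ∀ X : C, ∃ f : X ⟶ T, True := fun X => by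
    obtain ⟨f, -⟩ := exists_hom (X := X) (Y := T) (fun _ => τ)
      (Filter.Eventually.of_forall fun g x => (h _).symm)
    exact ⟨f, trivial⟩
  choose f _ using key
  exact ⟨IsTerminal.ofUniqueHom f fun X m => hom_ext fun x => (h _).trans (h _).symm⟩

theorem isPullback_of_concrete {P X Y Z : C} {p : P ⟶ X} {q : P ⟶ Y} {f : X ⟶ Z} {g : Y ⟶ Z}
    (h : ConcretePullback (fn p) (fn q) (fn f) (fn g)) : IsPullback p q f g := by
  have w : p ≫ f = q ≫ g := hom_ext fun r => by
    rw [fn_comp_apply, fn_comp_apply, h.1]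
  refine ⟨⟨w⟩, isLimit_of_concrete _ ⟨?_, fun x hx => ?_⟩⟩
  · exact fun i j f y => fn_cone_w (PullbackCone.mk p q w) f y
  · have h₁ := hx .left .one WalkingCospan.Hom.inl
    have h₂ := hx .right .one WalkingCospan.Hom.inr
    obtain ⟨r, hr, hu⟩ := h.2 (x .left) (x .right) (h₁.trans h₂.symm)
    refine ⟨r, ?_, fun r' hr' => hu r' ⟨hr' .left, hr' .right⟩⟩
    rintro (_ | _ | _)
    · refine Eq.trans ?_ h₁
      change fn (p ≫ f) r = fn f _
      rw [fn_comp_apply, hr.1]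
    · exact hr.1
    · exact hr.2

theorem mono_of_injective {X Y : C} (f : X ⟶ Y) (hf : Function.Injective (fn f)) : Mono f :=
  ⟨fun a b h => hom_ext fun x => hf (by rw [← fn_comp_apply, h, fn_comp_apply])⟩

theorem epi_of_surjective {X Y : C} (f : X ⟶ Y) (hf : Function.Surjective (fn f)) : Epi f :=
  ⟨fun a b h => hom_ext fun y => by
    obtain ⟨x, rfl⟩ := hf y
    rw [← fn_comp_apply, h, fn_comp_apply]⟩

/-- Surjectivity of the action on the source and injectivity on the target are needed for the
implication from left to right. -/
theorem eventually_act_mem_range {X Y : C} (f : X ⟶ Y) :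
    ∀ᶠ g in hom (C := C), ∀ y, act Y g y ∈ Set.range (fn f) ↔ y ∈ Set.range (fn f) := by
  filter_upwards [fn_act f, act_bijective X, act_bijective Y] with g h₁ h₂ h₃ y
  constructor
  · rintro ⟨x, hx⟩
    obtain ⟨x, rfl⟩ := h₂.2 x
    rw [h₁] at hx
    exact ⟨x, h₃.1 hx⟩
  · rintro ⟨x, rfl⟩
    exact ⟨act X g x, h₁ x⟩

/-- Transposition is the usual one for sets. For a fixed `ζ` the curried function is internal
because elements in `supp` fix `ζ`; the transpose is a morphism because an element of `E` is
determined by the function that it names. -/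
theorem isExponential_of_concrete {P E A B : C} (p : P ⟶ E) (q : P ⟶ A) (ev : P ⟶ B)
    (h : ConcreteExponential (suppFun A B) (fn p) (fn q) (fn ev))
    (bij : ∀ {Q X Y : C} (z : Q ⟶ X) (a : Q ⟶ Y), IsBinaryProduct z a →
      Function.Bijective fun r => (fn z r, fn a r)) : IsExponential p q ev := by
  refine ⟨isBinaryProduct_of_bijective p q h.pair, fun Q Z z a hza g => ?_⟩
  have hb := bij z a hza
  -- `r` is the inverse of the pairing, so it assigns to `(ζ, α)` the point of `Q` above it.
  choose r hr using fun ζα : car Z × car A => hb.2 ζα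
  have hr₁ : ∀ ζ α, fn z (r (ζ, α)) = ζ := fun ζ α => congrArg Prod.fst (hr (ζ, α))
  have hr₂ : ∀ ζ α, fn a (r (ζ, α)) = α := fun ζ α => congrArg Prod.snd (hr (ζ, α))
  have hru : ∀ s, r (fn z s, fn a s) = s := fun s => hb.1 (hr _)
  have hract : ∀ᶠ γ in hom (C := C), ∀ ζ α,
      r (act Z γ ζ, act A γ α) = act Q γ (r (ζ, α)) := by
    filter_upwards [fn_act z, fn_act a] with γ h₁ h₂ ζ α
    rw [← hru (act Q γ (r (ζ, α))), h₁, h₂, hr₁, hr₂]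
  have hsupp : ∀ ζ, (fun α => fn g (r (ζ, α))) ∈ suppFun A B := by
    intro ζ
    change ∀ᶠ γ in supp (C := C), _
    filter_upwards [supp_le hract, supp_le (fn_act g), act_eq_self Z ζ] with γ h₁ h₂ h₃ α
    have := h₁ ζ α
    rw [h₃] at this
    rw [this, h₂]
  choose e he using fun ζ => (h.mem _).1 (hsupp ζ)
  have heact : ∀ᶠ γ in hom (C := C), ∀ ζ, e (act Z γ ζ) = act E γ (e ζ) := by
    filter_upwards [hract, fn_act g, fn_act p, fn_act q, fn_act ev, act_bijective P]
      with γ h₁ h₂ h₃ h₄ h₅ h₆ ζ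
    refine h.inj _ _ fun s s' hs hs' hq => ?_
    obtain ⟨s', rfl⟩ := h₆.2 s'
    -- `s₀` is the point at which `e ζ` is evaluated at the second coordinate of `s'`; moving it by
    -- `γ` gives the point at which the translate of `e ζ` is evaluated.
    obtain ⟨s₀, hs₀⟩ := h.pair.2 (e ζ, fn q s')
    have hs₀₁ : fn p s₀ = e ζ := congrArg Prod.fst hs₀
    have hs₀₂ : fn q s₀ = fn q s' := congrArg Prod.snd hs₀
    have : act P γ s' = act P γ s₀ := h.pair.1 (Prod.ext
      (by change fn p _ = fn p _; rw [hs', h₃, hs₀₁])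
      (by change fn q _ = fn q _; rw [h₄, h₄, hs₀₂]))
    rw [this, h₅, he ζ s₀ hs₀₁, ← h₂, ← h₁, he _ s hs, hq, this, h₄]
  obtain ⟨l, hl⟩ := exists_hom (X := Z) (Y := E) e heact
  obtain ⟨hP⟩ := isBinaryProduct_of_bijective p q h.pair
  refine ⟨l, ⟨BinaryFan.IsLimit.lift hP (z ≫ l) a, ?_, ?_, ?_⟩, ?_⟩
  · exact hP.fac _ ⟨.left⟩
  · exact hP.fac _ ⟨.right⟩
  · have hk₁ : BinaryFan.IsLimit.lift hP (z ≫ l) a ≫ p = z ≫ l := hP.fac _ ⟨.left⟩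
    have hk₂ : BinaryFan.IsLimit.lift hP (z ≫ l) a ≫ q = a := hP.fac _ ⟨.right⟩
    refine hom_ext fun s => ?_
    rw [fn_comp_apply, he (fn z s), ← fn_comp_apply, hk₂, hru]
    rw [← fn_comp_apply, hk₁, fn_comp_apply, hl]
  · rintro l' ⟨k', hk₁, hk₂, hk₃⟩
    refine hom_ext fun ζ => ?_
    rw [hl]
    refine h.inj _ _ fun s s' hs hs' hq => ?_
    have : s = fn k' (r (ζ, fn q s)) := by
      apply h.pair.1
      apply Prod.ext
      · change fn p _ = fn p _
        rw [← fn_comp_apply, hk₁, fn_comp_apply, hr₁, hs]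
      · change fn q _ = fn q _
        rw [← fn_comp_apply, hk₂, hr₂]
    rw [he ζ s' hs', ← hq, this, ← fn_comp_apply, hk₃, ← fn_comp_apply, hk₂, hr₂]

/-- The classifying map sends `y` to the set of all `x` related to it. This set is internal because
elements in `supp` fix `y`, and the map is equivariant because elements of `Q` are determined by
their members. -/
theorem isPowerObject_of_concrete {M X Q : C} (m : M ⟶ X) (n : M ⟶ Q)
    (h : ConcretePower (suppSet X) (fn m) (fn n))
    (rel : ∀ {R X Y : C} (r : R ⟶ X) (s : R ⟶ Y), IsRelation r s →
      Function.Injective fun ρ => (fn r ρ, fn s ρ))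
    (pb : ∀ {P X Y Z : C} {p : P ⟶ X} {q : P ⟶ Y} {f : X ⟶ Z} {g : Y ⟶ Z}, IsPullback p q f g →
      ConcretePullback (fn p) (fn q) (fn f) (fn g)) : IsPowerObject m n := by
  refine ⟨fun Z f g h₁ h₂ => hom_ext fun z => h.pair (Prod.ext ?_ ?_), fun R Y r s hrs => ?_⟩
  · change fn m _ = fn m _
    rw [← fn_comp_apply, h₁, fn_comp_apply]
  · change fn n _ = fn n _
    rw [← fn_comp_apply, h₂, fn_comp_apply]
  have hR := rel r s hrs
  have hact : ∀ᶠ γ in hom (C := C), ∀ x y,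
      (∃ ρ, fn r ρ = act X γ x ∧ fn s ρ = act Y γ y) ↔ ∃ ρ, fn r ρ = x ∧ fn s ρ = y := by
    filter_upwards [fn_act r, fn_act s, act_bijective R, act_bijective X, act_bijective Y]
      with γ h₁ h₂ h₃ h₄ h₅ x y
    constructor
    · rintro ⟨ρ, e₁, e₂⟩
      obtain ⟨ρ, rfl⟩ := h₃.2 ρ
      exact ⟨ρ, h₄.1 ((h₁ ρ).symm.trans e₁), h₅.1 ((h₂ ρ).symm.trans e₂)⟩
    · rintro ⟨ρ, rfl, rfl⟩
      exact ⟨_, h₁ ρ, h₂ ρ⟩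
  have hactm : ∀ᶠ γ in hom (C := C), ∀ x y,
      (∃ ρ, fn m ρ = act X γ x ∧ fn n ρ = act Q γ y) ↔ ∃ ρ, fn m ρ = x ∧ fn n ρ = y := by
    filter_upwards [fn_act m, fn_act n, act_bijective M, act_bijective X, act_bijective Q]
      with γ h₁ h₂ h₃ h₄ h₅ x y
    constructor
    · rintro ⟨ρ, e₁, e₂⟩
      obtain ⟨ρ, rfl⟩ := h₃.2 ρ
      exact ⟨ρ, h₄.1 ((h₁ ρ).symm.trans e₁), h₅.1 ((h₂ ρ).symm.trans e₂)⟩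
    · rintro ⟨ρ, rfl, rfl⟩
      exact ⟨_, h₁ ρ, h₂ ρ⟩
  have hsupp : ∀ y, {x | ∃ ρ, fn r ρ = x ∧ fn s ρ = y} ∈ suppSet X := by
    intro y
    change ∀ᶠ γ in supp (C := C), _
    filter_upwards [supp_le hact, act_eq_self Y y] with γ h₁ h₂ x
    have := h₁ x y
    rwa [h₂] at this
  choose e he using fun y => (h.mem _).1 (hsupp y)
  replace he : ∀ y x, (∃ ρ, fn r ρ = x ∧ fn s ρ = y) ↔ ∃ ρ, fn m ρ = x ∧ fn n ρ = e y := he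
  obtain ⟨χ, hχ⟩ := exists_hom (X := Y) (Y := Q) e (by
    filter_upwards [hact, hactm, act_bijective X] with γ h₁ h₂ h₃ y
    refine h.inj _ _ fun x => ?_
    obtain ⟨x, rfl⟩ := h₃.2 x
    rw [← he, h₁, h₂, he])
  choose t ht₁ ht₂ using fun ρ : car R => (he (fn s ρ) (fn r ρ)).1 ⟨ρ, rfl, rfl⟩
  obtain ⟨τ, hτ⟩ := exists_hom (X := R) (Y := M) t (by
    filter_upwards [fn_act r, fn_act s, fn_act m, fn_act n, fn_act χ] with γ h₁ h₂ h₃ h₄ h₅ ρ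
    refine h.pair (Prod.ext ?_ ?_)
    · change fn m _ = fn m _
      rw [ht₁, h₁, h₃, ht₁]
    · change fn n _ = fn n _
      rw [ht₂, h₂, h₄, ht₂, ← hχ, h₅])
  refine ⟨χ, ⟨τ, hom_ext fun ρ => ?_, isPullback_of_concrete ⟨fun ρ => ?_, fun y μ hy => ?_⟩⟩, ?_⟩
  · rw [fn_comp_apply, hτ, ht₁]
  · rw [hτ, hχ, ht₂]
  · rw [hχ] at hy
    obtain ⟨ρ, h₁, rfl⟩ := (he y (fn m μ)).2 ⟨μ, rfl, hy.symm⟩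
    refine ⟨ρ, ⟨rfl, ?_⟩, fun ρ' ⟨hs, hm⟩ => hR (Prod.ext ?_ hs)⟩
    · rw [hτ]
      refine h.pair (Prod.ext ?_ ?_)
      · exact (ht₁ ρ).trans h₁
      · exact (ht₂ ρ).trans hy
    · change fn r _ = fn r _
      rw [h₁, ← hm, hτ, ht₁]
  · rintro χ' ⟨τ', hτ', hpb⟩
    have hpb := pb hpb
    refine hom_ext fun y => h.inj _ _ fun x => ?_
    rw [hχ, ← he]
    constructor
    · rintro ⟨μ, rfl, hμ⟩
      obtain ⟨ρ, ⟨h₁, h₂⟩, -⟩ := hpb.2 y μ hμ.symm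
      exact ⟨ρ, by rw [← hτ', fn_comp_apply, h₂], h₁⟩
    · rintro ⟨ρ, rfl, rfl⟩
      exact ⟨fn τ' ρ, by rw [← fn_comp_apply, hτ'], (hpb.1 ρ).symm⟩

/-- The characteristic function is the classical two-valued one. It is equivariant since the range
of a morphism is invariant and both truth values are fixed: `fn t τ` because `T` is a singleton, and
`ω` because the action on `Ω` is bijective. -/
theorem isSubobjectClassifier_of_concrete {T Ω : C} (t : T ⟶ Ω) (h : ConcreteClassifier (fn t))
    (inj : ∀ {X Y : C} (m : X ⟶ Y), Mono m → Function.Injective (fn m))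
    (pb : ∀ {P X Y Z : C} {p : P ⟶ X} {q : P ⟶ Y} {f : X ⟶ Z} {g : Y ⟶ Z}, IsPullback p q f g →
      ConcretePullback (fn p) (fn q) (fn f) (fn g)) : IsSubobjectClassifier t := by
  classical
  obtain ⟨τ, hτ, ω, hω, hΩ⟩ := h
  obtain ⟨hT⟩ := isTerminal_of_unique τ hτ
  refine ⟨⟨hT⟩, fun U X m hm => ?_⟩
  have hm := inj m hm
  obtain ⟨χ, hχ⟩ := exists_hom (X := X) (Y := Ω)
    (fun x => if x ∈ Set.range (fn m) then fn t τ else ω) (by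
      filter_upwards [eventually_act_mem_range m, fn_act t, act_bijective Ω] with g h₁ h₂ h₃ x
      have h₄ : act Ω g (fn t τ) = fn t τ := by rw [← h₂, hτ (act T g τ)]
      have h₅ : act Ω g ω = ω := (hΩ _).resolve_left fun h => hω (h₃.1 (h.trans h₄.symm))
      simp only [h₁]
      split_ifs
      · exact h₄.symm
      · exact h₅.symm)
  refine ⟨χ, ⟨hT.from U, isPullback_of_concrete ⟨fun r => ?_, fun x τ' hx => ?_⟩⟩, ?_⟩
  · rw [hχ, hτ (fn _ r)]
    exact if_pos ⟨r, rfl⟩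
  · rw [hχ, hτ τ'] at hx
    have : x ∈ Set.range (fn m) := by
      by_contra hx'
      exact hω ((if_neg hx').symm.trans hx)
    obtain ⟨r, rfl⟩ := this
    exact ⟨r, ⟨rfl, (hτ _).trans (hτ _).symm⟩, fun r' hr' => hm hr'.1⟩
  · rintro χ' ⟨k, hk⟩
    have hk := pb hk
    refine hom_ext fun x => ?_
    rw [hχ]
    dsimp only
    split_ifs with hx
    · obtain ⟨r, rfl⟩ := hx
      rw [hk.1, hτ (fn k r)]
    · refine (hΩ _).resolve_left fun hx' => hx ?_
      obtain ⟨r, hr, -⟩ := hk.2 x τ hx'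
      exact ⟨r, hr.1⟩

end

end SupportedCategory

/-! ### Limits, monomorphisms, epimorphisms and relations on underlying sets -/

namespace SupportedCategory

/-- A supported category in which the elementary topos operations can be performed on the
underlying sets. -/
class HasConcreteOperations (C : Type (u + 1)) [Category.{u} C] [SupportedCategory C] : Prop where
  exists_sub : ∀ (X : C) (s : Set (car X)),
    (∀ᶠ g in hom (C := C), ∀ x, act X g x ∈ s ↔ x ∈ s) →
      ∃ (V : C) (m : V ⟶ X), Function.Injective (fn m) ∧ Set.range (fn m) = s
  exists_limit : ∀ (I : Type) [SmallCategory I] [FinCategory I] (K : I ⥤ C),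
    ∃ c : Cone K, ConcreteLimit (fun _ _ f => fn (K.map f)) fun i => fn (c.π.app i)
  exists_colimit : ∀ (I : Type) [SmallCategory I] [FinCategory I] (K : I ⥤ C),
    ∃ c : Cocone K, ConcreteColimit (fun _ _ f => fn (K.map f)) fun i => fn (c.ι.app i)
  exists_exponential : ∀ A B : C, ∃ (P E : C) (p : P ⟶ E) (q : P ⟶ A) (ev : P ⟶ B),
    ConcreteExponential (suppFun A B) (fn p) (fn q) (fn ev)
  exists_power : ∀ X : C, ∃ (M Q : C) (m : M ⟶ X) (n : M ⟶ Q),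
    ConcretePower (suppSet X) (fn m) (fn n)
  exists_classifier : ∃ (T Ω : C) (t : T ⟶ Ω), ConcreteClassifier (fn t)

open HasConcreteOperations

variable {C : Type (u + 1)} [Category.{u} C] [SupportedCategory C] [HasConcreteOperations C]

/-- Any limit cone is isomorphic to the constructed one, and the underlying function of the
isomorphism is a bijection along which the concrete property is moved. The characterisations of
colimits, exponentials, power objects and classifiers rest on the same comparison. -/
theorem isLimit_iff {I : Type} [SmallCategory I] [FinCategory I] {K : I ⥤ C} (c : Cone K) :
    Nonempty (IsLimit c) ↔
      ConcreteLimit (fun _ _ f => fn (K.map f)) fun i => fn (c.π.app i) := by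
  refine ⟨fun ⟨hc⟩ => ⟨fun i j f y => fn_cone_w c f y, fun x hx => ?_⟩, isLimit_of_concrete c⟩
  obtain ⟨d, hd⟩ := exists_limit I K
  obtain ⟨hd'⟩ := isLimit_of_concrete d hd
  have hb := bijective_of_isIso (hc.conePointUniqueUpToIso hd').hom
  have hπ : ∀ i y, fn (d.π.app i) (fn (hc.conePointUniqueUpToIso hd').hom y) =
      fn (c.π.app i) y := fun i y =>
    (fn_comp_apply _ (d.π.app i) y).symm.trans
      (fn_congr (hc.conePointUniqueUpToIso_hom_comp hd' i) y)
  obtain ⟨y, hy, hu⟩ := hd.2 x hx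
  obtain ⟨y, rfl⟩ := hb.2 y
  refine ⟨y, fun i => (hπ i y).symm.trans (hy i), fun y' hy' => hb.1 (hu _ fun i => ?_)⟩
  exact (hπ i y').trans (hy' i)

theorem isColimit_iff {I : Type} [SmallCategory I] [FinCategory I] {K : I ⥤ C} (c : Cocone K) :
    Nonempty (IsColimit c) ↔
      ConcreteColimit (fun _ _ f => fn (K.map f)) fun i => fn (c.ι.app i) := by
  refine ⟨fun ⟨hc⟩ => ⟨fun i j f y => fn_cocone_w c f y, fun Z s hs => ?_⟩, isColimit_of_concrete c⟩
  obtain ⟨d, hd⟩ := exists_colimit I K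
  obtain ⟨hd'⟩ := isColimit_of_concrete d hd
  have hb := bijective_of_isIso (hc.coconePointUniqueUpToIso hd').hom
  have hι : ∀ i x, fn (hc.coconePointUniqueUpToIso hd').hom (fn (c.ι.app i) x) =
      fn (d.ι.app i) x := fun i x =>
    (fn_comp_apply (c.ι.app i) _ x).symm.trans
      (fn_congr (hc.comp_coconePointUniqueUpToIso_hom hd' i) x)
  obtain ⟨h, hh, hu⟩ := hd.2 Z s hs
  refine ⟨h ∘ fn (hc.coconePointUniqueUpToIso hd').hom,
    fun i x => (congrArg h (hι i x)).trans (hh i x), fun h' hh' => ?_⟩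
  funext y
  -- A competing function on the given vertex is moved to the constructed vertex along the inverse
  -- of the comparison bijection, where uniqueness is known.
  have := hu (h' ∘ Function.surjInv hb.2) fun i x =>
    (congrArg (h' ∘ Function.surjInv hb.2) (hι i x).symm).trans
      ((congrArg h' (Function.leftInverse_surjInv hb _)).trans (hh' i x))
  rw [← this, Function.comp_apply, Function.comp_apply, Function.leftInverse_surjInv hb]

theorem isBinaryProduct_iff {P X Y : C} (p : P ⟶ X) (q : P ⟶ Y) :
    IsBinaryProduct p q ↔ Function.Bijective fun r => (fn p r, fn q r) := by
  refine ⟨fun h => ?_, isBinaryProduct_of_bijective p q⟩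
  have h := (isLimit_iff _).1 h
  refine Function.bijective_iff_existsUnique _ |>.2 fun xy => ?_
  obtain ⟨r, hr, hu⟩ := h.2 (fun i => match i with
    | ⟨.left⟩ => xy.1
    | ⟨.right⟩ => xy.2) (by
      rintro ⟨_ | _⟩ ⟨_ | _⟩ ⟨⟨f⟩⟩ <;> first | exact fn_id_apply _ _ | cases f)
  refine ⟨r, Prod.ext (hr ⟨.left⟩) (hr ⟨.right⟩), fun r' hr' => hu _ ?_⟩
  rintro ⟨_ | _⟩
  · exact congrArg Prod.fst hr'
  · exact congrArg Prod.snd hr'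

theorem isPullback_iff {P X Y Z : C} {p : P ⟶ X} {q : P ⟶ Y} {f : X ⟶ Z} {g : Y ⟶ Z} :
    IsPullback p q f g ↔ ConcretePullback (fn p) (fn q) (fn f) (fn g) := by
  refine ⟨fun h => ⟨fun r => ?_, fun x y hxy => ?_⟩, isPullback_of_concrete⟩
  · rw [← fn_comp_apply, h.w, fn_comp_apply]
  · obtain ⟨r, hr, hu⟩ := ((isLimit_iff _).1 h.isLimit').2 (fun i => match i with
      | .left => x
      | .right => y
      | .one => fn f x) (by
        rintro _ _ (_ | _ | _)
        · exact fn_id_apply _ _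
        · rfl
        · exact hxy.symm)
    refine ⟨r, ⟨hr .left, hr .right⟩, fun r' hr' => hu _ ?_⟩
    rintro (_ | _ | _)
    · refine Eq.trans ?_ (congrArg (fn f) hr'.1)
      exact fn_comp_apply p f r'
    · exact hr'.1
    · exact hr'.2

theorem exists_pullback {X Y Z : C} (f : X ⟶ Z) (g : Y ⟶ Z) :
    ∃ (P : C) (p : P ⟶ X) (q : P ⟶ Y), IsPullback p q f g := by
  obtain ⟨c, hc⟩ := exists_limit _ (cospan f g)
  obtain ⟨hc⟩ := isLimit_of_concrete c hc
  exact ⟨_, _, _, IsPullback.of_isLimit hc⟩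

/-- The projections of the kernel pair agree for a monomorphism, and the kernel pair contains every
pair of points with the same image. -/
theorem mono_iff {X Y : C} (f : X ⟶ Y) : Mono f ↔ Function.Injective (fn f) := by
  refine ⟨fun _ a b hab => ?_, mono_of_injective f⟩
  obtain ⟨P, p, q, h⟩ := exists_pullback f f
  have hpq : p = q := (cancel_mono f).1 h.w
  obtain ⟨r, ⟨rfl, rfl⟩, -⟩ := (isPullback_iff.1 h).2 a b hab
  rw [hpq]

theorem isSubobjectClassifier_of_concrete' {T Ω : C} {t : T ⟶ Ω}
    (h : ConcreteClassifier (fn t)) : IsSubobjectClassifier t :=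
  isSubobjectClassifier_of_concrete t h (fun m => (mono_iff m).1) isPullback_iff.1

/-- The image is a subobject, so it has a characteristic morphism. This agrees with the constantly
true morphism after composition with `f`; for an epimorphism the two coincide and the image is
everything. -/
theorem epi_iff {X Y : C} (f : X ⟶ Y) : Epi f ↔ Function.Surjective (fn f) := by
  refine ⟨fun _ y => ?_, epi_of_surjective f⟩
  obtain ⟨T, Ω, t, ht⟩ := exists_classifier (C := C)
  obtain ⟨V, m, hm, hr⟩ := exists_sub Y (Set.range (fn f)) (eventually_act_mem_range f)
  obtain ⟨χ, ⟨k, hk⟩, -⟩ := (isSubobjectClassifier_of_concrete' ht).2 m (mono_of_injective m hm)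
  obtain ⟨hT⟩ := (isSubobjectClassifier_of_concrete' ht).1
  have h : f ≫ χ = f ≫ hT.from Y ≫ t := hom_ext fun x => by
    obtain ⟨v, hv⟩ : fn f x ∈ Set.range (fn m) := hr ▸ ⟨x, rfl⟩
    obtain ⟨τ, hτ, -⟩ := ht
    rw [fn_comp_apply, ← hv, (isPullback_iff.1 hk).1, ← Category.assoc, fn_comp_apply _ t,
      hτ (fn k v)]
    exact congrArg _ (hτ _).symm
  have h' := (cancel_epi f).1 h
  obtain ⟨v, ⟨rfl, -⟩, -⟩ := (isPullback_iff.1 hk).2 y (fn (hT.from Y) y) (by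
    rw [h', fn_comp_apply])
  rw [← Set.mem_range, ← hr]
  exact ⟨v, rfl⟩

/-- For the forward direction, the pairs of points of `R` that agree under both legs form a
subobject of the kernel pair of `r`. Its two projections to `R` are equal by joint monicity. -/
theorem isRelation_iff {R X Y : C} (r : R ⟶ X) (s : R ⟶ Y) :
    IsRelation r s ↔ Function.Injective fun ρ => (fn r ρ, fn s ρ) := by
  constructor
  · intro h a b hab
    have h₁ : fn r a = fn r b := congrArg Prod.fst hab
    have h₂ : fn s a = fn s b := congrArg Prod.snd hab
    obtain ⟨P, p, q, hpq⟩ := exists_pullback r r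
    have hP := isPullback_iff.1 hpq
    obtain ⟨V, m, hm, hr⟩ := exists_sub P {z | fn s (fn p z) = fn s (fn q z)} (by
      filter_upwards [fn_act s, fn_act p, fn_act q, act_bijective Y] with g e₁ e₂ e₃ e₄ z
      rw [e₂, e₁, e₃, e₁, e₄.1.eq_iff])
    have hmpq : m ≫ p = m ≫ q := h _ _ (by rw [Category.assoc, Category.assoc, hpq.w]) <|
      hom_ext fun v => by
        have : fn m v ∈ Set.range (fn m) := ⟨v, rfl⟩
        rw [hr] at this
        have : fn s (fn p (fn m v)) = fn s (fn q (fn m v)) := this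
        simpa only [fn_comp_apply] using this
    obtain ⟨z, ⟨rfl, rfl⟩, -⟩ := hP.2 a b h₁
    obtain ⟨v, rfl⟩ : z ∈ Set.range (fn m) := hr ▸ h₂
    rw [← fn_comp_apply, hmpq, fn_comp_apply]
  · intro h Z f g h₁ h₂
    refine hom_ext fun z => h (Prod.ext ?_ ?_)
    · change fn r _ = fn r _
      rw [← fn_comp_apply, h₁, fn_comp_apply]
    · change fn s _ = fn s _
      rw [← fn_comp_apply, h₂, fn_comp_apply]

theorem isExponential_of_concrete' {P E A B : C} {p : P ⟶ E} {q : P ⟶ A} {ev : P ⟶ B}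
    (h : ConcreteExponential (suppFun A B) (fn p) (fn q) (fn ev)) : IsExponential p q ev :=
  isExponential_of_concrete p q ev h fun z a => (isBinaryProduct_iff z a).1

end SupportedCategory

/-! ### Uniqueness of universal objects up to isomorphism -/

section Uniqueness

variable {C : Type w₁} [Category.{w₂} C]

/-- Each exponential classifies the evaluation of the other; uniqueness makes the two comparisons
inverse on the exponentials, and then the product property makes them inverse on the domains of
evaluation. -/
theorem IsExponential.exists_comparison {P E P' E' A B : C} {p : P ⟶ E} {q : P ⟶ A} {ev : P ⟶ B}
    {p' : P' ⟶ E'} {q' : P' ⟶ A} {ev' : P' ⟶ B} (h : IsExponential p q ev)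
    (h' : IsExponential p' q' ev') :
    ∃ (k : P ≅ P') (l : E ≅ E'), k.hom ≫ p' = p ≫ l.hom ∧ k.hom ≫ q' = q ∧ k.hom ≫ ev' = ev := by
  obtain ⟨l, ⟨k, hk₁, hk₂, hk₃⟩, -⟩ := h'.2 p q h.1 ev
  obtain ⟨l', ⟨k', hk₁', hk₂', hk₃'⟩, -⟩ := h.2 p' q' h'.1 ev'
  have hl : l ≫ l' = 𝟙 _ := (h.2 p q h.1 ev).unique
    ⟨k ≫ k', by simp [hk₁', reassoc_of% hk₁], by simp [hk₂', hk₂], by simp [hk₃', hk₃]⟩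
    ⟨𝟙 _, by simp⟩
  have hl' : l' ≫ l = 𝟙 _ := (h'.2 p' q' h'.1 ev').unique
    ⟨k' ≫ k, by simp [hk₁, reassoc_of% hk₁'], by simp [hk₂', hk₂], by simp [hk₃', hk₃]⟩
    ⟨𝟙 _, by simp⟩
  obtain ⟨hP⟩ := h.1
  obtain ⟨hP'⟩ := h'.1
  refine ⟨⟨k, k', ?_, ?_⟩, ⟨l, l', hl, hl'⟩, hk₁, hk₂, hk₃⟩
  · refine BinaryFan.IsLimit.hom_ext hP ?_ ?_
    · simp [hk₁', reassoc_of% hk₁, hl]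
    · simp [hk₂, hk₂']
  · refine BinaryFan.IsLimit.hom_ext hP' ?_ ?_
    · simp [hk₁, reassoc_of% hk₁', hl']
    · simp [hk₂, hk₂']

theorem IsPowerObject.exists_comparison {M X Q M' Q' : C} {m : M ⟶ X} {n : M ⟶ Q}
    {m' : M' ⟶ X} {n' : M' ⟶ Q'} (h : IsPowerObject m n) (h' : IsPowerObject m' n') :
    ∃ (k : M ≅ M') (l : Q ≅ Q'), k.hom ≫ m' = m ∧ k.hom ≫ n' = n ≫ l.hom := by
  obtain ⟨l, ⟨k, hk₁, hk₂⟩, -⟩ := h'.2 m n h.1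
  obtain ⟨l', ⟨k', hk₁', hk₂'⟩, -⟩ := h.2 m' n' h'.1
  have hl : l ≫ l' = 𝟙 _ := (h.2 m n h.1).unique
    ⟨k ≫ k', by simp [hk₁, hk₁'], hk₂.paste_vert hk₂'⟩
    ⟨𝟙 _, by simp, IsPullback.id_vert n⟩
  have hl' : l' ≫ l = 𝟙 _ := (h'.2 m' n' h'.1).unique
    ⟨k' ≫ k, by simp [hk₁, hk₁'], hk₂'.paste_vert hk₂⟩
    ⟨𝟙 _, by simp, IsPullback.id_vert n'⟩
  refine ⟨⟨k, k', h.1 _ _ ?_ ?_, h'.1 _ _ ?_ ?_⟩, ⟨l, l', hl, hl'⟩, hk₁, hk₂.w.symm⟩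
  · simp [hk₁, hk₁']
  · simp [← hk₂'.w, ← reassoc_of% hk₂.w, hl]
  · simp [hk₁, hk₁']
  · simp [← hk₂.w, ← reassoc_of% hk₂'.w, hl']

theorem IsSubobjectClassifier.mono {T Ω : C} {t : T ⟶ Ω} (h : IsSubobjectClassifier t) : Mono t :=
  h.1.some.mono_from t

theorem IsSubobjectClassifier.exists_comparison {T Ω T' Ω' : C} {t : T ⟶ Ω} {t' : T' ⟶ Ω'}
    (h : IsSubobjectClassifier t) (h' : IsSubobjectClassifier t') :
    ∃ (k : T ≅ T') (l : Ω ≅ Ω'), t ≫ l.hom = k.hom ≫ t' := by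
  obtain ⟨l, ⟨k, hk⟩, -⟩ := h'.2 t h.mono
  obtain ⟨l', ⟨k', hk'⟩, -⟩ := h.2 t' h'.mono
  have hl : l ≫ l' = 𝟙 _ := (h.2 t h.mono).unique
    ⟨k ≫ k', hk.paste_vert hk'⟩ ⟨𝟙 _, IsPullback.id_vert t⟩
  have hl' : l' ≫ l = 𝟙 _ := (h'.2 t' h'.mono).unique
    ⟨k' ≫ k, hk'.paste_vert hk⟩ ⟨𝟙 _, IsPullback.id_vert t'⟩
  exact ⟨h.1.some.uniqueUpToIso h'.1.some, ⟨l, l', hl, hl'⟩,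
    hk.w.trans (congrArg (· ≫ t') (h'.1.some.hom_ext _ _))⟩

end Uniqueness

/-! ### Transport of the concrete notions along bijections -/

section Transport

/-- `f'` corresponds to `f` under bijections of the domains and codomains. -/
def Corresponds {X Y X' Y' : Type u} (a : X ≃ X') (b : Y ≃ Y') (f : X → Y) (f' : X' → Y') : Prop :=
  ∀ x, f' (a x) = b (f x)

theorem Corresponds.symm {X Y X' Y' : Type u} {a : X ≃ X'} {b : Y ≃ Y'} {f : X → Y} {f' : X' → Y'}
    (h : Corresponds a b f f') : Corresponds a.symm b.symm f' f := fun x => by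
  rw [Equiv.eq_symm_apply, ← h, Equiv.apply_symm_apply]

theorem Corresponds.injective {X Y X' Y' : Type u} {a : X ≃ X'} {b : Y ≃ Y'} {f : X → Y}
    {f' : X' → Y'} (h : Corresponds a b f f') (hf : Function.Injective f) :
    Function.Injective f' := by
  intro x y
  obtain ⟨x, rfl⟩ := a.surjective x
  obtain ⟨y, rfl⟩ := a.surjective y
  rw [h, h, b.apply_eq_iff_eq, a.apply_eq_iff_eq]
  exact fun e => hf e

theorem Corresponds.surjective {X Y X' Y' : Type u} {a : X ≃ X'} {b : Y ≃ Y'} {f : X → Y}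
    {f' : X' → Y'} (h : Corresponds a b f f') (hf : Function.Surjective f) :
    Function.Surjective f' := by
  intro y
  obtain ⟨y, rfl⟩ := b.surjective y
  obtain ⟨x, rfl⟩ := hf y
  exact ⟨a x, h x⟩

theorem Corresponds.mem_range {X Y X' Y' : Type u} {a : X ≃ X'} {b : Y ≃ Y'} {f : X → Y}
    {f' : X' → Y'} (h : Corresponds a b f f') (y : Y) : b y ∈ Set.range f' ↔ y ∈ Set.range f := by
  constructor
  · rintro ⟨x, hx⟩
    obtain ⟨x, rfl⟩ := a.surjective x
    exact ⟨x, b.injective ((h x).symm.trans hx)⟩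
  · rintro ⟨x, rfl⟩
    exact ⟨a x, h x⟩

theorem ConcreteExponential.transport {P E A B P' E' A' B' : Type u} {S : Set (A → B)}
    {S' : Set (A' → B')} {p : P → E} {q : P → A} {ev : P → B} {p' : P' → E'} {q' : P' → A'}
    {ev' : P' → B'} (h : ConcreteExponential S p q ev) {a : P ≃ P'} {b : E ≃ E'} {c : A ≃ A'}
    {d : B ≃ B'} (hp : Corresponds a b p p') (hq : Corresponds a c q q')
    (hev : Corresponds a d ev ev')
    (hS : ∀ f f', Corresponds c d f f' → (f ∈ S ↔ f' ∈ S')) :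
    ConcreteExponential S' p' q' ev' where
  pair := Function.Bijective.of_comp_iff _ a.bijective |>.1 <| by
    have : (fun r => (p' r, q' r)) ∘ a = (Equiv.prodCongr b c) ∘ fun r => (p r, q r) :=
      funext fun r => Prod.ext (hp r) (hq r)
    rw [this]
    exact (Equiv.bijective _).comp h.pair
  inj e e' he := by
    obtain ⟨e, rfl⟩ := b.surjective e
    obtain ⟨e', rfl⟩ := b.surjective e'
    refine congrArg b (h.inj e e' fun r r' h₁ h₂ h₃ => ?_)
    have := he (a r) (a r') (by rw [hp, h₁]) (by rw [hp, h₂]) (by rw [hq, hq, h₃])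
    rwa [hev, hev, d.apply_eq_iff_eq] at this
  mem f' := by
    rw [← hS (d.symm ∘ f' ∘ c) f' fun x => by simp, h.mem]
    refine b.exists_congr fun e => a.forall_congr fun r => ?_
    simp only [hp r, hq r, hev r, b.apply_eq_iff_eq, Function.comp_apply, Equiv.eq_symm_apply]

theorem ConcretePower.transport {M X Q M' X' Q' : Type u} {S : Set (Set X)} {S' : Set (Set X')}
    {m : M → X} {n : M → Q} {m' : M' → X'} {n' : M' → Q'} (h : ConcretePower S m n)
    {a : M ≃ M'} {b : X ≃ X'} {c : Q ≃ Q'} (hm : Corresponds a b m m') (hn : Corresponds a c n n')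
    (hS : ∀ s s', (∀ x, b x ∈ s' ↔ x ∈ s) → (s ∈ S ↔ s' ∈ S')) : ConcretePower S' m' n' := by
  have key : ∀ x y, (∃ r, m' r = b x ∧ n' r = c y) ↔ ∃ r, m r = x ∧ n r = y := fun x y =>
    (a.exists_congr fun r => by
      rw [hm r, hn r, b.apply_eq_iff_eq, c.apply_eq_iff_eq]).symm
  refine ⟨?_, fun y y' hy => ?_, fun s' => ?_⟩
  · intro r r'
    obtain ⟨r, rfl⟩ := a.surjective r
    obtain ⟨r', rfl⟩ := a.surjective r'
    simp only [hm r, hm r', hn r, hn r', Prod.mk.injEq, EmbeddingLike.apply_eq_iff_eq]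
    exact fun e => h.pair (Prod.ext e.1 e.2)
  · obtain ⟨y, rfl⟩ := c.surjective y
    obtain ⟨y', rfl⟩ := c.surjective y'
    refine congrArg c (h.inj y y' fun x => ?_)
    rw [← key, hy, key]
  · rw [← hS (b ⁻¹' s') s' fun x => Iff.rfl, h.mem]
    refine c.exists_congr fun y => b.forall_congr fun x => ?_
    rw [key]
    rfl

theorem ConcreteClassifier.transport {T Ω T' Ω' : Type u} {t : T → Ω} {t' : T' → Ω'}
    (h : ConcreteClassifier t) {a : T ≃ T'} {b : Ω ≃ Ω'} (ht : Corresponds a b t t') :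
    ConcreteClassifier t' := by
  obtain ⟨τ, hτ, ω, hω, hΩ⟩ := h
  refine ⟨a τ, fun τ' => ?_, b ω, ?_, fun w => ?_⟩
  · exact a.symm_apply_eq.1 (hτ _)
  · rwa [ht, Ne, b.apply_eq_iff_eq]
  · rw [ht, ← b.symm_apply_eq, ← b.symm_apply_eq]
    exact hΩ _

theorem ConcreteLimit.transport {I : Type} [SmallCategory I] {K K' : I → Type u}
    {k : ∀ i j, (i ⟶ j) → K i → K j} {k' : ∀ i j, (i ⟶ j) → K' i → K' j} {P P' : Type u}
    {π : ∀ i, P → K i} {π' : ∀ i, P' → K' i} (h : ConcreteLimit k π) {a : P ≃ P'}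
    {b : ∀ i, K i ≃ K' i} (hk : ∀ i j f, Corresponds (b i) (b j) (k i j f) (k' i j f))
    (hπ : ∀ i, Corresponds a (b i) (π i) (π' i)) : ConcreteLimit k' π' := by
  refine ⟨fun i j f y => ?_, fun x hx => ?_⟩
  · obtain ⟨y, rfl⟩ := a.surjective y
    rw [hπ i y, hk i j f, h.1, hπ j y]
  · obtain ⟨y, hy, hu⟩ := h.2 (fun i => (b i).symm (x i)) fun i j f => by
      rw [(hk i j f).symm, hx]
    refine ⟨a y, fun i => by rw [hπ i y, hy, Equiv.apply_symm_apply], fun y' hy' => ?_⟩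
    rw [← a.symm_apply_eq]
    exact hu _ fun i => by rw [← hy' i]; exact (hπ i).symm y'

theorem ConcreteColimit.transport {I : Type} [SmallCategory I] {K K' : I → Type u}
    {k : ∀ i j, (i ⟶ j) → K i → K j} {k' : ∀ i j, (i ⟶ j) → K' i → K' j} {P P' : Type u}
    {ι : ∀ i, K i → P} {ι' : ∀ i, K' i → P'} (h : ConcreteColimit k ι) {a : P ≃ P'}
    {b : ∀ i, K i ≃ K' i} (hk : ∀ i j f, Corresponds (b i) (b j) (k i j f) (k' i j f))
    (hι : ∀ i, Corresponds (b i) a (ι i) (ι' i)) : ConcreteColimit k' ι' := by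
  refine ⟨fun i j f y => ?_, fun Z s hs => ?_⟩
  · obtain ⟨y, rfl⟩ := (b i).surjective y
    rw [hk i j f, hι j, h.1, hι i y]
  · obtain ⟨l, hl, hu⟩ := h.2 Z (fun i x => s i (b i x)) fun i j f x => by
      rw [← hk i j f, hs]
    refine ⟨l ∘ a.symm, fun i x => ?_, fun l' hl' => ?_⟩
    · rw [Function.comp_apply, ← (hι i).symm x, hl, Equiv.apply_symm_apply]
    · rw [← hu (l' ∘ a) fun i x => by rw [Function.comp_apply, ← hι i x, hl'] ]
      funext x
      simp

end Transport

/-! ### Exponentials, power objects, classifiers and subobject operations on underlying sets -/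

namespace SupportedCategory

open HasConcreteOperations

section

variable {C : Type (u + 1)} [Category.{u} C] [SupportedCategory C]

/-- The bijection underlying an isomorphism. -/
noncomputable def equivOfIso {X Y : C} (e : X ≅ Y) : car X ≃ car Y :=
  Equiv.ofBijective (fn e.hom) (bijective_of_isIso e.hom)

theorem corresponds_of_iso {X Y X' Y' : C} (a : X ≅ X') (b : Y ≅ Y') {f : X ⟶ Y} {f' : X' ⟶ Y'}
    (h : a.hom ≫ f' = f ≫ b.hom) : Corresponds (equivOfIso a) (equivOfIso b) (fn f) (fn f') :=
  fun x => (fn_comp_apply a.hom f' x).symm.trans ((fn_congr h x).trans (fn_comp_apply f b.hom x))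

variable [HasConcreteOperations C]

theorem isExponential_iff {P E A B : C} (p : P ⟶ E) (q : P ⟶ A) (ev : P ⟶ B) :
    IsExponential p q ev ↔ ConcreteExponential (suppFun A B) (fn p) (fn q) (fn ev) := by
  refine ⟨fun h => ?_, isExponential_of_concrete'⟩
  obtain ⟨P', E', p', q', ev', h'⟩ := exists_exponential A B
  obtain ⟨k, l, hk₁, hk₂, hk₃⟩ := (isExponential_of_concrete' h').exists_comparison h
  have hid : ∀ X : C, ∀ x, equivOfIso (Iso.refl X) x = x := fn_id_apply
  refine h'.transport (corresponds_of_iso k l hk₁)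
    (corresponds_of_iso k (Iso.refl _) (hk₂.trans (Category.comp_id _).symm))
    (corresponds_of_iso k (Iso.refl _) (hk₃.trans (Category.comp_id _).symm)) fun f f' hf => ?_
  have : f' = f := funext fun x => by
    have := hf x
    rwa [hid, hid] at this
  rw [this]

theorem isPowerObject_of_concrete' {M X Q : C} {m : M ⟶ X} {n : M ⟶ Q}
    (h : ConcretePower (suppSet X) (fn m) (fn n)) : IsPowerObject m n :=
  isPowerObject_of_concrete m n h (fun r s => (isRelation_iff r s).1) isPullback_iff.1

theorem isPowerObject_iff {M X Q : C} (m : M ⟶ X) (n : M ⟶ Q) :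
    IsPowerObject m n ↔ ConcretePower (suppSet X) (fn m) (fn n) := by
  refine ⟨fun h => ?_, isPowerObject_of_concrete'⟩
  obtain ⟨M', Q', m', n', h'⟩ := exists_power X
  obtain ⟨k, l, hk₁, hk₂⟩ := (isPowerObject_of_concrete' h').exists_comparison h
  have hid : ∀ X : C, ∀ x, equivOfIso (Iso.refl X) x = x := fn_id_apply
  refine h'.transport (corresponds_of_iso k (Iso.refl _) (hk₁.trans (Category.comp_id _).symm))
    (corresponds_of_iso k l hk₂) fun s s' hs => ?_
  have : s' = s := Set.ext fun x => by
    have := hs x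
    rwa [hid] at this
  rw [this]

theorem isSubobjectClassifier_iff {T Ω : C} (t : T ⟶ Ω) :
    IsSubobjectClassifier t ↔ ConcreteClassifier (fn t) := by
  refine ⟨fun h => ?_, isSubobjectClassifier_of_concrete'⟩
  obtain ⟨T', Ω', t', h'⟩ := exists_classifier (C := C)
  obtain ⟨k, l, hk⟩ := (isSubobjectClassifier_of_concrete' h').exists_comparison h
  exact h'.transport (corresponds_of_iso k l hk.symm)

/-- The set `s` is the range of a morphism, hence of a monomorphism `w`. Testing the hypothesis on
`w` and on `n` gives the two inclusions. -/
theorem subset_range_iff {X Y : C} {V : C} (n : V ⟶ Y) (s : Set (car Y)) (f : X ⟶ Y)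
    (hs : Set.range (fn f) = s) (h : ∀ {W : C} (w : W ⟶ Y), Mono w →
      (Set.range (fn n) ⊆ Set.range (fn w) ↔ s ⊆ Set.range (fn w))) (hn : Mono n) :
    Set.range (fn n) = s := by
  obtain ⟨W, w, hw, hr⟩ := exists_sub Y (Set.range (fn f)) (eventually_act_mem_range f)
  refine (((h w (mono_of_injective w hw)).2 ?_).trans ?_).antisymm ((h n hn).1 subset_rfl)
  · rw [hr, hs]
  · rw [hr, hs]

/-- Factoring through a monomorphism is inclusion of ranges, so the adjunction says that `n` has the
same upper bounds as the set-theoretic image, which is itself a subobject. -/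
theorem isExistsAlong_iff {U X Y V : C} (m : U ⟶ X) (f : X ⟶ Y) (n : V ⟶ Y) :
    IsExistsAlong m f n ↔ Function.Injective (fn m) ∧ Function.Injective (fn n) ∧
      ∀ y, y ∈ Set.range (fn n) ↔ ∃ u, fn f (fn m u) = y := by
  have key : Set.range (fn (m ≫ f)) = {y | ∃ u, fn f (fn m u) = y} := by
    rw [fn_comp]
    rfl
  unfold IsExistsAlong
  rw [mono_iff, mono_iff]
  refine and_congr_right fun hm => and_congr_right fun hn => ?_
  constructor
  · intro h
    refine Set.ext_iff.1 (subset_range_iff n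
      {y | ∃ u, fn f (fn m u) = y} (m ≫ f) key (fun {W} w hw => ?_)
      (mono_of_injective n hn))
    have h' := h w hw
    rwa [exists_factor_iff w ((mono_iff w).1 hw), exists_factor_iff w ((mono_iff w).1 hw), key]
      at h'
  · intro h W w hw
    have hr : Set.range (fn n) = {y | ∃ u, fn f (fn m u) = y} := Set.ext h
    rw [exists_factor_iff w ((mono_iff w).1 hw), exists_factor_iff w ((mono_iff w).1 hw), key, hr]

/-- A subobject is determined by the subobjects that it contains. -/
theorem range_eq_of_forall {Y V : C} (n : V ⟶ Y) (hn : Mono n) (s : Set (car Y))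
    (hs : ∀ᶠ g in hom (C := C), ∀ y, act Y g y ∈ s ↔ y ∈ s)
    (h : ∀ {W : C} (w : W ⟶ Y), Mono w →
      ((∃ k : W ⟶ V, k ≫ n = w) ↔ Set.range (fn w) ⊆ s)) : Set.range (fn n) = s := by
  obtain ⟨W, w, hw, rfl⟩ := exists_sub Y s hs
  refine ((h n hn).1 ⟨𝟙 _, Category.id_comp _⟩).antisymm ?_
  exact (exists_factor_iff n ((mono_iff n).1 hn) w).1
    ((h w (mono_of_injective w hw)).2 subset_rfl)

theorem isForallAlong_iff {U X Y V : C} (m : U ⟶ X) (f : X ⟶ Y) (n : V ⟶ Y) :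
    IsForallAlong m f n ↔ Function.Injective (fn m) ∧ Function.Injective (fn n) ∧
      ∀ y, y ∈ Set.range (fn n) ↔ ∀ x, fn f x = y → x ∈ Set.range (fn m) := by
  unfold IsForallAlong
  rw [mono_iff, mono_iff]
  refine and_congr_right fun hm => and_congr_right fun hn => ?_
  have key : ∀ ⦃W Q : C⦄ (w : W ⟶ Y) (a : Q ⟶ W) (b : Q ⟶ X), IsPullback a b w f →
      ((∃ l : Q ⟶ U, l ≫ m = b) ↔
        Set.range (fn w) ⊆ {y | ∀ x, fn f x = y → x ∈ Set.range (fn m)}) := by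
    intro W Q w a b hpb
    have hpb := isPullback_iff.1 hpb
    rw [exists_factor_iff m hm]
    constructor
    · rintro h _ ⟨z, rfl⟩ x hx
      obtain ⟨r, ⟨-, rfl⟩, -⟩ := hpb.2 z x hx.symm
      exact h ⟨r, rfl⟩
    · rintro h _ ⟨r, rfl⟩
      exact h ⟨fn a r, rfl⟩ _ (hpb.1 r).symm
  constructor
  · intro h
    refine Set.ext_iff.1 (range_eq_of_forall n (mono_of_injective n hn)
      {y | ∀ x, fn f x = y → x ∈ Set.range (fn m)} ?_ fun {W} w hw => ?_)
    · filter_upwards [fn_act f, act_bijective X, act_bijective Y, eventually_act_mem_range m]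
        with g h₁ h₂ h₃ h₄ y
      rw [h₂.2.forall]
      simp only [h₁, h₄, h₃.1.eq_iff]
    · obtain ⟨Q, a, b, hpb⟩ := exists_pullback w f
      rw [h w a b hw hpb, key w a b hpb]
  · intro h W Q w a b hw hpb
    rw [key w a b hpb, exists_factor_iff n hn]
    have hr : Set.range (fn n) = {y | ∀ x, fn f x = y → x ∈ Set.range (fn m)} := Set.ext h
    rw [hr]

theorem isSubobjectSup_iff {U V W X : C} (m : U ⟶ X) (n : V ⟶ X) (w : W ⟶ X) :
    IsSubobjectSup m n w ↔ Function.Injective (fn m) ∧ Function.Injective (fn n) ∧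
      Function.Injective (fn w) ∧
      ∀ x, x ∈ Set.range (fn w) ↔ x ∈ Set.range (fn m) ∨ x ∈ Set.range (fn n) := by
  unfold IsSubobjectSup
  rw [mono_iff, mono_iff, mono_iff]
  refine and_congr_right fun hm => and_congr_right fun hn => and_congr_right fun hw => ?_
  obtain ⟨Z, z, hz, hr⟩ := exists_sub X (Set.range (fn m) ∪ Set.range (fn n)) (by
    filter_upwards [eventually_act_mem_range m, eventually_act_mem_range n] with g h₁ h₂ x
    rw [Set.mem_union, h₁, h₂, Set.mem_union])
  have key : ∀ ⦃T : C⦄ (t : T ⟶ X), Mono t →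
      (((∃ k : U ⟶ T, k ≫ t = m) ∧ ∃ k : V ⟶ T, k ≫ t = n) ↔
        Set.range (fn m) ∪ Set.range (fn n) ⊆ Set.range (fn t)) := by
    intro T t ht
    rw [exists_factor_iff t ((mono_iff t).1 ht), exists_factor_iff t ((mono_iff t).1 ht),
      Set.union_subset_iff]
  constructor
  · intro h
    refine Set.ext_iff.1 (subset_range_iff w
      (Set.range (fn m) ∪ Set.range (fn n)) z hr (fun {T} t ht => ?_)
      (mono_of_injective w hw))
    rw [← key t ht, ← h t ht, exists_factor_iff t ((mono_iff t).1 ht)]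
  · intro h T t ht
    rw [key t ht, exists_factor_iff t ((mono_iff t).1 ht)]
    have hr : Set.range (fn w) = Set.range (fn m) ∪ Set.range (fn n) := Set.ext h
    rw [hr]

/-- As for universal quantification, the set-theoretic implication is invariant and is recognised by
the subobjects below it; the pullback of `t` along `m` plays the role of the intersection. -/
theorem isSubobjectImp_iff {U V W X : C} (m : U ⟶ X) (n : V ⟶ X) (w : W ⟶ X) :
    IsSubobjectImp m n w ↔ Function.Injective (fn m) ∧ Function.Injective (fn n) ∧
      Function.Injective (fn w) ∧
      ∀ x, x ∈ Set.range (fn w) ↔ (x ∈ Set.range (fn m) → x ∈ Set.range (fn n)) := by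
  unfold IsSubobjectImp
  rw [mono_iff, mono_iff, mono_iff]
  refine and_congr_right fun hm => and_congr_right fun hn => and_congr_right fun hw => ?_
  have key : ∀ ⦃T Q : C⦄ (t : T ⟶ X) (a : Q ⟶ T) (b : Q ⟶ U), IsPullback a b t m →
      ((∃ l : Q ⟶ V, l ≫ n = b ≫ m) ↔
        Set.range (fn t) ⊆ {x | x ∈ Set.range (fn m) → x ∈ Set.range (fn n)}) := by
    intro T Q t a b hpb
    have hpb := isPullback_iff.1 hpb
    rw [exists_factor_iff n hn]
    constructor
    · rintro h _ ⟨z, rfl⟩ ⟨u, hu⟩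
      obtain ⟨r, ⟨-, rfl⟩, -⟩ := hpb.2 z u hu.symm
      rw [← hu, ← fn_comp_apply]
      exact h ⟨r, rfl⟩
    · rintro h _ ⟨r, rfl⟩
      rw [fn_comp_apply]
      exact h ⟨fn a r, hpb.1 r⟩ ⟨_, rfl⟩
  constructor
  · intro h
    refine Set.ext_iff.1 (range_eq_of_forall w (mono_of_injective w hw)
      {x | x ∈ Set.range (fn m) → x ∈ Set.range (fn n)} ?_ fun {T} t ht => ?_)
    · filter_upwards [eventually_act_mem_range m, eventually_act_mem_range n] with g h₁ h₂ x
      rw [h₁, h₂]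
    · obtain ⟨Q, a, b, hpb⟩ := exists_pullback t m
      rw [h t a b ht hpb, key t a b hpb]
  · intro h T Q t a b ht hpb
    rw [key t a b hpb, exists_factor_iff w hw]
    have hr : Set.range (fn w) = {x | x ∈ Set.range (fn m) → x ∈ Set.range (fn n)} := Set.ext h
    rw [hr]

variable (C) in
theorem isElementaryTopos : IsElementaryTopos C where
  hasFiniteLimits := ⟨fun I _ _ => ⟨fun K => by
    obtain ⟨c, hc⟩ := exists_limit I K
    obtain ⟨hc⟩ := isLimit_of_concrete c hc
    exact ⟨⟨⟨c, hc⟩⟩⟩⟩⟩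
  exponential A B := by
    obtain ⟨P, E, p, q, ev, h⟩ := exists_exponential A B
    exact ⟨P, E, p, q, ev, isExponential_of_concrete' h⟩
  classifier := by
    obtain ⟨T, Ω, t, ht⟩ := exists_classifier (C := C)
    have ht := isSubobjectClassifier_of_concrete' ht
    obtain ⟨⟨hT⟩, h⟩ := ht
    choose χ hχ hu using h
    choose k hk using hχ
    exact ⟨⟨Subobject.Classifier.mkOfTerminalΩ₀ T hT Ω t (fun m hm => χ m hm)
      (fun m hm => by
        rw [hT.hom_ext (hT.from _) (k m hm)]
        exact hk m hm)
      (fun m hm χ' h' => hu m hm χ' ⟨_, h'⟩)⟩⟩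

end

/-! ### Transfer of statements between diagrams with the same underlying structure -/

section Transfer

variable {E : Type (u + 1)} [Category.{u} E] [SupportedCategory E] [HasConcreteOperations E]
  {E' : Type (u + 1)} [Category.{u} E'] [SupportedCategory E'] [HasConcreteOperations E']
  {C : Type w₁} [Category.{w₂} C]

/-- A bijective correspondence between the underlying sets in two diagrams, compatible with all
the structure. -/
structure DiagramEquiv (D : C ⥤ E) (D' : C ⥤ E') where
  equiv : ∀ X : C, car (D.obj X) ≃ car (D'.obj X)
  corresponds : ∀ {X Y : C} (f : X ⟶ Y),
    Corresponds (equiv X) (equiv Y) (fn (D.map f)) (fn (D'.map f))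
  suppFun : ∀ (X Y : C) (f : car (D.obj X) → car (D.obj Y)) f',
    Corresponds (equiv X) (equiv Y) f f' →
      (f ∈ suppFun (D.obj X) (D.obj Y) ↔ f' ∈ SupportedCategory.suppFun (D'.obj X) (D'.obj Y))
  suppSet : ∀ (X : C) (s : Set (car (D.obj X))) (s' : Set (car (D'.obj X))),
    (∀ x, equiv X x ∈ s' ↔ x ∈ s) →
      (s ∈ suppSet (D.obj X) ↔ s' ∈ SupportedCategory.suppSet (D'.obj X))

/-- The inverse correspondence. -/
def DiagramEquiv.symm {D : C ⥤ E} {D' : C ⥤ E'} (δ : DiagramEquiv D D') : DiagramEquiv D' D where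
  equiv X := (δ.equiv X).symm
  corresponds f := (δ.corresponds f).symm
  suppFun X Y f f' h := (δ.suppFun X Y f' f h.symm).symm
  suppSet X s s' h := (δ.suppSet X s' s fun x => by
    rw [← h, Equiv.symm_apply_apply]).symm

/-- Each atomic assertion is first rewritten in terms of underlying functions and then moved along
the bijections. One implication suffices because `DiagramEquiv.symm` supplies the other. The
hypothesis `hφ` concerns only the two connectives and is vacuous for atomic assertions. -/
theorem DiagramEquiv.holds_imp {D : C ⥤ E} {D' : C ⥤ E'} (δ : DiagramEquiv D D')
    (φ : ToposStatement C) (hφ : ∀ ψ, (φ = .not ψ → (ψ.Holds D ↔ ψ.Holds D')) ∧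
      ∀ χ, φ = .and ψ χ → (ψ.Holds D ↔ ψ.Holds D') ∧ (χ.Holds D ↔ χ.Holds D')) :
    φ.Holds D → φ.Holds D' := by
  cases φ with
  | eq f g =>
    intro h
    refine hom_ext fun x => ?_
    obtain ⟨x, rfl⟩ := (δ.equiv _).surjective x
    rw [δ.corresponds f, δ.corresponds g]
    exact congrArg _ (fn_congr h x)
  | mono f =>
    simp only [ToposStatement.Holds, mono_iff]
    exact (δ.corresponds f).injective
  | epi f =>
    simp only [ToposStatement.Holds, epi_iff]
    exact (δ.corresponds f).surjective
  | iso f =>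
    simp only [ToposStatement.Holds, isIso_iff]
    exact fun h => ⟨(δ.corresponds f).injective h.1, (δ.corresponds f).surjective h.2⟩
  | limit I K c =>
    simp only [ToposStatement.Holds, isLimit_iff]
    exact fun h => h.transport (a := δ.equiv _) (b := fun i => δ.equiv (K.obj i))
      (fun i j f => δ.corresponds (K.map f)) fun i => δ.corresponds (c.π.app i)
  | colimit I K c =>
    simp only [ToposStatement.Holds, isColimit_iff]
    exact fun h => h.transport (a := δ.equiv _) (b := fun i => δ.equiv (K.obj i))
      (fun i j f => δ.corresponds (K.map f)) fun i => δ.corresponds (c.ι.app i)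
  | exponential p q ev =>
    simp only [ToposStatement.Holds, isExponential_iff]
    exact fun h => h.transport (δ.corresponds p) (δ.corresponds q) (δ.corresponds ev)
      (δ.suppFun _ _)
  | power m n =>
    simp only [ToposStatement.Holds, isPowerObject_iff]
    exact fun h => h.transport (δ.corresponds m) (δ.corresponds n) (δ.suppSet _)
  | classifier t =>
    simp only [ToposStatement.Holds, isSubobjectClassifier_iff]
    exact fun h => h.transport (δ.corresponds t)
  | existsAlong m f n =>
    simp only [ToposStatement.Holds, isExistsAlong_iff]
    rintro ⟨h₁, h₂, h₃⟩
    refine ⟨(δ.corresponds m).injective h₁, (δ.corresponds n).injective h₂, fun y => ?_⟩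
    obtain ⟨y, rfl⟩ := (δ.equiv _).surjective y
    rw [(δ.corresponds n).mem_range, h₃]
    refine (δ.equiv _).exists_congr fun u => ?_
    rw [δ.corresponds m, δ.corresponds f, Equiv.apply_eq_iff_eq]
  | forallAlong m f n =>
    simp only [ToposStatement.Holds, isForallAlong_iff]
    rintro ⟨h₁, h₂, h₃⟩
    refine ⟨(δ.corresponds m).injective h₁, (δ.corresponds n).injective h₂, fun y => ?_⟩
    obtain ⟨y, rfl⟩ := (δ.equiv _).surjective y
    rw [(δ.corresponds n).mem_range, h₃]
    refine (δ.equiv _).forall_congr fun u => ?_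
    rw [(δ.corresponds m).mem_range, δ.corresponds f, Equiv.apply_eq_iff_eq]
  | sup m n w =>
    simp only [ToposStatement.Holds, isSubobjectSup_iff]
    rintro ⟨h₁, h₂, h₃, h₄⟩
    refine ⟨(δ.corresponds m).injective h₁, (δ.corresponds n).injective h₂,
      (δ.corresponds w).injective h₃, fun y => ?_⟩
    obtain ⟨y, rfl⟩ := (δ.equiv _).surjective y
    rw [(δ.corresponds n).mem_range, (δ.corresponds m).mem_range, (δ.corresponds w).mem_range, h₄]
  | imp m n w =>
    simp only [ToposStatement.Holds, isSubobjectImp_iff]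
    rintro ⟨h₁, h₂, h₃, h₄⟩
    refine ⟨(δ.corresponds m).injective h₁, (δ.corresponds n).injective h₂,
      (δ.corresponds w).injective h₃, fun y => ?_⟩
    obtain ⟨y, rfl⟩ := (δ.equiv _).surjective y
    rw [(δ.corresponds n).mem_range, (δ.corresponds m).mem_range, (δ.corresponds w).mem_range, h₄]
  | not ψ => exact fun h h' => h (((hφ ψ).1 rfl).2 h')
  | and ψ χ => exact fun h => ⟨(((hφ ψ).2 χ rfl).1).1 h.1, (((hφ ψ).2 χ rfl).2).1 h.2⟩

/-- The same statements hold for corresponding diagrams. -/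
theorem DiagramEquiv.holds_iff {D : C ⥤ E} {D' : C ⥤ E'} (δ : DiagramEquiv D D')
    (φ : ToposStatement C) : φ.Holds D ↔ φ.Holds D' := by
  induction φ with
  | not ψ ih => exact not_congr ih
  | and ψ χ ih₁ ih₂ => exact and_congr ih₁ ih₂
  | _ =>
    constructor
    · exact δ.holds_imp _ fun ψ => ⟨nofun, nofun⟩
    · exact δ.symm.holds_imp _ fun ψ => ⟨nofun, nofun⟩

/-- A functor that does not change the underlying sets and the internal functions is logical. -/
theorem DiagramEquiv.isLogical {F : E ⥤ E'} (δ : DiagramEquiv (𝟭 E) F) : IsLogical F where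
  preservesFiniteLimits := ⟨fun I _ _ => ⟨fun {K} => ⟨fun {c} hc =>
    (δ.holds_iff (.limit I K c)).1 ⟨hc⟩⟩⟩⟩
  exponential p q ev h := (δ.holds_iff (.exponential p q ev)).1 h
  classifier t h := (δ.holds_iff (.classifier t)).1 h

end Transfer

end SupportedCategory

open Topology SupportedCategory

/-! ## The topology of automorphism groups -/

section AutomorphismTopology

variable {L : FirstOrder.Language.{w₁, w₂}} {M : Type u} [L.Structure M]

/-- The value of a product at `a` depends only on the value of the right factor at `a` and of the
left factor at one further point; for inverses, `π⁻¹ a = b` says that `π b = a`. -/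
instance : IsTopologicalGroup (M ≃[L] M) where
  continuous_mul := by
    refine continuous_aut fun a => ?_
    let _ : TopologicalSpace M := ⊥
    have : DiscreteTopology M := ⟨rfl⟩
    refine continuous_discrete_rng.2 fun b => isOpen_iff_mem_nhds.2 fun ⟨π, σ⟩ h => ?_
    have h : π (σ a) = b := h
    have h₁ : ∀ᶠ p : (M ≃[L] M) × (M ≃[L] M) in 𝓝 (π, σ), p.1 (σ a) = π (σ a) :=
      (((continuous_aut_apply (σ a)).comp continuous_fst).continuousAt (x := (π, σ))).eventually
        (p := fun b => b = π (σ a)) (by rw [nhds_discrete]; exact rfl)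
    have h₂ : ∀ᶠ p : (M ≃[L] M) × (M ≃[L] M) in 𝓝 (π, σ), p.2 a = σ a :=
      (((continuous_aut_apply a).comp continuous_snd).continuousAt (x := (π, σ))).eventually
        (p := fun b => b = σ a) (by rw [nhds_discrete]; exact rfl)
    filter_upwards [h₁, h₂] with p hp₁ hp₂
    change p.1 (p.2 a) = b
    rw [hp₂, hp₁, h]
  continuous_inv := by
    refine continuous_aut fun a => ?_
    let _ : TopologicalSpace M := ⊥
    have : DiscreteTopology M := ⟨rfl⟩
    refine continuous_discrete_rng.2 fun b => ?_
    have : (fun π : M ≃[L] M => π⁻¹ a) ⁻¹' {b} = (fun π : M ≃[L] M => π b) ⁻¹' {a} := by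
      ext π
      change π.symm a = b ↔ π b = a
      constructor
      · rintro rfl
        exact π.apply_symm_apply a
      · rintro rfl
        exact π.symm_apply_apply b
    rw [this]
    exact (isOpen_discrete _).preimage (continuous_aut_apply b)

/-- A property holds near the identity if it holds for the pointwise stabiliser of a finite set. -/
theorem eventually_aut_iff {P : (M ≃[L] M) → Prop} :
    (∀ᶠ π in 𝓝 (1 : M ≃[L] M), P π) ↔ ∃ U : Finset M, ∀ π : M ≃[L] M, (∀ a ∈ U, π a = a) → P π := by
  let _ : TopologicalSpace M := ⊥
  have : DiscreteTopology M := ⟨rfl⟩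
  constructor
  · intro h
    rw [Filter.Eventually, nhds_induced, Filter.mem_comap] at h
    obtain ⟨t, ht, htP⟩ := h
    rw [nhds_pi, Filter.mem_pi] at ht
    obtain ⟨U, hU, s, hs, hst⟩ := ht
    refine ⟨hU.toFinset, fun π hπ => htP (hst fun a ha => ?_)⟩
    have : π a = a := hπ a (hU.mem_toFinset.2 ha)
    change π a ∈ s a
    rw [this]
    exact mem_of_mem_nhds (hs a)
  · rintro ⟨U, hU⟩
    have : ∀ᶠ π : M ≃[L] M in 𝓝 1, ∀ a ∈ U, π a = a :=
      (Filter.eventually_all_finset U).2 fun a _ =>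
        ((continuous_aut_apply (L := L) a).continuousAt (x := 1)).eventually
          (p := fun b => b = a) (by rw [nhds_discrete]; exact rfl)
    exact this.mono hU

end AutomorphismTopology

/-! ### Topos operations on continuous actions -/

namespace ContSet

variable {G : Type u} [Group G] [TopologicalSpace G]

theorem eventually_smul_eq (X : ContSet G) (x : X.carrier) : ∀ᶠ g in 𝓝 (1 : G), g • x = x := by
  let _ : TopologicalSpace X.carrier := ⊥
  have : DiscreteTopology X.carrier := ⟨rfl⟩
  have h : Continuous fun g : G => g • x := X.continuous_smul.comp (.prodMk_left x)
  refine (h.continuousAt (x := 1)).eventually (p := fun y => y = x) ?_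
  rw [nhds_discrete]
  exact one_smul G x

variable [IsTopologicalGroup G]

/-- An action is continuous if all stabilisers are neighbourhoods of the identity. -/
def ofStabilizers (X : Type u) [MulAction G X] (h : ∀ x : X, ∀ᶠ g in 𝓝 (1 : G), g • x = x) :
    ContSet G where
  carrier := X
  continuous_smul := by
    let _ : TopologicalSpace X := ⊥
    have : DiscreteTopology X := ⟨rfl⟩
    refine continuous_prod_of_discrete_right.2 fun x => ?_
    refine continuous_discrete_rng.2 fun y => isOpen_iff_mem_nhds.2 fun σ hσ => ?_
    have ht : Filter.Tendsto (fun π => σ⁻¹ * π) (𝓝 σ) (𝓝 1) := by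
      have := (continuous_const_mul σ⁻¹).tendsto σ
      rwa [inv_mul_cancel] at this
    filter_upwards [ht.eventually (h x)] with π hπ
    rw [mul_smul, inv_smul_eq_iff] at hπ
    exact hπ.trans hσ

/-- The product of two continuous actions. -/
def prod (X Y : ContSet G) : ContSet G :=
  ofStabilizers (X.carrier × Y.carrier) fun x => by
    filter_upwards [X.eventually_smul_eq x.1, Y.eventually_smul_eq x.2] with g h₁ h₂
    exact Prod.ext h₁ h₂

/-- The action on an invariant subset. -/
def sub (X : ContSet G) (s : Set X.carrier) (hs : ∀ (g : G), ∀ x ∈ s, g • x ∈ s) : ContSet G :=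
  let _ : MulAction G s :=
    { smul g x := ⟨g • x.1, hs g x.1 x.2⟩
      one_smul x := Subtype.ext (one_smul G x.1)
      mul_smul g h x := Subtype.ext (mul_smul g h x.1) }
  ofStabilizers s fun x => (X.eventually_smul_eq x.1).mono fun _ h => Subtype.ext h

/-- The functions that commute with all group elements near the identity. -/
def internalFun (X Y : ContSet G) : Set (X.carrier → Y.carrier) :=
  {f | ∀ᶠ g in 𝓝 (1 : G), ∀ x, f (g • x) = g • f x}

/-- The subsets that are fixed by all group elements near the identity. -/
def internalSet (X : ContSet G) : Set (Set X.carrier) :=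
  {s | ∀ᶠ g in 𝓝 (1 : G), ∀ x, g • x ∈ s ↔ x ∈ s}

/-- This is what makes conjugates of internal functions and translates of internal subsets internal
again. -/
theorem tendsto_conj (g : G) : Filter.Tendsto (fun h => g⁻¹ * h * g) (𝓝 1) (𝓝 1) := by
  have : Continuous fun h : G => g⁻¹ * h * g := by fun_prop
  simpa using this.tendsto 1

/-- Conjugation of internal functions. -/
instance internalFunAction (X Y : ContSet G) : MulAction G (internalFun X Y) where
  smul g f := ⟨fun x => g • f.1 (g⁻¹ • x), by
    change ∀ᶠ h in 𝓝 (1 : G), _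
    filter_upwards [(tendsto_conj g).eventually f.2] with h hh x
    have := hh (g⁻¹ • x)
    rw [smul_smul, mul_assoc, mul_inv_cancel, mul_one, mul_smul] at this
    rw [this, smul_smul, smul_smul, mul_assoc g⁻¹, mul_inv_cancel_left]⟩
  one_smul f := Subtype.ext (funext fun x => by
    change (1 : G) • f.1 ((1 : G)⁻¹ • x) = f.1 x
    rw [inv_one, one_smul, one_smul])
  mul_smul g h f := Subtype.ext (funext fun x => by
    change (g * h) • f.1 ((g * h)⁻¹ • x) = g • h • f.1 (h⁻¹ • g⁻¹ • x)
    rw [mul_inv_rev, mul_smul, mul_smul])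

theorem internalFun_smul_apply {X Y : ContSet G} (g : G) (f : internalFun X Y) (x : X.carrier) :
    (g • f).1 x = g • f.1 (g⁻¹ • x) :=
  rfl

/-- Translation of internal subsets. -/
instance internalSetAction (X : ContSet G) : MulAction G (internalSet X) where
  smul g s := ⟨{x | g⁻¹ • x ∈ s.1}, by
    change ∀ᶠ h in 𝓝 (1 : G), _
    filter_upwards [(tendsto_conj g).eventually s.2] with h hh x
    have := hh (g⁻¹ • x)
    rwa [smul_smul, mul_assoc, mul_inv_cancel, mul_one, mul_smul] at this⟩
  one_smul s := Subtype.ext (Set.ext fun x => by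
    change (1 : G)⁻¹ • x ∈ s.1 ↔ x ∈ s.1
    rw [inv_one, one_smul])
  mul_smul g h s := Subtype.ext (Set.ext fun x => by
    change (g * h)⁻¹ • x ∈ s.1 ↔ h⁻¹ • g⁻¹ • x ∈ s.1
    rw [mul_inv_rev, mul_smul])

theorem mem_internalSet_smul {X : ContSet G} (g : G) (s : internalSet X) (x : X.carrier) :
    x ∈ (g • s).1 ↔ g⁻¹ • x ∈ s.1 :=
  Iff.rfl

/-- The exponential of two continuous actions. -/
def exponential (X Y : ContSet G) : ContSet G :=
  ofStabilizers (internalFun X Y) fun f => by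
    have hf : ∀ᶠ g in 𝓝 (1 : G), ∀ x, f.1 (g • x) = g • f.1 x := f.2
    filter_upwards [hf] with g hg
    refine Subtype.ext (funext fun x => ?_)
    rw [internalFun_smul_apply, ← hg, smul_inv_smul]

/-- The power object of a continuous action. -/
def power (X : ContSet G) : ContSet G :=
  ofStabilizers (internalSet X) fun s => by
    have hs : ∀ᶠ g in 𝓝 (1 : G), ∀ x, g • x ∈ s.1 ↔ x ∈ s.1 := s.2
    filter_upwards [hs] with g hg
    refine Subtype.ext (Set.ext fun x => ?_)
    rw [mem_internalSet_smul, ← hg, smul_inv_smul]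

/-- A set with the trivial action. -/
def trivial (X : Type u) : ContSet G :=
  let _ : MulAction G X :=
    { smul _ x := x
      one_smul _ := rfl
      mul_smul _ _ _ := rfl }
  ofStabilizers X fun _ => Filter.Eventually.of_forall fun _ => rfl

section FiniteDiagrams

variable {I : Type} [SmallCategory I] [FinCategory I] (K : I ⥤ ContSet G)

/-- Compatible families of elements of a finite diagram. -/
def limitObj : ContSet G :=
  let _ : MulAction G {x : ∀ i, (K.obj i).carrier // ∀ i j (f : i ⟶ j),
      (K.map f).toFun (x i) = x j} :=
    { smul g x := ⟨fun i => g • x.1 i, fun i j f => by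
        rw [(K.map f).map_smul, x.2]⟩
      one_smul x := Subtype.ext (funext fun i => one_smul G (x.1 i))
      mul_smul g h x := Subtype.ext (funext fun i => mul_smul g h (x.1 i)) }
  ofStabilizers {x : ∀ i, (K.obj i).carrier // ∀ i j (f : i ⟶ j),
      (K.map f).toFun (x i) = x j} fun x => by
    filter_upwards [Filter.eventually_all.2 fun i => (K.obj i).eventually_smul_eq (x.1 i)] with g hg
    exact Subtype.ext (funext hg)

/-- The identifications made in the colimit of a diagram. -/
def colimitRel (x y : Σ i, (K.obj i).carrier) : Prop :=
  ∃ f : x.1 ⟶ y.1, (K.map f).toFun x.2 = y.2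

/-- The disjoint union of a diagram, with elements identified along its morphisms. -/
def colimitObj : ContSet G :=
  let _ : MulAction G (Quot (colimitRel K)) :=
    { smul g := Quot.map (fun x => ⟨x.1, g • x.2⟩) fun x y ⟨f, hf⟩ =>
        ⟨f, ((K.map f).map_smul g x.2).trans (congrArg (g • ·) hf)⟩
      one_smul := by
        rintro ⟨i, x⟩
        exact congrArg (fun y => Quot.mk (colimitRel K) ⟨i, y⟩) (one_smul G x)
      mul_smul := by
        rintro g h ⟨i, x⟩
        exact congrArg (fun y => Quot.mk (colimitRel K) ⟨i, y⟩) (mul_smul g h x) }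
  ofStabilizers (Quot (colimitRel K)) (by
    rintro ⟨i, x⟩
    filter_upwards [(K.obj i).eventually_smul_eq x] with g hg
    exact congrArg (fun y => Quot.mk (colimitRel K) ⟨i, y⟩) hg)

end FiniteDiagrams

/-- Morphisms must commute with the whole group, whence `⊤`, whereas internal functions and subsets
are tested only near the identity. -/
instance : SupportedCategory (ContSet G) where
  car X := X.carrier
  fn f := f.toFun
  fn_id _ := rfl
  fn_comp _ _ := rfl
  fn_injective h := hom_ext h
  Γ := G
  act _ g x := g • x
  hom := ⊤
  supp := 𝓝 1
  supp_le := le_top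
  act_bijective _ := Filter.Eventually.of_forall MulAction.bijective
  act_eq_self X x := X.eventually_smul_eq x
  fn_act f := Filter.Eventually.of_forall fun g x => f.map_smul g x
  exists_hom h hh := ⟨⟨h, Filter.eventually_top.1 hh⟩, rfl⟩

instance : HasConcreteOperations (ContSet G) where
  exists_sub X s hs := by
    have hs : ∀ (g : G) (x : X.carrier), g • x ∈ s ↔ x ∈ s := Filter.eventually_top.1 hs
    exact ⟨X.sub s fun g x hx => (hs g x).2 hx, ⟨Subtype.val, fun _ _ => rfl⟩,
      Subtype.val_injective, Subtype.range_val⟩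
  exists_limit I _ _ K := by
    refine ⟨⟨limitObj K, ⟨fun i => ⟨fun x => x.1 i, fun _ _ => rfl⟩, ?_⟩⟩, ?_, ?_⟩
    · intro i j f
      exact hom_ext (funext fun x => (x.2 i j f).symm)
    · exact fun i j f x => x.2 i j f
    · exact fun x hx => ⟨⟨x, hx⟩, fun _ => rfl, fun y hy => Subtype.ext (funext hy)⟩
  exists_colimit I _ _ K := by
    refine ⟨⟨colimitObj K, ⟨fun i => ⟨fun x => Quot.mk _ ⟨i, x⟩, fun _ _ => rfl⟩, ?_⟩⟩, ?_, ?_⟩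
    · intro i j f
      exact hom_ext (funext fun x => (Quot.sound ⟨f, rfl⟩).symm)
    · exact fun i j f x => (Quot.sound ⟨f, rfl⟩).symm
    · intro Z s hs
      refine ⟨Quot.lift (fun x => s x.1 x.2) ?_, fun _ _ => rfl, fun h hh => ?_⟩
      · rintro ⟨i, x⟩ ⟨j, y⟩ ⟨f, hf⟩
        exact (hs i j f x).symm.trans (congrArg (s j) hf)
      · funext y
        obtain ⟨i, x⟩ := y
        exact hh i x
  exists_exponential A B := by
    refine ⟨(exponential A B).prod A, exponential A B, ⟨Prod.fst, fun _ _ => rfl⟩,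
      ⟨Prod.snd, fun _ _ => rfl⟩, ⟨fun r => r.1.1 r.2, fun g r => ?_⟩, ?_, ?_, ?_⟩
    · change (g • r.1).1 (g • r.2) = _
      exact (internalFun_smul_apply g r.1 _).trans (by rw [inv_smul_smul])
    · exact Function.bijective_id
    · exact fun e e' h => Subtype.ext (funext fun x => h (e, x) (e', x) rfl rfl rfl)
    · refine fun f => ⟨fun hf => ⟨⟨f, hf⟩, ?_⟩, ?_⟩
      · intro r hr
        have hr : r.1 = ⟨f, hf⟩ := hr
        exact congrFun (congrArg Subtype.val hr) r.2
      · rintro ⟨e, he⟩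
        obtain rfl : e.1 = f := funext fun x => he (e, x) rfl
        exact e.2
  exists_power X := by
    refine ⟨(X.prod (power X)).sub {r | r.1 ∈ r.2.1} fun g r hr => ?_, power X,
      ⟨fun r => r.1.1, fun _ _ => rfl⟩, ⟨fun r => r.1.2, fun _ _ => rfl⟩, ?_, ?_, ?_⟩
    · change g⁻¹ • g • r.1 ∈ r.2.1
      rwa [inv_smul_smul]
    · exact fun r r' h => Subtype.ext h
    · intro y y' h
      refine Subtype.ext (Set.ext fun x => ⟨fun hx => ?_, fun hx => ?_⟩)
      · obtain ⟨r, rfl, rfl⟩ := (h x).1 ⟨⟨(x, y), hx⟩, rfl, rfl⟩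
        exact r.2
      · obtain ⟨r, rfl, rfl⟩ := (h x).2 ⟨⟨(x, y'), hx⟩, rfl, rfl⟩
        exact r.2
    · refine fun s => ⟨fun hs => ⟨⟨s, hs⟩, fun x =>
        ⟨fun hx => ⟨⟨(x, ⟨s, hs⟩), hx⟩, rfl, rfl⟩, ?_⟩⟩, ?_⟩
      · rintro ⟨r, rfl, hr⟩
        have := r.2
        have hr' : r.1.2.1 = s := congrArg Subtype.val hr
        rw [← hr']
        exact this
      · rintro ⟨y, hy⟩
        obtain rfl : y.1 = s := Set.ext fun x => by
          rw [hy]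
          constructor
          · exact fun hx => ⟨⟨(x, y), hx⟩, rfl, rfl⟩
          · rintro ⟨r, rfl, rfl⟩
            exact r.2
        exact y.2
  exists_classifier :=
    ⟨trivial PUnit, trivial (ULift Bool), ⟨fun _ => ⟨true⟩, fun _ _ => rfl⟩, ⟨⟩, fun _ => rfl,
      ⟨false⟩, by
        change (⟨false⟩ : ULift Bool) ≠ ⟨true⟩
        simp, by
        rintro ⟨_ | _⟩
        · exact Or.inr rfl
        · exact Or.inl rfl⟩

end ContSet

/-! ## Finite sets of atoms as stages -/

section Stages

variable {L : FirstOrder.Language.{w₁, w₂}} {A : Type u} [L.Structure A] {S T : Finset A}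

theorem autOver_apply_eq (π : AutOver L S) {a : A} (ha : a ∈ S) : π a = a :=
  π.map_constants (L.con (⟨a, ha⟩ : (S : Set A)))

/-- An automorphism that fixes the elements of `S` is an automorphism of `A ⊔ S`. -/
def autOverMk (π : A ≃[L] A) (h : ∀ a ∈ S, π a = a) : AutOver L S :=
  { π.toEquiv with
    map_fun' := by
      rintro n (f | c) x
      · exact π.map_fun' f x
      · cases n with
        | zero => exact h _ (Subtype.prop (p := fun a => a ∈ (S : Set A)) c)
        | succ n => cases n <;> exact nomatch c
    map_rel' := by
      rintro n (r | r) x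
      · exact π.map_rel' r x
      · exact nomatch r }

/-- `Aut(A ⊔ S)` is an open subgroup of `Aut(A)`: adjoining `S` to the finite set that describes a
neighbourhood forces its elements into this subgroup. This is why exponentials and power objects do
not depend on the stage. -/
theorem eventually_autOver_iff {P : (A ≃[L] A) → Prop} :
    (∀ᶠ π in 𝓝 (1 : AutOver L S), P (autOverForget L S π)) ↔ ∀ᶠ π in 𝓝 (1 : A ≃[L] A), P π := by
  classical
  constructor
  · intro h
    obtain ⟨U, hU⟩ := eventually_aut_iff.1 h
    exact eventually_aut_iff.2 ⟨U ∪ S, fun π hπ =>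
      hU (autOverMk π fun a ha => hπ a (Finset.mem_union_right _ ha))
        fun a ha => hπ a (Finset.mem_union_left _ ha)⟩
  · intro h
    obtain ⟨U, hU⟩ := eventually_aut_iff.1 h
    exact eventually_aut_iff.2 ⟨U, fun π hπ => hU _ hπ⟩

theorem eventually_autOver_restrict_iff (h : S ≤ T) {P : AutOver L S → Prop} :
    (∀ᶠ π in 𝓝 (1 : AutOver L T), P (autOverRestrict L h π)) ↔
      ∀ᶠ π in 𝓝 (1 : AutOver L S), P π := by
  classical
  constructor
  · intro h'
    obtain ⟨U, hU⟩ := eventually_aut_iff.1 h'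
    exact eventually_aut_iff.2 ⟨U ∪ T, fun π hπ =>
      hU (autOverMk (autOverForget L S π) fun a ha => hπ a (Finset.mem_union_right _ ha))
        fun a ha => hπ a (Finset.mem_union_left _ ha)⟩
  · intro h'
    obtain ⟨U, hU⟩ := eventually_aut_iff.1 h'
    exact eventually_aut_iff.2 ⟨U, fun π hπ => hU _ hπ⟩

/-- A property that holds near the identity holds for all automorphisms over some finite set. -/
theorem exists_stage {P : (A ≃[L] A) → Prop} (h : ∀ᶠ π in 𝓝 (1 : A ≃[L] A), P π) :
    ∃ S : Finset A, ∀ T, S ≤ T → ∀ π : AutOver L T, P (autOverForget L T π) := by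
  obtain ⟨U, hU⟩ := eventually_aut_iff.1 h
  exact ⟨U, fun T hT π => hU _ fun a ha => autOver_apply_eq π (hT ha)⟩

theorem eventually_of_stage {P : (A ≃[L] A) → Prop}
    (h : ∀ π : AutOver L S, P (autOverForget L S π)) : ∀ᶠ π in 𝓝 (1 : A ≃[L] A), P π :=
  eventually_autOver_iff.1 (Filter.Eventually.of_forall h)

/-- A subgroup of a topological group is open as soon as it is a neighbourhood of the identity. -/
theorem isOpen_stabilizer_iff {x : VA A} :
    IsOpen (MulAction.stabilizer (A ≃[L] A) x : Set (A ≃[L] A)) ↔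
      ∀ᶠ π in 𝓝 (1 : A ≃[L] A), π • x = x :=
  ⟨fun h => h.mem_nhds (one_mem (MulAction.stabilizer (A ≃[L] A) x)),
    fun h => Subgroup.isOpen_of_mem_nhds _ h⟩

theorem isSymmetric_iff_eventually {x : VA A} : IsSymmetric L x ↔
    (∀ᶠ π in 𝓝 (1 : A ≃[L] A), π • x = x) ∧ ∀ y ∈ x, IsSymmetric L y := by
  rw [isSymmetric_iff, isOpen_stabilizer_iff]

end Stages

/-! ### Atomless codes in the hierarchy -/

namespace VA

variable {A B : Type u}

theorem map_range {ι : Type u} (e : A → B) (x : ι → VA A) :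
    map e (range x) = range fun i => map e (x i) := by
  refine ext (map_isSet e (range_isSet x)) (range_isSet _) fun z => ?_
  rw [mem_map, mem_range]
  constructor
  · rintro ⟨_, hz, rfl⟩
    obtain ⟨i, rfl⟩ := mem_range.1 hz
    exact ⟨i, rfl⟩
  · rintro ⟨i, rfl⟩
    exact ⟨_, mem_range.2 ⟨i, rfl⟩, rfl⟩

theorem range_congr {ι κ : Type u} {x : ι → VA A} {y : κ → VA A} (f : ι → κ)
    (hf : ∀ i, x i = y (f i)) (g : κ → ι) (hg : ∀ k, y k = x (g k)) : range x = range y := by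
  refine ext (range_isSet x) (range_isSet y) fun z => ?_
  rw [mem_range, mem_range]
  constructor
  · rintro ⟨i, rfl⟩
    exact ⟨f i, (hf i).symm⟩
  · rintro ⟨k, rfl⟩
    exact ⟨g k, (hg k).symm⟩

theorem atom_injective {a b : A} (h : atom a = atom b) : a = b := mk_eq.1 h

/-- A hereditarily atomless set representing an element of a type. -/
noncomputable def code {ι : Type u} : ι → VA A :=
  IsWellFounded.fix WellOrderingRel fun i c =>
    range fun j : {j // WellOrderingRel j i} => c j.1 j.2

theorem code_eq {ι : Type u} (i : ι) :
    (code i : VA A) = range fun j : {j // WellOrderingRel j i} => code j.1 :=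
  IsWellFounded.fix_eq _ _ i

theorem mem_code {ι : Type u} {i : ι} {y : VA A} :
    y ∈ code i ↔ ∃ j, WellOrderingRel j i ∧ code j = y := by
  rw [code_eq, mem_range]
  simp

/-- The codes are built like von Neumann ordinals along a well-ordering. If two codes agreed, the
earlier one would be an element of itself, hence equal to the code of a strictly smaller index,
against the induction hypothesis. -/
theorem code_injective {ι : Type u} : Function.Injective (code : ι → VA A) := by
  intro i
  induction i using IsWellFounded.induction WellOrderingRel with
  | _ i ih =>
    intro j hij
    rcases trichotomous_of WellOrderingRel i j with h | h | h
    · have : (code i : VA A) ∈ code i := by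
        have : (code i : VA A) ∈ code j := mem_code.2 ⟨i, h, rfl⟩
        rwa [← hij] at this
      obtain ⟨k, hk, hki⟩ := mem_code.1 this
      have := ih k hk hki
      subst this
      exact (irrefl_of WellOrderingRel k hk).elim
    · exact h
    · exact (ih j h hij.symm).symm

theorem map_code {ι : Type u} (e : A → B) (i : ι) : map e (code i) = code i := by
  induction i using IsWellFounded.induction WellOrderingRel with
  | _ i ih =>
    rw [code_eq, map_range, code_eq]
    exact congrArg range (funext fun j => ih j.1 j.2)

end VA

/-! ### Codes, atoms and finite sets are symmetric -/

section Symmetric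

variable {L : FirstOrder.Language.{w₁, w₂}} {A : Type u} [L.Structure A]

theorem isSymmetric_code {ι : Type u} (i : ι) : IsSymmetric L (VA.code i : VA A) := by
  induction i using IsWellFounded.induction WellOrderingRel with
  | _ i ih =>
    refine isSymmetric_iff_eventually.2 ⟨.of_forall fun π => VA.map_code _ _, fun y hy => ?_⟩
    obtain ⟨j, hj, rfl⟩ := VA.mem_code.1 hy
    exact ih j hj

theorem isSymmetric_atom (a : A) : IsSymmetric L (VA.atom a) := by
  refine isSymmetric_iff_eventually.2 ⟨?_, fun y hy => (VA.notMem_atom y a hy).elim⟩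
  refine eventually_aut_iff.2 ⟨{a}, fun π hπ => ?_⟩
  change VA.atom (π a) = VA.atom a
  rw [hπ a (Finset.mem_singleton_self a)]

theorem isSymmetric_range_of_finite {ι : Type u} [Finite ι] {x : ι → VA A}
    (hx : ∀ i, IsSymmetric L (x i)) : IsSymmetric L (VA.range x) := by
  refine isSymmetric_iff_eventually.2 ⟨?_, fun y hy => ?_⟩
  · filter_upwards [Filter.eventually_all.2 fun i => (isSymmetric_iff_eventually.1 (hx i)).1]
      with π hπ
    exact (VA.map_range _ _).trans (congrArg VA.range (funext hπ))
  · obtain ⟨i, rfl⟩ := VA.mem_range.1 hy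
    exact hx i

end Symmetric

/-! ## Realising a continuous action as a symmetric set -/

namespace ContSet

variable {L : FirstOrder.Language.{w₁, w₂}} {A : Type u} [L.Structure A] {S : Finset A}
  (X : ContSet (AutOver L S))

theorem exists_support (x : X.carrier) :
    ∃ U : Finset A, ∀ π : AutOver L S, (∀ a ∈ U, π a = a) → π • x = x :=
  eventually_aut_iff.1 (X.eventually_smul_eq x)

/-- A finite set of atoms such that automorphisms that fix its elements also fix `x`. -/
noncomputable def support (x : X.carrier) : Finset A := (X.exists_support x).choose

theorem smul_eq_of_support {x : X.carrier} {π : AutOver L S} (h : ∀ a ∈ X.support x, π a = a) :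
    π • x = x :=
  (X.exists_support x).choose_spec π h

/-- A set that determines `π • x` and on which automorphisms act through `π`. -/
noncomputable def tag (x : X.carrier) (π : AutOver L S) : VA A :=
  VA.pair (VA.code x) (VA.range fun a : X.support x => VA.pair (VA.code a.1) (VA.atom (π a.1)))

theorem smul_tag (σ : AutOver L S) (x : X.carrier) (π : AutOver L S) :
    σ • X.tag x π = X.tag x (σ * π) := by
  change VA.map σ _ = _
  rw [tag, VA.map_pair, VA.map_code, VA.map_range]
  refine congrArg (VA.pair _) (congrArg VA.range (funext fun a => ?_))
  rw [VA.map_pair, VA.map_code]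
  rfl

/-- The first component recovers `x`. The second recovers the restriction of the automorphism to the
support of `x`, which determines its effect on `x`. -/
theorem tag_inj {x y : X.carrier} {π σ : AutOver L S} (h : X.tag x π = X.tag y σ) :
    x = y ∧ π • x = σ • y := by
  obtain ⟨h₁, h₂⟩ := VA.pair_inj h
  obtain rfl := VA.code_injective h₁
  refine ⟨rfl, ?_⟩
  rw [← inv_smul_eq_iff, smul_smul]
  refine X.smul_eq_of_support fun a ha => ?_
  have : VA.pair (VA.code a) (VA.atom (π a)) ∈
      VA.range fun a : X.support x => VA.pair (VA.code a.1) (VA.atom (π a.1)) :=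
    VA.mem_range.2 ⟨⟨a, ha⟩, rfl⟩
  rw [h₂] at this
  obtain ⟨⟨b, hb⟩, hab⟩ := VA.mem_range.1 this
  obtain ⟨h₃, h₄⟩ := VA.pair_inj hab
  obtain rfl : b = a := VA.code_injective h₃
  have h₅ : σ b = π b := VA.atom_injective h₄
  change σ.symm (π b) = b
  rw [← h₅]
  exact σ.symm_apply_apply b

/-- A symmetric set representing an element of a continuous action. -/
noncomputable def encode (x : X.carrier) : VA A :=
  VA.range fun p : {p : X.carrier × AutOver L S // p.2 • p.1 = x} => X.tag p.1.1 p.1.2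

/-- Multiplication by `σ` on the left permutes the tags, carrying the pairs that represent `x` to
those that represent `σ • x`. -/
theorem smul_encode (σ : AutOver L S) (x : X.carrier) : σ • X.encode x = X.encode (σ • x) := by
  refine (VA.map_range _ _).trans (VA.range_congr
    (fun p => ⟨(p.1.1, σ * p.1.2), by rw [mul_smul, p.2]⟩) (fun p => X.smul_tag _ _ _)
    (fun p => ⟨(p.1.1, σ⁻¹ * p.1.2), by rw [mul_smul, p.2, inv_smul_smul]⟩) fun p => ?_)
  refine Eq.trans ?_ (X.smul_tag _ _ _).symm
  rw [mul_inv_cancel_left]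

/-- The representative of `x` contains the tag of `x` with the identity, and any tag determines the
element that it represents. -/
theorem encode_injective : Function.Injective X.encode := by
  intro x y h
  have : X.tag x 1 ∈ X.encode x := VA.mem_range.2 ⟨⟨(x, 1), one_smul _ x⟩, rfl⟩
  rw [h] at this
  obtain ⟨⟨⟨z, π⟩, hp⟩, hz⟩ := VA.mem_range.1 this
  rw [← hp, (X.tag_inj hz).2, one_smul]

/-- Near the identity `x` is fixed, so its representative is too. The elements are tags, each built
from codes and finitely many atoms; finiteness of the support is essential here. -/
theorem isSymmetric_encode (x : X.carrier) : IsSymmetric L (X.encode x) := by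
  refine isSymmetric_iff_eventually.2 ⟨eventually_autOver_iff (S := S).1 ?_, fun y hy => ?_⟩
  · filter_upwards [X.eventually_smul_eq x] with π hπ
    exact (X.smul_encode π x).trans (congrArg X.encode hπ)
  · obtain ⟨p, rfl⟩ := VA.mem_range.1 hy
    exact (isSymmetric_code _).pair (isSymmetric_range_of_finite fun a =>
      (isSymmetric_code _).pair (isSymmetric_atom _))

theorem smul_range_encode (σ : AutOver L S) : σ • VA.range X.encode = VA.range X.encode :=
  (VA.map_range _ _).trans (VA.range_congr (fun x => σ • x) (fun x => X.smul_encode σ x)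
    (fun x => σ⁻¹ • x) fun x => by
      refine Eq.trans ?_ (X.smul_encode _ _).symm
      rw [smul_inv_smul])

/-- The symmetric set of representatives of the elements of a continuous action. -/
noncomputable def realize : ZFA L A where
  set := VA.range X.encode
  isSet := VA.range_isSet _
  symmetric := isSymmetric_iff_eventually.2 ⟨eventually_of_stage X.smul_range_encode, fun y hy => by
    obtain ⟨x, rfl⟩ := VA.mem_range.1 hy
    exact X.isSymmetric_encode x⟩

/-- The elements of an action correspond to their representatives. -/
noncomputable def realizeEquiv : X.carrier ≃ X.realize.set.Elem :=
  Equiv.ofBijective (fun x => VA.Elem.mk (X.encode x) (VA.mem_range.2 ⟨x, rfl⟩)) <| by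
    constructor
    · intro x y h
      exact X.encode_injective ((VA.Elem.val_mk _ _).symm.trans
        ((congrArg VA.Elem.val h).trans (VA.Elem.val_mk _ _)))
    · intro i
      obtain ⟨x, hx⟩ := VA.mem_range.1 i.val_mem
      exact ⟨x, VA.Elem.ext ((VA.Elem.val_mk _ _).trans hx)⟩

theorem val_realizeEquiv (x : X.carrier) : (X.realizeEquiv x).val = X.encode x :=
  VA.Elem.val_mk _ _

end ContSet

/-! ### Symmetric sets as sets with a partially defined action -/

namespace ZFA

variable {L : FirstOrder.Language.{w₁, w₂}} {A : Type u} [L.Structure A]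

theorem eventually_smul_set (X : ZFA L A) : ∀ᶠ π in 𝓝 (1 : A ≃[L] A), π • X.set = X.set :=
  (isSymmetric_iff_eventually.1 X.symmetric).1

theorem eventually_smul_val {X : ZFA L A} (i : X.set.Elem) :
    ∀ᶠ π in 𝓝 (1 : A ≃[L] A), π • i.val = i.val :=
  (isSymmetric_iff_eventually.1 (X.symmetric.mem i.val_mem)).1

open Classical in
/-- The action of an automorphism on the elements of a symmetric set; elements that are not mapped
into the set are left fixed. -/
noncomputable def partialAct (X : ZFA L A) (π : A ≃[L] A) (i : X.set.Elem) : X.set.Elem :=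
  if h : π • i.val ∈ X.set then VA.Elem.mk _ h else i

theorem val_partialAct_of_mem {X : ZFA L A} {π : A ≃[L] A} {i : X.set.Elem}
    (h : π • i.val ∈ X.set) : (X.partialAct π i).val = π • i.val := by
  rw [partialAct, dif_pos h, VA.Elem.val_mk]

theorem smul_val_mem {X : ZFA L A} {π : A ≃[L] A} (h : π • X.set = X.set) (i : X.set.Elem) :
    π • i.val ∈ X.set := by
  have := mem_smul_iff (π := π).2 i.val_mem
  rwa [h] at this

theorem val_partialAct {X : ZFA L A} {π : A ≃[L] A} (h : π • X.set = X.set) (i : X.set.Elem) :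
    (X.partialAct π i).val = π • i.val :=
  val_partialAct_of_mem (smul_val_mem h i)

/-- Automorphisms near the identity map both sets onto themselves, so the default value of
`partialAct` does not occur, and fixing the graph amounts to commuting with the function. -/
theorem isSymmetric_graph_iff_eventually {X Y : ZFA L A} {f : X.set.Elem → Y.set.Elem} :
    IsSymmetric L (VA.graph f) ↔
      ∀ᶠ π in 𝓝 (1 : A ≃[L] A), ∀ i, f (X.partialAct π i) = Y.partialAct π (f i) := by
  rw [isSymmetric_graph_iff X.symmetric Y.symmetric, isOpen_stabilizer_iff]
  refine Filter.eventually_congr ?_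
  filter_upwards [X.eventually_smul_set, Y.eventually_smul_set] with π hX hY
  rw [smul_graph_eq_iff X.isSet]
  constructor
  · rintro ⟨-, h⟩ i
    exact VA.Elem.ext ((h _ _ (val_partialAct hX i)).trans (val_partialAct hY _).symm)
  · refine fun h => ⟨hX, fun i j hij => ?_⟩
    obtain rfl : j = X.partialAct π i := VA.Elem.ext (hij.trans (val_partialAct hX i).symm)
    rw [h, val_partialAct hY]

theorem partialAct_bijective {X : ZFA L A} {π : A ≃[L] A} (h : π • X.set = X.set) :
    Function.Bijective (X.partialAct π) := by
  have h' : π⁻¹ • X.set = X.set := by rw [inv_smul_eq_iff, h]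
  refine Function.bijective_iff_has_inverse.2 ⟨X.partialAct π⁻¹, fun i => ?_, fun i => ?_⟩
  · exact VA.Elem.ext (by rw [val_partialAct h', val_partialAct h, inv_smul_smul])
  · exact VA.Elem.ext (by rw [val_partialAct h, val_partialAct h', smul_inv_smul])

/-- The two filters coincide: a symmetric function need only commute with automorphisms near the
identity, so morphisms and internal functions are the same. -/
noncomputable instance : SupportedCategory (ZFA L A) where
  car X := X.set.Elem
  fn f := f.toFun
  fn_id _ := rfl
  fn_comp _ _ := rfl
  fn_injective h := hom_ext h
  Γ := A ≃[L] A
  act X := X.partialAct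
  hom := 𝓝 1
  supp := 𝓝 1
  supp_le := le_rfl
  act_bijective X := X.eventually_smul_set.mono fun _ => partialAct_bijective
  act_eq_self X x := by
    filter_upwards [X.eventually_smul_set, eventually_smul_val x] with π h₁ h₂
    exact VA.Elem.ext ((val_partialAct h₁ x).trans h₂)
  fn_act f := isSymmetric_graph_iff_eventually.1 f.symmetric
  exists_hom h hh := ⟨⟨h, isSymmetric_graph_iff_eventually.2 hh⟩, rfl⟩

end ZFA

/-! ## Realisations -/

namespace ContSet

variable {L : FirstOrder.Language.{w₁, w₂}} {A : Type u} [L.Structure A] {S T : Finset A}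

/-- An equivariant bijection between a continuous action and the elements of a symmetric set. -/
structure Realization (Y : ContSet (AutOver L S)) (X : ZFA L A) where
  equiv : Y.carrier ≃ X.set.Elem
  val_smul : ∀ (π : AutOver L S) (y : Y.carrier), (equiv (π • y)).val = π • (equiv y).val

namespace Realization

variable {Y Y' Y'' : ContSet (AutOver L S)} {X X' X'' : ZFA L A}

/-- Automorphisms over `S` keep the elements inside the set, since the image is again the value of
the bijection at a point; thus the default value is not used. -/
theorem partialAct_equiv (r : Realization Y X) (π : AutOver L S) (y : Y.carrier) :
    X.partialAct (autOverForget L S π) (r.equiv y) = r.equiv (π • y) :=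
  VA.Elem.ext ((ZFA.val_partialAct_of_mem (π := autOverForget L S π)
    ((r.val_smul π y).symm ▸ (r.equiv (π • y)).val_mem :)).trans (r.val_smul π y).symm)

/-- The bijections turn the condition at stage `S` into the condition on `partialAct`, and openness
of `Aut(A ⊔ S)` identifies the neighbourhoods on which they are imposed. -/
theorem mem_suppFun_iff (r : Realization Y X) (r' : Realization Y' X') {f f'}
    (h : Corresponds r.equiv r'.equiv f f') : f ∈ suppFun Y Y' ↔ f' ∈ suppFun X X' := by
  refine Iff.trans ?_ (eventually_autOver_iff (S := S))
  refine Filter.eventually_congr (Filter.Eventually.of_forall fun π => ?_)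
  refine r.equiv.forall_congr fun y => ?_
  change _ ↔ f' (X.partialAct _ _) = X'.partialAct _ _
  rw [h, r.partialAct_equiv, r'.partialAct_equiv, h, Equiv.apply_eq_iff_eq]
  rfl

theorem mem_suppSet_iff (r : Realization Y X) {s s'} (h : ∀ x, r.equiv x ∈ s' ↔ x ∈ s) :
    s ∈ suppSet Y ↔ s' ∈ suppSet X := by
  refine Iff.trans ?_ (eventually_autOver_iff (S := S))
  refine Filter.eventually_congr (Filter.Eventually.of_forall fun π => ?_)
  refine r.equiv.forall_congr fun y => ?_
  change _ ↔ (X.partialAct _ _ ∈ s' ↔ _)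
  rw [r.partialAct_equiv, h, h]
  rfl

/-- The symmetric function given by an equivariant function. -/
def map (r : Realization Y X) (r' : Realization Y' X') (f : Y ⟶ Y') : X ⟶ X' where
  toFun := r'.equiv ∘ f.toFun ∘ r.equiv.symm
  symmetric := by
    refine ZFA.isSymmetric_graph_iff_eventually.2 ?_
    refine (r.mem_suppFun_iff r' (f := f.toFun) fun y => ?_).1
      (Filter.Eventually.of_forall fun π => f.map_smul π)
    simp

theorem map_toFun (r : Realization Y X) (r' : Realization Y' X') (f : Y ⟶ Y') :
    (r.map r' f).toFun = r'.equiv ∘ f.toFun ∘ r.equiv.symm :=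
  rfl

theorem corresponds_map (r : Realization Y X) (r' : Realization Y' X') (f : Y ⟶ Y') :
    Corresponds r.equiv r'.equiv f.toFun (r.map r' f).toFun := fun y => by
  rw [map_toFun]
  simp

theorem map_comp_map (r : Realization Y X) (r' : Realization Y' X') (r'' : Realization Y'' X'')
    (f : Y ⟶ Y') (g : Y' ⟶ Y'') : r.map r' f ≫ r'.map r'' g = r.map r'' (f ≫ g) :=
  ZFA.hom_ext (funext fun _ => congrArg (fun y => r''.equiv (g.toFun y))
    (r'.equiv.symm_apply_apply _))

theorem map_id (r : Realization Y X) : r.map r (𝟙 Y) = 𝟙 X :=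
  ZFA.hom_ext (funext fun x => r.equiv.apply_symm_apply x)

/-- Realisations of the same action are isomorphic. -/
def iso (r : Realization Y X) (r' : Realization Y X') : X ≅ X' where
  hom := r.map r' (𝟙 Y)
  inv := r'.map r (𝟙 Y)
  hom_inv_id := by rw [map_comp_map, Category.comp_id, map_id]
  inv_hom_id := by rw [map_comp_map, Category.comp_id, map_id]

/-- A realisation of an action is a realisation of its restrictions. -/
def restrict (r : Realization Y X) (h : S ≤ T) : Realization ((contRestrict L h).obj Y) X where
  equiv := r.equiv
  val_smul π y := r.val_smul (autOverRestrict L h π) y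

end Realization

/-- Every continuous action is realised by a symmetric set. -/
noncomputable def realization (Y : ContSet (AutOver L S)) : Realization Y Y.realize where
  equiv := Y.realizeEquiv
  val_smul π y := by
    rw [val_realizeEquiv, val_realizeEquiv, smul_encode]

end ContSet

/-- An equivariant set realises the action on its elements. -/
def EquivariantZFA.realization {L : FirstOrder.Language.{w₁, w₂}} {A : Type u} [L.Structure A]
    {S : Finset A} (X : EquivariantZFA L S) :
    ContSet.Realization ((EquivariantZFA.toCont L S).obj X) X.obj where
  equiv := Equiv.refl _
  val_smul π i := EquivariantZFA.val_smul X π i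

/-! ### Finite supports and descent of diagrams to a stage -/

section Stage

variable {L : FirstOrder.Language.{w₁, w₂}} {A : Type u} [L.Structure A] {S T : Finset A}
  {C : Type w₃} [Category.{w₄} C]

/-- `x` is fixed by all automorphisms that fix the elements of `S`. -/
def IsSupportedBy (L : FirstOrder.Language.{w₁, w₂}) {A : Type u} [L.Structure A] (S : Finset A)
    (x : VA A) : Prop :=
  ∀ π : AutOver L S, π • x = x

theorem IsSupportedBy.mono {x : VA A} (h : IsSupportedBy L S x) (hST : S ≤ T) :
    IsSupportedBy L T x :=
  fun π => h (autOverRestrict L hST π)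

theorem IsSymmetric.exists_support {x : VA A} (h : IsSymmetric L x) :
    ∃ S, IsSupportedBy L S x := by
  obtain ⟨S, hS⟩ := exists_stage (isSymmetric_iff_eventually.1 h).1
  exact ⟨S, hS S le_rfl⟩

theorem exists_common_support {ι : Type*} [Finite ι] {x : ι → VA A}
    (h : ∀ i, IsSymmetric L (x i)) : ∃ S, ∀ i, IsSupportedBy L S (x i) := by
  classical
  have := Fintype.ofFinite ι
  choose s hs using fun i => (h i).exists_support
  exact ⟨Finset.univ.sup s, fun i => (hs i).mono (Finset.le_sup (Finset.mem_univ i))⟩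

/-- The diagram of continuous actions given by a diagram of equivariant sets. -/
noncomputable def stageFunctor (D : C ⥤ ZFA L A) (hX : ∀ X, IsSupportedBy L S (D.obj X).set)
    (hf : ∀ {X Y : C} (f : X ⟶ Y), IsSupportedBy L S (VA.graph (D.map f).toFun)) :
    C ⥤ ContSet (AutOver L S) where
  obj X := (EquivariantZFA.toCont L S).obj ⟨D.obj X, hX X⟩
  map f := (EquivariantZFA.toCont L S).map ⟨D.map f, hf f⟩
  map_id X := ContSet.hom_ext (congrArg ZFA.Hom.toFun (D.map_id X))
  map_comp f g := ContSet.hom_ext (congrArg ZFA.Hom.toFun (D.map_comp f g))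

/-- A stagewise realisation of a diagram of symmetric sets. -/
structure DiagramRealization (D₀ : C ⥤ ContSet (AutOver L S)) (D : C ⥤ ZFA L A) where
  obj : ∀ X, ContSet.Realization (D₀.obj X) (D.obj X)
  corresponds : ∀ {X Y : C} (f : X ⟶ Y),
    Corresponds (obj X).equiv (obj Y).equiv (D₀.map f).toFun (D.map f).toFun

/-- A stagewise realisation preserves all the structure. -/
def DiagramRealization.diagramEquiv {D₀ : C ⥤ ContSet (AutOver L S)} {D : C ⥤ ZFA L A}
    (r : DiagramRealization D₀ D) : DiagramEquiv D₀ D where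
  equiv X := (r.obj X).equiv
  corresponds f := r.corresponds f
  suppFun X Y _ _ := (r.obj X).mem_suppFun_iff (r.obj Y)
  suppSet X _ _ := (r.obj X).mem_suppSet_iff

/-- The realisation of a diagram of equivariant sets by the actions on the elements. -/
def stageRealization (D : C ⥤ ZFA L A) (hX : ∀ X, IsSupportedBy L S (D.obj X).set)
    (hf : ∀ {X Y : C} (f : X ⟶ Y), IsSupportedBy L S (VA.graph (D.map f).toFun)) :
    DiagramRealization (stageFunctor D hX hf) D where
  obj X := EquivariantZFA.realization ⟨D.obj X, hX X⟩
  corresponds _ _ := rfl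

/-- The morphisms with an equivariant graph are closed under composition. -/
theorem isSupportedBy_map_of_generators (D : C ⥤ ZFA L A)
    (hX : ∀ X, IsSupportedBy L S (D.obj X).set) {W : MorphismProperty C}
    (hW : W.multiplicativeClosure = ⊤)
    (h : ∀ {X Y : C} (f : X ⟶ Y), W f → IsSupportedBy L S (VA.graph (D.map f).toFun))
    {X Y : C} (f : X ⟶ Y) : IsSupportedBy L S (VA.graph (D.map f).toFun) := by
  have hf : W.multiplicativeClosure f := hW ▸ trivial
  induction hf with
  | of f hf => exact h f hf
  | id X =>
    rw [D.map_id]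
    exact fun π => smul_graph_id (D.obj X).isSet (hX X π)
  | comp_of f g _ hg ih =>
    rw [D.map_comp]
    exact fun π => smul_graph_comp (f := (D.map f).toFun) (g := (D.map g).toFun) (D.obj _).isSet
      (D.obj _).isSet (ih π) (h g hg π)

/-- Each object and each generating morphism has a finite support. The union of these finitely many
supports fixes all of them, and composites inherit the support. -/
theorem exists_stageRealization (hC : IsFinitelyGenerated C) (D : C ⥤ ZFA L A) :
    ∃ (S : Finset A) (D₀ : C ⥤ ContSet (AutOver L S)), Nonempty (DiagramRealization D₀ D) := by
  classical
  obtain ⟨_, W, hWf, hW⟩ := hC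
  obtain ⟨S₁, h₁⟩ := exists_common_support fun X => (D.obj X).symmetric
  have : Finite {f : Arrow C | W f.hom} := hWf
  obtain ⟨S₂, h₂⟩ := exists_common_support fun f : {f : Arrow C | W f.hom} =>
    (D.map f.1.hom).symmetric
  have hX : ∀ X, IsSupportedBy L (S₁ ∪ S₂) (D.obj X).set := fun X =>
    (h₁ X).mono Finset.subset_union_left
  have hf : ∀ {X Y : C} (f : X ⟶ Y), IsSupportedBy L (S₁ ∪ S₂) (VA.graph (D.map f).toFun) :=
    isSupportedBy_map_of_generators D hX hW fun f hf =>
      (h₂ ⟨Arrow.mk f, hf⟩).mono Finset.subset_union_right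
  exact ⟨_, _, ⟨stageRealization D hX hf⟩⟩

theorem isFinitelyGenerated_of_finCategory (I : Type) [SmallCategory I] [FinCategory I] :
    IsFinitelyGenerated I := by
  refine ⟨inferInstance, ⊤, ?_, ?_⟩
  · have : Finite (Arrow I) := Finite.of_injective
      (fun f : Arrow I => (⟨f.left, f.right, f.hom⟩ : Σ X Y : I, (X ⟶ Y))) fun f g h => by
        obtain ⟨X, Y, f⟩ := f
        obtain ⟨X', Y', g⟩ := g
        cases h
        rfl
    exact Set.toFinite _
  · exact top_le_iff.1 (MorphismProperty.le_multiplicativeClosure ⊤)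

theorem ZFA.exists_realization (X : ZFA L A) :
    ∃ (S : Finset A) (Y : ContSet (AutOver L S)), Nonempty (ContSet.Realization Y X) := by
  obtain ⟨S, hS⟩ := X.symmetric.exists_support
  exact ⟨S, _, ⟨EquivariantZFA.realization ⟨X, hS⟩⟩⟩

theorem ZFA.exists_realization₂ (X X' : ZFA L A) :
    ∃ (S : Finset A) (Y Y' : ContSet (AutOver L S)), Nonempty (ContSet.Realization Y X) ∧
      Nonempty (ContSet.Realization Y' X') := by
  classical
  obtain ⟨S, Y, ⟨r⟩⟩ := X.exists_realization
  obtain ⟨S', Y', ⟨r'⟩⟩ := X'.exists_realization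
  exact ⟨S ∪ S', _, _, ⟨r.restrict Finset.subset_union_left⟩,
    ⟨r'.restrict Finset.subset_union_right⟩⟩

open HasConcreteOperations

/-- The data of each construction descend to a stage; the construction is performed on continuous
actions there, realised by symmetric sets, and transported along the realisation bijections. -/
instance : HasConcreteOperations (ZFA L A) where
  exists_sub X s hs := by
    classical
    obtain ⟨S₁, h₁⟩ := X.symmetric.exists_support
    obtain ⟨S₂, h₂⟩ := exists_stage hs
    let Y : EquivariantZFA L (S₁ ∪ S₂) := ⟨X, h₁.mono Finset.subset_union_left⟩
    obtain ⟨V, m, hm, hr⟩ := exists_sub ((EquivariantZFA.toCont L (S₁ ∪ S₂)).obj Y) s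
      (Filter.Eventually.of_forall fun π x => by
        have := h₂ _ Finset.subset_union_right π x
        exact (iff_of_eq (congrArg (· ∈ s) (Y.realization.partialAct_equiv π x).symm)).trans this)
    refine ⟨V.realize, V.realization.map Y.realization m,
      (V.realization.corresponds_map Y.realization m).injective hm, ?_⟩
    rw [← hr]
    exact Set.ext fun x => (V.realization.corresponds_map Y.realization m).mem_range x
  exists_limit I _ _ K := by
    obtain ⟨S, K₀, ⟨r⟩⟩ := exists_stageRealization (isFinitelyGenerated_of_finCategory I) K
    obtain ⟨c, hc⟩ := exists_limit I K₀
    have h := hc.transport (a := c.pt.realizeEquiv) (b := fun i => (r.obj i).equiv)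
      (k' := fun i j f => fn (K.map f))
      (π' := fun i => fn (c.pt.realization.map (r.obj i) (c.π.app i)))
      (fun i j f => r.corresponds f)
      (fun i => c.pt.realization.corresponds_map (r.obj i) (c.π.app i))
    refine ⟨⟨c.pt.realize, ⟨fun i => c.pt.realization.map (r.obj i) (c.π.app i), ?_⟩⟩, h⟩
    exact fun i j f => SupportedCategory.hom_ext fun x => (h.1 i j f x).symm
  exists_colimit I _ _ K := by
    obtain ⟨S, K₀, ⟨r⟩⟩ := exists_stageRealization (isFinitelyGenerated_of_finCategory I) K
    obtain ⟨c, hc⟩ := exists_colimit I K₀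
    have h := hc.transport (a := c.pt.realizeEquiv) (b := fun i => (r.obj i).equiv)
      (k' := fun i j f => fn (K.map f))
      (ι' := fun i => fn ((r.obj i).map c.pt.realization (c.ι.app i)))
      (fun i j f => r.corresponds f)
      (fun i => (r.obj i).corresponds_map c.pt.realization (c.ι.app i))
    refine ⟨⟨c.pt.realize, ⟨fun i => (r.obj i).map c.pt.realization (c.ι.app i), ?_⟩⟩, h⟩
    exact fun i j f => SupportedCategory.hom_ext fun x => h.1 i j f x
  exists_exponential X X' := by
    obtain ⟨S, Y, Y', ⟨r⟩, ⟨r'⟩⟩ := X.exists_realization₂ X'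
    obtain ⟨P, E, p, q, ev, h⟩ := exists_exponential Y Y'
    exact ⟨P.realize, E.realize, P.realization.map E.realization p, P.realization.map r q,
      P.realization.map r' ev, h.transport (P.realization.corresponds_map E.realization p)
        (P.realization.corresponds_map r q) (P.realization.corresponds_map r' ev)
        fun _ _ => r.mem_suppFun_iff r'⟩
  exists_power X := by
    obtain ⟨S, Y, ⟨r⟩⟩ := X.exists_realization
    obtain ⟨M, Q, m, n, h⟩ := exists_power Y
    exact ⟨M.realize, Q.realize, M.realization.map r m, M.realization.map Q.realization n,
      h.transport (M.realization.corresponds_map r m)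
        (M.realization.corresponds_map Q.realization n) fun _ _ => r.mem_suppSet_iff⟩
  exists_classifier := by
    -- The classifier involves no given objects, so the empty set of atoms is a sufficient stage.
    obtain ⟨T, Ω, t, h⟩ := exists_classifier (C := ContSet (AutOver L (∅ : Finset A)))
    exact ⟨T.realize, Ω.realize, T.realization.map Ω.realization t,
      h.transport (T.realization.corresponds_map Ω.realization t)⟩

/-- Restriction to a smaller stage does not change the underlying sets. -/
def contRestrictDiagramEquiv (h : S ≤ T) :
    DiagramEquiv (𝟭 (ContSet (AutOver L S))) (contRestrict L h) where
  equiv _ := Equiv.refl _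
  corresponds _ _ := rfl
  suppFun X Y f f' hf := by
    obtain rfl : f' = f := funext hf
    let k : X.carrier → Y.carrier := f'
    exact (eventually_autOver_restrict_iff h (P := fun π => ∀ x, k (π • x) = π • k x)).symm
  suppSet X s s' hs := by
    obtain rfl : s' = s := Set.ext hs
    let t : Set X.carrier := s'
    exact (eventually_autOver_restrict_iff h (P := fun π => ∀ x, π • x ∈ t ↔ x ∈ t)).symm

theorem isLogical_contRestrict (h : S ≤ T) : IsLogical (contRestrict L h) :=
  (contRestrictDiagramEquiv h).isLogical

variable (L S) in
/-- The embedding of continuous actions into symmetric sets. -/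
noncomputable def realizeFunctor : ContSet (AutOver L S) ⥤ ZFA L A where
  obj Y := Y.realize
  map {Y Y'} f := Y.realization.map Y'.realization f
  map_id Y := Y.realization.map_id
  map_comp {Y Y' Y''} f g :=
    (Y.realization.map_comp_map Y'.realization Y''.realization f g).symm

variable (L S) in
/-- The embedding does not change the underlying sets. -/
noncomputable def realizeFunctorRealization (D : C ⥤ ContSet (AutOver L S)) :
    DiagramRealization D (D ⋙ realizeFunctor L S) where
  obj X := (D.obj X).realization
  corresponds {X Y} f := (D.obj X).realization.corresponds_map (D.obj Y).realization (D.map f)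

theorem isLogical_realizeFunctor : IsLogical (realizeFunctor L S) :=
  (realizeFunctorRealization L S (𝟭 _)).diagramEquiv.isLogical

instance : (realizeFunctor L S).Faithful where
  map_injective {Y Y' f g} h := ContSet.hom_ext (funext fun y => Y'.realizeEquiv.injective (by
    have h₁ := Y.realization.corresponds_map Y'.realization f y
    have h₂ := Y.realization.corresponds_map Y'.realization g y
    exact h₁.symm.trans ((congrFun (congrArg ZFA.Hom.toFun h) _).trans h₂)))

instance : (realizeFunctor L S).ReflectsIsomorphisms where
  reflects f h := ((realizeFunctorRealization L S (𝟭 _)).diagramEquiv.holds_iff (.iso f)).2 h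

end Stage

/-! ### Equivariant sets are equivalent to continuous actions -/

section Equivalence

variable {L : FirstOrder.Language.{w₁, w₂}} {A : Type u} [L.Structure A] {S T : Finset A}

theorem EquivariantZFA.isSupportedBy_graph {X Y : EquivariantZFA L S}
    (f : (toCont L S).obj X ⟶ (toCont L S).obj Y) :
    IsSupportedBy L S (VA.graph (x := X.obj.set) (y := Y.obj.set) f.toFun) := fun π =>
  (smul_graph_eq_iff (π := autOverForget L S π) X.obj.isSet).2 ⟨X.equivariant π, fun i j hij => by
    obtain rfl : j = π • i := VA.Elem.ext (hij.trans (val_smul X π i).symm)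
    exact (congrArg VA.Elem.val (f.map_smul π i)).trans (val_smul Y π _)⟩

instance : (EquivariantZFA.toCont L S).Faithful where
  map_injective h := EquivariantZFA.hom_ext (ZFA.hom_ext (congrArg ContSet.Hom.toFun h))

/-- The realisations involved have identity bijections, so the symmetric function obtained is the
given equivariant function itself. -/
instance : (EquivariantZFA.toCont L S).Full where
  map_surjective {X Y} f :=
    ⟨⟨X.realization.map Y.realization f, EquivariantZFA.isSupportedBy_graph f⟩, rfl⟩

/-- Actions with the same realisation are isomorphic. -/
def ContSet.Realization.contIso {Y Z : ContSet (AutOver L S)} {X : ZFA L A} (r : Realization Y X)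
    (r' : Realization Z X) : Y ≅ Z :=
  have key : ∀ {Y Z : ContSet (AutOver L S)} (r : Realization Y X) (r' : Realization Z X)
      (π : AutOver L S) (y : Y.carrier),
      r'.equiv.symm (r.equiv (π • y)) = π • r'.equiv.symm (r.equiv y) := fun r r' π y => by
    rw [Equiv.symm_apply_eq]
    exact VA.Elem.ext (by
      rw [r.val_smul, r'.val_smul, Equiv.apply_symm_apply])
  { hom := ⟨fun y => r'.equiv.symm (r.equiv y), key r r'⟩
    inv := ⟨fun z => r.equiv.symm (r'.equiv z), key r' r⟩
    hom_inv_id := ContSet.hom_ext (funext fun y =>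
      (congrArg r.equiv.symm (r'.equiv.apply_symm_apply _)).trans (r.equiv.symm_apply_apply y))
    inv_hom_id := ContSet.hom_ext (funext fun z =>
      (congrArg r'.equiv.symm (r.equiv.apply_symm_apply _)).trans (r'.equiv.symm_apply_apply z)) }

/-- The set realising `Y` is itself `S`-equivariant, so `Y` and the action on its elements are two
actions realised by the same set. -/
instance : (EquivariantZFA.toCont L S).EssSurj where
  mem_essImage Y :=
    ⟨⟨Y.realize, Y.smul_range_encode⟩,
      ⟨(EquivariantZFA.realization ⟨Y.realize, Y.smul_range_encode⟩).contIso Y.realization⟩⟩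

instance : (EquivariantZFA.toCont L S).IsEquivalence where

end Equivalence

/-! ### The pseudo-cocone of realisations -/

section Cocone

variable {L : FirstOrder.Language.{w₁, w₂}} {A : Type u} [L.Structure A] {S T : Finset A}

/-- Realisation commutes with restriction to a smaller group. -/
noncomputable def realizeFunctorIso (h : S ≤ T) :
    contRestrict L h ⋙ realizeFunctor L T ≅ realizeFunctor L S :=
  NatIso.ofComponents
    (fun Y => ((contRestrict L h).obj Y).realization.iso (Y.realization.restrict h)) fun {Y Y'} f =>
      (ContSet.Realization.map_comp_map _ _ _ _ _).trans
        (ContSet.Realization.map_comp_map ((contRestrict L h).obj Y).realization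
          (Y.realization.restrict h) (Y'.realization.restrict h) (𝟙 _)
          ((contRestrict L h).map f)).symm

variable (L A) in
/-- The realisations of continuous actions form a pseudo-cocone. -/
noncomputable def realizeCocone (hC : ∀ S : Finset A, IsElementaryTopos (ContSet (AutOver L S)))
    (hR : ∀ (S T : Finset A) (h : S ≤ T), IsLogical (contRestrict L h))
    (hZ : IsElementaryTopos (ZFA L A)) :
    PseudoCocone (contDiagram L A hC hR) (⟨ZFA L A, hZ⟩ : ElemTopos.{u, u + 1}) where
  app S := ⟨realizeFunctor L S.as, isLogical_realizeFunctor⟩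
  naturality f := ElemTopos.isoMk (realizeFunctorIso (leOfHom f.as))
  naturality_naturality {i j f g} η := by
    obtain rfl : f = g := LocallyDiscrete.eq_of_hom η
    obtain rfl : η = 𝟙 f := Subsingleton.elim _ _
    rw [PrelaxFunctor.map₂_id, Bicategory.id_whiskerRight, Category.id_comp]
  naturality_id i := by
    refine NatTrans.ext (funext fun Y => ?_)
    rfl
  naturality_comp {i j k} f g := by
    refine NatTrans.ext (funext fun (Y : ContSet (AutOver L i.as)) => ?_)
    have hf := leOfHom f.as
    have hg := leOfHom g.as
    let Y₁ := (contRestrict L hf).obj Y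
    let Y₂ := (contRestrict L hg).obj Y₁
    let Y₃ := (contRestrict L (hf.trans hg)).obj Y
    -- All coherence cells of the diagram are the identity on underlying sets, and `𝟙` is the
    -- associator. Both sides therefore replace the representative of a point of `Y` in one
    -- realisation by its representative in another; the intermediate representatives cancel.
    refine Eq.symm (Eq.trans (b := Y₃.realization.map Y₂.realization ⟨id, fun _ _ => rfl⟩ ≫
      𝟙 _ ≫ Y₂.realization.map (Y₁.realization.restrict hg) (𝟙 _) ≫
        Y₁.realization.map (Y.realization.restrict hf) (𝟙 _)) rfl ?_)
    exact ZFA.hom_ext (funext fun x => congrArg Y.realizeEquiv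
      ((Y₁.realizeEquiv.symm_apply_apply _).trans (Y₂.realizeEquiv.symm_apply_apply _)))

/-- The embedding of the equivariant sets. -/
noncomputable def toContRealizeIso : EquivariantZFA.toCont L S ⋙ realizeFunctor L S ≅
    EquivariantZFA.inclusion L S :=
  NatIso.ofComponents
    (fun X => ((EquivariantZFA.toCont L S).obj X).realization.iso X.realization) fun {X X'} f =>
      (ContSet.Realization.map_comp_map _ _ _ _ _).trans
        (ContSet.Realization.map_comp_map _ X.realization X'.realization (𝟙 _)
          ((EquivariantZFA.toCont L S).map f)).symm

end Cocone

/-! ### Lifting symmetric functions to a stage -/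

section Lift

variable {L : FirstOrder.Language.{w₁, w₂}} {A : Type u} [L.Structure A] {S T : Finset A}

/-- A symmetric function between realisations is equivariant at all sufficiently late stages. -/
theorem exists_lift (X : ContSet (AutOver L S)) (Y : ContSet (AutOver L T))
    (f : X.realize ⟶ Y.realize) : ∃ U₀ : Finset A, ∀ U, U₀ ≤ U → ∀ (hS : S ≤ U) (hT : T ≤ U),
      ∃ φ : (contRestrict L hS).obj X ⟶ (contRestrict L hT).obj Y,
        Corresponds X.realizeEquiv Y.realizeEquiv φ.toFun f.toFun := by
  obtain ⟨U₀, hU₀⟩ := exists_stage (ZFA.isSymmetric_graph_iff_eventually.1 f.symmetric)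
  refine ⟨U₀, fun U hU hS hT => ?_⟩
  have hc : Corresponds X.realizeEquiv Y.realizeEquiv
      (fun x => Y.realizeEquiv.symm (f.toFun (X.realizeEquiv x))) f.toFun := fun x => by
    rw [Equiv.apply_symm_apply]
  refine ⟨⟨fun x => Y.realizeEquiv.symm (f.toFun (X.realizeEquiv x)), fun π x => ?_⟩, hc⟩
  refine Y.realizeEquiv.injective ((hc _).symm.trans ?_)
  have h₁ := (X.realization.restrict hS).partialAct_equiv π x
  have h₂ := (Y.realization.restrict hT).partialAct_equiv π
    (Y.realizeEquiv.symm (f.toFun (X.realizeEquiv x)))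
  refine (congrArg f.toFun h₁.symm).trans ((hU₀ U hU π _).trans (Eq.trans ?_ h₂))
  exact congrArg _ (Y.realizeEquiv.apply_symm_apply _).symm

theorem exists_lift_of_finite {ι : Type*} [Finite ι] (X Y : ι → ContSet (AutOver L S))
    (f : ∀ i, (X i).realize ⟶ (Y i).realize) : ∃ (T : Finset A) (h : S ≤ T)
      (φ : ∀ i, (contRestrict L h).obj (X i) ⟶ (contRestrict L h).obj (Y i)),
        ∀ i, Corresponds (X i).realizeEquiv (Y i).realizeEquiv (φ i).toFun (f i).toFun := by
  classical
  have := Fintype.ofFinite ι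
  choose U hU using fun i => exists_lift (X i) (Y i) (f i)
  have hS : S ≤ S ∪ Finset.univ.sup U := Finset.subset_union_left
  choose φ hφ using fun i => hU i (S ∪ Finset.univ.sup U)
    ((Finset.le_sup (Finset.mem_univ i)).trans Finset.subset_union_right) hS hS
  exact ⟨_, hS, φ, hφ⟩

end Lift

/-! ## Invariance of universal properties under isomorphism -/

section IsoInvariance

variable {C : Type w₁} [Category.{w₂} C]

theorem isBinaryProduct_iff_existsUnique {P X Y : C} {p : P ⟶ X} {q : P ⟶ Y} :
    IsBinaryProduct p q ↔ ∀ (Z : C) (f : Z ⟶ X) (g : Z ⟶ Y), ∃! k : Z ⟶ P, k ≫ p = f ∧ k ≫ q = g := by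
  constructor
  · rintro ⟨h⟩ Z f g
    exact ⟨BinaryFan.IsLimit.lift h f g, ⟨h.fac _ ⟨.left⟩, h.fac _ ⟨.right⟩⟩, fun k hk =>
      BinaryFan.IsLimit.hom_ext h (hk.1.trans (h.fac (BinaryFan.mk f g) ⟨.left⟩).symm)
        (hk.2.trans (h.fac (BinaryFan.mk f g) ⟨.right⟩).symm)⟩
  · intro h
    choose k hk hu using h
    exact ⟨BinaryFan.IsLimit.mk _ (fun f g => k _ f g) (fun f g => (hk _ f g).1)
      (fun f g => (hk _ f g).2) fun f g m h₁ h₂ => hu _ _ _ _ ⟨h₁, h₂⟩⟩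

theorem IsBinaryProduct.of_iso {P X Y P' X' Y' : C} {p : P ⟶ X} {q : P ⟶ Y} {p' : P' ⟶ X'}
    {q' : P' ⟶ Y'} (h : IsBinaryProduct p q) (a : P ≅ P') (b : X ≅ X') (c : Y ≅ Y')
    (hp : a.hom ≫ p' = p ≫ b.hom) (hq : a.hom ≫ q' = q ≫ c.hom) : IsBinaryProduct p' q' := by
  rw [isBinaryProduct_iff_existsUnique] at h ⊢
  intro Z f g
  obtain ⟨k, ⟨hk₁, hk₂⟩, hu⟩ := h Z (f ≫ b.inv) (g ≫ c.inv)
  refine ⟨k ≫ a.hom, ⟨?_, ?_⟩, fun k' ⟨h₁, h₂⟩ => ?_⟩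
  · rw [Category.assoc, hp, reassoc_of% hk₁, b.inv_hom_id, Category.comp_id]
  · rw [Category.assoc, hq, reassoc_of% hk₂, c.inv_hom_id, Category.comp_id]
  · rw [← Iso.comp_inv_eq]
    refine hu _ ⟨?_, ?_⟩
    · rw [← h₁, ← cancel_mono b.hom]
      simp [← hp]
    · rw [← h₂, ← cancel_mono c.hom]
      simp [← hq]

theorem IsExponential.of_iso {P E A B P' E' A' B' : C} {p : P ⟶ E} {q : P ⟶ A} {ev : P ⟶ B}
    {p' : P' ⟶ E'} {q' : P' ⟶ A'} {ev' : P' ⟶ B'} (h : IsExponential p q ev) (a : P ≅ P')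
    (b : E ≅ E') (c : A ≅ A') (d : B ≅ B') (hp : a.hom ≫ p' = p ≫ b.hom)
    (hq : a.hom ≫ q' = q ≫ c.hom) (hev : a.hom ≫ ev' = ev ≫ d.hom) : IsExponential p' q' ev' := by
  refine ⟨h.1.of_iso a b c hp hq, fun Q Z z α hα g => ?_⟩
  obtain ⟨l, ⟨k, hk₁, hk₂, hk₃⟩, hu⟩ := h.2 z (α ≫ c.inv)
    (hα.of_iso (Iso.refl _) (Iso.refl _) c.symm (by simp) (by simp)) (g ≫ d.inv)
  refine ⟨l ≫ b.hom, ⟨k ≫ a.hom, ?_, ?_, ?_⟩, ?_⟩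
  · rw [Category.assoc, hp, reassoc_of% hk₁]
  · rw [Category.assoc, hq, reassoc_of% hk₂, c.inv_hom_id, Category.comp_id]
  · rw [Category.assoc, hev, reassoc_of% hk₃, d.inv_hom_id, Category.comp_id]
  · rintro l' ⟨k', h₁, h₂, h₃⟩
    rw [← Iso.comp_inv_eq]
    refine hu _ ⟨k' ≫ a.inv, ?_, ?_, ?_⟩
    · rw [← cancel_mono b.hom]
      simp [← hp, h₁]
    · rw [← h₂, ← cancel_mono c.hom]
      simp [← hq]
    · rw [← h₃, ← cancel_mono d.hom]
      simp [← hev]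

theorem IsSubobjectClassifier.of_iso {T Ω T' Ω' : C} {t : T ⟶ Ω} {t' : T' ⟶ Ω'}
    (h : IsSubobjectClassifier t) (a : T ≅ T') (b : Ω ≅ Ω') (ht : a.hom ≫ t' = t ≫ b.hom) :
    IsSubobjectClassifier t' := by
  refine ⟨⟨h.1.some.ofIso a⟩, fun U X m hm => ?_⟩
  obtain ⟨χ, ⟨k, hk⟩, hu⟩ := h.2 m hm
  refine ⟨χ ≫ b.hom, ⟨k ≫ a.hom, hk.paste_vert (IsPullback.of_vert_isIso ⟨ht.symm⟩)⟩, ?_⟩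
  rintro χ' ⟨k', hk'⟩
  rw [← Iso.comp_inv_eq]
  refine hu _ ⟨k' ≫ a.inv, hk'.paste_vert (IsPullback.of_vert_isIso ⟨?_⟩)⟩
  rw [Iso.comp_inv_eq, Category.assoc, ← ht, a.inv_hom_id_assoc]

end IsoInvariance

/-! ## The action of a pseudo-cocone on symmetric functions -/

section Bicolimit

variable {L : FirstOrder.Language.{w₁, w₂}} {A : Type u} [L.Structure A] {S T U V : Finset A}

/-- The comparison between successive restrictions. -/
def contRestrictComp (h : S ≤ T) (h' : T ≤ U) (Y : ContSet (AutOver L S)) :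
    (contRestrict L (h.trans h')).obj Y ⟶ (contRestrict L h').obj ((contRestrict L h).obj Y) :=
  ⟨id, fun _ _ => rfl⟩

namespace PseudoCocone

variable {hC : ∀ S : Finset A, IsElementaryTopos (ContSet (AutOver L S))}
  {hR : ∀ (S T : Finset A) (h : S ≤ T), IsLogical (contRestrict L h)} {E : ElemTopos.{u, u + 1}}
  (K : PseudoCocone (contDiagram L A hC hR) E)

/-- This is the composition coherence of the pseudo-cocone, evaluated at `Y` with the identity
associator removed. -/
theorem legIso_trans (h : S ≤ T) (h' : T ≤ U) (Y : ContSet (AutOver L S)) :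
    (K.legIso (h.trans h')).hom.app Y = (K.leg U).map (contRestrictComp h h' Y) ≫
      (K.legIso h').hom.app ((contRestrict L h).obj Y) ≫ (K.legIso h).hom.app Y := by
  have := congrArg (fun α : (contRestrict L (h.trans h') ⋙ K.leg U ⟶ K.leg S) => α.app Y)
    (K.naturality_comp (i := ⟨S⟩) (j := ⟨T⟩) (k := ⟨U⟩) (homOfLE h).toLoc (homOfLE h').toLoc)
  refine this.trans (Eq.trans (b := (K.leg U).map (contRestrictComp h h' Y) ≫ 𝟙 _ ≫
      (K.legIso h').hom.app ((contRestrict L h).obj Y) ≫ (K.legIso h).hom.app Y) rfl ?_)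
  rw [Category.id_comp]

theorem legIso_refl (Y : ContSet (AutOver L S)) :
    (K.legIso le_rfl).hom.app Y = (K.leg S).map ⟨id, fun _ _ => rfl⟩ := by
  have := congrArg (fun α : (contRestrict L (le_refl S) ⋙ K.leg S ⟶ K.leg S) => α.app Y)
    (K.naturality_id (⟨S⟩ : LocallyDiscrete (Finset A)))
  exact this.trans (Category.comp_id _)

/-- The morphism given by a morphism at a later stage. -/
def atStage {X : ContSet (AutOver L S)} {Y : ContSet (AutOver L T)} (hS : S ≤ U) (hT : T ≤ U)
    (φ : (contRestrict L hS).obj X ⟶ (contRestrict L hT).obj Y) :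
    (K.leg S).obj X ⟶ (K.leg T).obj Y :=
  (K.legIso hS).inv.app X ≫ (K.leg U).map φ ≫ (K.legIso hT).hom.app Y

/-- Coherence rewrites the structural isomorphisms to the later stage through those to the earlier
one, and naturality moves the intermediate isomorphism past the morphism, where it cancels. -/
theorem atStage_eq_of_le {X : ContSet (AutOver L S)} {Y : ContSet (AutOver L T)} (hS : S ≤ U)
    (hT : T ≤ U) (φ : (contRestrict L hS).obj X ⟶ (contRestrict L hT).obj Y) (h : U ≤ V)
    (ψ : (contRestrict L (hS.trans h)).obj X ⟶ (contRestrict L (hT.trans h)).obj Y)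
    (hψ : ψ.toFun = φ.toFun) : K.atStage (hS.trans h) (hT.trans h) ψ = K.atStage hS hT φ := by
  have hc : ψ ≫ contRestrictComp hT h Y = contRestrictComp hS h X ≫ (contRestrict L h).map φ :=
    ContSet.hom_ext hψ
  have hn := (K.legIso h).hom.naturality φ
  have hn' : (K.leg V).map ((contRestrict L h).map φ) ≫ (K.legIso h).hom.app _ =
    (K.legIso h).hom.app _ ≫ (K.leg U).map φ := hn
  rw [atStage, atStage, ← cancel_epi ((K.legIso (hS.trans h)).hom.app X), Iso.hom_inv_id_app_assoc,
    legIso_trans K hT h, ← Functor.map_comp_assoc, hc, Functor.map_comp_assoc, reassoc_of% hn',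
    legIso_trans K hS h, Category.assoc, Category.assoc, Iso.hom_inv_id_app_assoc]

/-- Both morphisms are compared with their common restriction to the stage `U ∪ V`. -/
theorem atStage_eq {X : ContSet (AutOver L S)} {Y : ContSet (AutOver L T)} (hS : S ≤ U)
    (hT : T ≤ U) (φ : (contRestrict L hS).obj X ⟶ (contRestrict L hT).obj Y) (hS' : S ≤ V)
    (hT' : T ≤ V) (ψ : (contRestrict L hS').obj X ⟶ (contRestrict L hT').obj Y)
    (h : ψ.toFun = φ.toFun) : K.atStage hS hT φ = K.atStage hS' hT' ψ := by
  classical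
  have hU : U ≤ U ∪ V := Finset.subset_union_left
  have hV : V ≤ U ∪ V := Finset.subset_union_right
  rw [← K.atStage_eq_of_le hS hT φ hU ⟨φ.toFun, ((contRestrict L hU).map φ).map_smul⟩ rfl,
    ← K.atStage_eq_of_le hS' hT' ψ hV ⟨φ.toFun, ((contRestrict L hU).map φ).map_smul⟩ h.symm]

/-- A lift exists at some stage. Lifts at any two stages have the same underlying function, as it is
determined by `f`, so they give the same morphism. -/
theorem exists_transfer {X : ContSet (AutOver L S)} {Y : ContSet (AutOver L T)}
    (f : X.realize ⟶ Y.realize) : ∃ g : (K.leg S).obj X ⟶ (K.leg T).obj Y,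
      ∀ (U : Finset A) (hS : S ≤ U) (hT : T ≤ U)
        (φ : (contRestrict L hS).obj X ⟶ (contRestrict L hT).obj Y),
        Corresponds X.realizeEquiv Y.realizeEquiv φ.toFun f.toFun → g = K.atStage hS hT φ := by
  classical
  obtain ⟨U, hU⟩ := exists_lift X Y f
  have hS : S ≤ S ∪ T ∪ U := Finset.subset_union_left.trans Finset.subset_union_left
  have hT : T ≤ S ∪ T ∪ U := Finset.subset_union_right.trans Finset.subset_union_left
  obtain ⟨φ, hφ⟩ := hU _ Finset.subset_union_right hS hT
  refine ⟨K.atStage hS hT φ, fun V hS' hT' ψ hψ => K.atStage_eq _ _ _ _ _ _ ?_⟩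
  exact funext fun x => Y.realizeEquiv.injective ((hψ x).symm.trans (hφ x))

/-- The action of a pseudo-cocone on symmetric functions. -/
noncomputable def transfer {X : ContSet (AutOver L S)} {Y : ContSet (AutOver L T)}
    (f : X.realize ⟶ Y.realize) : (K.leg S).obj X ⟶ (K.leg T).obj Y :=
  (K.exists_transfer f).choose

theorem transfer_eq {X : ContSet (AutOver L S)} {Y : ContSet (AutOver L T)}
    {f : X.realize ⟶ Y.realize} (hS : S ≤ U) (hT : T ≤ U)
    (φ : (contRestrict L hS).obj X ⟶ (contRestrict L hT).obj Y)
    (h : Corresponds X.realizeEquiv Y.realizeEquiv φ.toFun f.toFun) :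
    K.transfer f = K.atStage hS hT φ :=
  (K.exists_transfer f).choose_spec U hS hT φ h

theorem transfer_map {X Y : ContSet (AutOver L S)} (φ : X ⟶ Y) :
    K.transfer (X.realization.map Y.realization φ) = (K.leg S).map φ := by
  have hn : (K.leg S).map ((contRestrict L le_rfl).map φ) ≫ (K.legIso le_rfl).hom.app Y =
    (K.legIso le_rfl).hom.app X ≫ (K.leg S).map φ := (K.legIso le_rfl).hom.naturality φ
  rw [K.transfer_eq le_rfl le_rfl ((contRestrict L le_rfl).map φ)
    (X.realization.corresponds_map Y.realization φ), atStage, hn, Iso.inv_hom_id_app_assoc]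

theorem transfer_id (X : ContSet (AutOver L S)) : K.transfer (𝟙 X.realize) = 𝟙 _ := by
  have := K.transfer_map (𝟙 X)
  rwa [X.realization.map_id, CategoryTheory.Functor.map_id] at this

/-- At a stage late enough to lift both factors, the composite of the lifts is a lift of the
composite, and the inner structural isomorphisms cancel. -/
theorem transfer_comp {X : ContSet (AutOver L S)} {Y : ContSet (AutOver L T)}
    {Z : ContSet (AutOver L U)} (f : X.realize ⟶ Y.realize) (g : Y.realize ⟶ Z.realize) :
    K.transfer (f ≫ g) = K.transfer f ≫ K.transfer g := by
  classical
  obtain ⟨V, hV⟩ := exists_lift X Y f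
  obtain ⟨V', hV'⟩ := exists_lift Y Z g
  let W := S ∪ T ∪ U ∪ (V ∪ V')
  have hS : S ≤ W := (Finset.subset_union_left.trans Finset.subset_union_left).trans
    Finset.subset_union_left
  have hT : T ≤ W := (Finset.subset_union_right.trans Finset.subset_union_left).trans
    Finset.subset_union_left
  have hU : U ≤ W := Finset.subset_union_right.trans Finset.subset_union_left
  obtain ⟨φ, hφ⟩ := hV W (Finset.subset_union_left.trans Finset.subset_union_right) hS hT
  obtain ⟨ψ, hψ⟩ := hV' W (Finset.subset_union_right.trans Finset.subset_union_right) hT hU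
  rw [K.transfer_eq hS hT φ hφ, K.transfer_eq hT hU ψ hψ, K.transfer_eq hS hU (φ ≫ ψ) fun x =>
    (congrArg g.toFun (hφ x)).trans (hψ _)]
  simp [atStage]

/-- The comparison between the two realisations lifts at the later stage to the identity function,
so only the structural isomorphism remains. -/
theorem transfer_legIso (h : S ≤ T) (Y : ContSet (AutOver L S)) :
    K.transfer (((contRestrict L h).obj Y).realization.map (Y.realization.restrict h) (𝟙 _)) =
      (K.legIso h).hom.app Y := by
  have hc : Corresponds ((contRestrict L h).obj Y).realizeEquiv Y.realizeEquiv id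
      (((contRestrict L h).obj Y).realization.map (Y.realization.restrict h) (𝟙 _)).toFun :=
    ((contRestrict L h).obj Y).realization.corresponds_map (Y.realization.restrict h) (𝟙 _)
  rw [K.transfer_eq le_rfl h ⟨id, fun _ _ => rfl⟩ hc, atStage]
  exact (congrArg (fun k => (K.legIso le_rfl).inv.app _ ≫ k ≫ (K.legIso h).hom.app Y)
    (K.legIso_refl _).symm).trans (Iso.inv_hom_id_app_assoc _ _ _)

end PseudoCocone

end Bicolimit

/-! ## The logical functor given by a pseudo-cocone -/

section Bicolimit

variable {L : FirstOrder.Language.{w₁, w₂}} {A : Type u} [L.Structure A] {S T U V : Finset A}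

namespace ZFA

variable (W : ZFA L A)

/-- A finite set of atoms over which a symmetric set can be realised. -/
noncomputable def stageOf : Finset A := W.exists_realization.choose

/-- A continuous action that realises a symmetric set. -/
noncomputable def actionOf : ContSet (AutOver L W.stageOf) :=
  W.exists_realization.choose_spec.choose

/-- Every symmetric set is isomorphic to a realised one. -/
noncomputable def presentIso : W.actionOf.realize ≅ W :=
  W.actionOf.realization.iso W.exists_realization.choose_spec.choose_spec.some

end ZFA

/-- A diagram is isomorphic to the realisation of a diagram of actions over which it lies. -/
noncomputable def DiagramRealization.natIso {I : Type w₃} [Category.{w₄} I]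
    {D₀ : I ⥤ ContSet (AutOver L S)} {D : I ⥤ ZFA L A} (r : DiagramRealization D₀ D) :
    D₀ ⋙ realizeFunctor L S ≅ D :=
  NatIso.ofComponents (fun X => (D₀.obj X).realization.iso (r.obj X)) fun {X Y} f => by
    have h : D.map f = (r.obj X).map (r.obj Y) (D₀.map f) :=
      ZFA.hom_ext (funext fun x => by
        obtain ⟨x, rfl⟩ := (r.obj X).equiv.surjective x
        exact (r.corresponds f x).trans ((r.obj X).corresponds_map (r.obj Y) (D₀.map f) x).symm)
    rw [h]
    exact (ContSet.Realization.map_comp_map _ _ _ _ _).trans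
      (ContSet.Realization.map_comp_map (D₀.obj X).realization (r.obj X) (r.obj Y) (𝟙 _)
        (D₀.map f)).symm

/-- The three morphisms of an exponential come from a common stage. -/
theorem exists_stage_exponential {P E B B' : ZFA L A} (p : P ⟶ E) (q : P ⟶ B) (ev : P ⟶ B')
    (h : IsExponential p q ev) : ∃ (S : Finset A) (P₀ E₀ B₀ B₀' : ContSet (AutOver L S))
      (p₀ : P₀ ⟶ E₀) (q₀ : P₀ ⟶ B₀) (ev₀ : P₀ ⟶ B₀') (a : P₀.realize ≅ P) (b : E₀.realize ≅ E)
      (c : B₀.realize ≅ B) (d : B₀'.realize ≅ B'), IsExponential p₀ q₀ ev₀ ∧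
        a.hom ≫ p = (realizeFunctor L S).map p₀ ≫ b.hom ∧
        a.hom ≫ q = (realizeFunctor L S).map q₀ ≫ c.hom ∧
        a.hom ≫ ev = (realizeFunctor L S).map ev₀ ≫ d.hom := by
  -- One finite set of atoms has to fix the four sets and the three graphs simultaneously.
  obtain ⟨S, hS⟩ := exists_stage (P.eventually_smul_set.and <| E.eventually_smul_set.and <|
    B.eventually_smul_set.and <| B'.eventually_smul_set.and <|
    (isSymmetric_iff_eventually.1 p.symmetric).1.and <|
    (isSymmetric_iff_eventually.1 q.symmetric).1.and (isSymmetric_iff_eventually.1 ev.symmetric).1)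
  replace hS := hS S le_rfl
  let P₁ : EquivariantZFA L S := ⟨P, fun π => (hS π).1⟩
  let E₁ : EquivariantZFA L S := ⟨E, fun π => (hS π).2.1⟩
  let B₁ : EquivariantZFA L S := ⟨B, fun π => (hS π).2.2.1⟩
  let B₁' : EquivariantZFA L S := ⟨B', fun π => (hS π).2.2.2.1⟩
  let p₁ : P₁ ⟶ E₁ := ⟨p, fun π => (hS π).2.2.2.2.1⟩
  let q₁ : P₁ ⟶ B₁ := ⟨q, fun π => (hS π).2.2.2.2.2.1⟩
  let ev₁ : P₁ ⟶ B₁' := ⟨ev, fun π => (hS π).2.2.2.2.2.2⟩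
  refine ⟨S, _, _, _, _, (EquivariantZFA.toCont L S).map p₁, (EquivariantZFA.toCont L S).map q₁,
    (EquivariantZFA.toCont L S).map ev₁, toContRealizeIso.app P₁, toContRealizeIso.app E₁,
    toContRealizeIso.app B₁, toContRealizeIso.app B₁', ?_,
    (toContRealizeIso.hom.naturality p₁).symm, (toContRealizeIso.hom.naturality q₁).symm,
    (toContRealizeIso.hom.naturality ev₁).symm⟩
  rw [isExponential_iff] at h ⊢
  exact h.transport (a := Equiv.refl _) (b := Equiv.refl _) (c := Equiv.refl _)
    (d := Equiv.refl _) (fun _ => rfl) (fun _ => rfl) (fun _ => rfl) fun f f' hf =>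
      (B₁.realization.mem_suppFun_iff B₁'.realization hf.symm).symm

/-- A stage fixing both sets and the graph suffices: the concrete description of a classifier refers
only to the underlying function, so it is literally the same at the stage and in `ZFA(A)`. -/
theorem exists_stage_classifier {T Ω : ZFA L A} (t : T ⟶ Ω) (h : IsSubobjectClassifier t) :
    ∃ (S : Finset A) (T₀ Ω₀ : ContSet (AutOver L S)) (t₀ : T₀ ⟶ Ω₀) (a : T₀.realize ≅ T)
      (b : Ω₀.realize ≅ Ω), IsSubobjectClassifier t₀ ∧
        a.hom ≫ t = (realizeFunctor L S).map t₀ ≫ b.hom := by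
  obtain ⟨S, hS⟩ := exists_stage (T.eventually_smul_set.and <| Ω.eventually_smul_set.and
    (isSymmetric_iff_eventually.1 t.symmetric).1)
  replace hS := hS S le_rfl
  let T₁ : EquivariantZFA L S := ⟨T, fun π => (hS π).1⟩
  let Ω₁ : EquivariantZFA L S := ⟨Ω, fun π => (hS π).2.1⟩
  let t₁ : T₁ ⟶ Ω₁ := ⟨t, fun π => (hS π).2.2⟩
  refine ⟨S, _, _, (EquivariantZFA.toCont L S).map t₁, toContRealizeIso.app T₁,
    toContRealizeIso.app Ω₁, ?_, (toContRealizeIso.hom.naturality t₁).symm⟩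
  rw [isSubobjectClassifier_iff] at h ⊢
  exact h

namespace PseudoCocone

variable {hC : ∀ S : Finset A, IsElementaryTopos (ContSet (AutOver L S))}
  {hR : ∀ (S T : Finset A) (h : S ≤ T), IsLogical (contRestrict L h)} {E : ElemTopos.{u, u + 1}}
  (K : PseudoCocone (contDiagram L A hC hR) E)

/-- The functor on symmetric sets given by a pseudo-cocone. -/
noncomputable def transferFunctor : ZFA L A ⥤ E.carrier where
  obj W := (K.leg W.stageOf).obj W.actionOf
  map {W W'} f := K.transfer (W.presentIso.hom ≫ f ≫ W'.presentIso.inv)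
  map_id W := by
    rw [Category.id_comp, Iso.hom_inv_id, transfer_id]
  map_comp f g := by
    rw [← transfer_comp]
    simp

theorem transferFunctor_map_transfer {X : ContSet (AutOver L S)} {Y : ContSet (AutOver L T)}
    (f : X.realize ⟶ Y.realize) : K.transferFunctor.map f ≫ K.transfer Y.realize.presentIso.hom =
      K.transfer X.realize.presentIso.hom ≫ K.transfer f := by
  rw [← transfer_comp]
  refine (K.transfer_comp _ _).symm.trans (congrArg _ ?_)
  rw [Category.assoc, Category.assoc, Iso.inv_hom_id, Category.comp_id]

/-- The functor extends the pseudo-cocone. -/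
noncomputable def realizeTransferIso (S : Finset A) :
    realizeFunctor L S ⋙ K.transferFunctor ≅ K.leg S :=
  NatIso.ofComponents
    (fun Y =>
      { hom := K.transfer Y.realize.presentIso.hom
        inv := K.transfer Y.realize.presentIso.inv
        hom_inv_id := (K.transfer_comp _ _).symm.trans
          ((congrArg K.transfer (Iso.hom_inv_id _)).trans (K.transfer_id _))
        inv_hom_id := (K.transfer_comp _ _).symm.trans
          ((congrArg K.transfer (Iso.inv_hom_id _)).trans (K.transfer_id _)) })
    fun {Y Y'} f => (K.transferFunctor_map_transfer (Y.realization.map Y'.realization f)).trans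
      (congrArg _ (K.transfer_map f))

/-- This compatibility makes the isomorphisms with the separate legs into an isomorphism of
pseudo-cocones. -/
theorem transferFunctor_map_legIso (h : S ≤ T) (Y : ContSet (AutOver L S)) :
    K.transferFunctor.map ((realizeFunctorIso h).hom.app Y) ≫ (K.realizeTransferIso S).hom.app Y =
      (K.realizeTransferIso T).hom.app ((contRestrict L h).obj Y) ≫ (K.legIso h).hom.app Y :=
  (K.transferFunctor_map_transfer _).trans (congrArg _ (K.transfer_legIso h Y))

theorem isLogical_leg (S : Finset A) : IsLogical (K.leg S) := (K.app ⟨S⟩).isLogical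

/-- The value of the functor at a symmetric set that is realised at a given stage. -/
noncomputable def legTransferIso {X : ContSet (AutOver L S)} {W : ZFA L A} (a : X.realize ≅ W) :
    (K.leg S).obj X ≅ K.transferFunctor.obj W :=
  (K.realizeTransferIso S).symm.app X ≪≫ K.transferFunctor.mapIso a

theorem legTransferIso_comp {X Y : ContSet (AutOver L S)} {W W' : ZFA L A} {φ : X ⟶ Y}
    {f : W ⟶ W'} (a : X.realize ≅ W) (b : Y.realize ≅ W')
    (h : a.hom ≫ f = (realizeFunctor L S).map φ ≫ b.hom) :
    (K.legTransferIso a).hom ≫ K.transferFunctor.map f =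
      (K.leg S).map φ ≫ (K.legTransferIso b).hom := by
  have hn := (K.realizeTransferIso S).inv.naturality_assoc φ (K.transferFunctor.map b.hom)
  refine (Category.assoc _ _ _).trans (Eq.trans ?_ hn.symm)
  refine congrArg (fun k => (K.realizeTransferIso S).inv.app X ≫ k) ?_
  exact (K.transferFunctor.map_comp _ _).symm.trans
    ((congrArg _ h).trans (K.transferFunctor.map_comp _ _))

/-- A finite diagram, an exponential or a classifier descends to a stage `S` up to isomorphism. On
objects from this stage the functor agrees with the logical functor `K.leg S`, and the notions are
invariant under isomorphism. -/
theorem isLogical_transferFunctor : IsLogical K.transferFunctor where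
  preservesFiniteLimits := ⟨fun I _ _ => ⟨fun {D} => by
    obtain ⟨S, D₀, ⟨r⟩⟩ := exists_stageRealization (isFinitelyGenerated_of_finCategory I) D
    have := (hC S).hasFiniteLimits
    have := (K.isLogical_leg S).preservesFiniteLimits
    have := (isLogical_realizeFunctor (L := L) (S := S)).preservesFiniteLimits
    have h : PreservesLimit D₀ (realizeFunctor L S ⋙ K.transferFunctor) :=
      preservesLimit_of_natIso D₀ (K.realizeTransferIso S).symm
    -- It is enough to preserve one limit cone, and the realisation of a limit cone at the stage is
    -- such a cone.
    have : PreservesLimit (D₀ ⋙ realizeFunctor L S) K.transferFunctor :=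
      preservesLimit_of_preserves_limit_cone
        (isLimitOfPreserves (realizeFunctor L S) (limit.isLimit D₀))
        (isLimitOfPreserves (realizeFunctor L S ⋙ K.transferFunctor) (limit.isLimit D₀))
    exact preservesLimit_of_iso_diagram _ r.natIso⟩⟩
  exponential p q ev h := by
    obtain ⟨S, P₀, E₀, B₀, B₀', p₀, q₀, ev₀, a, b, c, d, h, hp, hq, hev⟩ :=
      exists_stage_exponential p q ev h
    exact ((K.isLogical_leg S).exponential _ _ _ h).of_iso (K.legTransferIso a)
      (K.legTransferIso b) (K.legTransferIso c) (K.legTransferIso d)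
      (K.legTransferIso_comp a b hp) (K.legTransferIso_comp a c hq) (K.legTransferIso_comp a d hev)
  classifier t h := by
    obtain ⟨S, T₀, Ω₀, t₀, a, b, h, ht⟩ := exists_stage_classifier t h
    exact ((K.isLogical_leg S).classifier _ h).of_iso (K.legTransferIso a) (K.legTransferIso b)
      (K.legTransferIso_comp a b ht)

end PseudoCocone

end Bicolimit

namespace PseudoCocone

open Bicategory

/-- A compatible family of invertible 2-cells is an isomorphism of pseudo-cocones. -/
def isoOfComponents {J : Type w₁} [Bicategory.{w₂, w₃} J] {B : Type u} [Bicategory.{v, w₄} B]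
    {D : J ⥤ᵖ B} {c : B} {X Y : PseudoCocone D c} (e : ∀ j, X.app j ≅ Y.app j)
    (h : ∀ {i j : J} (f : i ⟶ j),
      (X.naturality f).hom ≫ (e i).hom = D.map f ◁ (e j).hom ≫ (Y.naturality f).hom) : X ≅ Y where
  hom := ⟨fun j => (e j).hom, h⟩
  inv := ⟨fun j => (e j).inv, fun {i j} f => by
    rw [← cancel_epi (D.map f ◁ (e j).hom), ← reassoc_of% (h f), Iso.hom_inv_id, Category.comp_id,
      whiskerLeft_hom_inv_assoc]⟩
  hom_inv_id := Hom.ext (funext fun j => (e j).hom_inv_id)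
  inv_hom_id := Hom.ext (funext fun j => (e j).inv_hom_id)

end PseudoCocone

/-! ## The universal property of the category of symmetric sets -/

section Bicolimit

variable {L : FirstOrder.Language.{w₁, w₂}} {A : Type u} [L.Structure A] {S T U : Finset A}

/-- Compatible morphisms between values at realisations form a natural transformation. -/
theorem exists_natTrans {E : Type w₃} [Category.{w₄} E] (F F' : ZFA L A ⥤ E)
    (m : ∀ (S : Finset A) (Y : ContSet (AutOver L S)), F.obj Y.realize ⟶ F'.obj Y.realize)
    (hm : ∀ {S T : Finset A} {X : ContSet (AutOver L S)} {Y : ContSet (AutOver L T)}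
      (f : X.realize ⟶ Y.realize), F.map f ≫ m T Y = m S X ≫ F'.map f) :
    ∃ η : F ⟶ F', ∀ (S : Finset A) (Y : ContSet (AutOver L S)), η.app Y.realize = m S Y := by
  refine ⟨⟨fun W => F.map W.presentIso.inv ≫ m _ W.actionOf ≫ F'.map W.presentIso.hom,
    fun W W' f => ?_⟩, fun S Y => ?_⟩
  · have := hm (W.presentIso.hom ≫ f ≫ W'.presentIso.inv)
    rw [← cancel_epi (F.map W.presentIso.hom), ← cancel_mono (F'.map W'.presentIso.inv)]
    simpa [← Functor.map_comp, ← Functor.map_comp_assoc] using this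
  · change F.map _ ≫ m _ _ ≫ F'.map _ = _
    rw [← hm, ← Functor.map_comp_assoc, Iso.inv_hom_id, CategoryTheory.Functor.map_id, Category.id_comp]

variable {hC : ∀ S : Finset A, IsElementaryTopos (ContSet (AutOver L S))}
  {hR : ∀ (S T : Finset A) (h : S ≤ T), IsLogical (contRestrict L h)}

namespace PseudoCocone

/-- The component at a stage of a morphism of pseudo-cocones. -/
def legHom {E : ElemTopos.{u, u + 1}} {K K' : PseudoCocone (contDiagram L A hC hR) E} (m : K ⟶ K')
    (S : Finset A) : K.leg S ⟶ K'.leg S :=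
  m.app ⟨S⟩

theorem legHom_legIso {E : ElemTopos.{u, u + 1}} {K K' : PseudoCocone (contDiagram L A hC hR) E}
    (m : K ⟶ K') (h : S ≤ T) (Y : ContSet (AutOver L S)) :
    (K.legIso h).hom.app Y ≫ (legHom m S).app Y =
      (legHom m T).app ((contRestrict L h).obj Y) ≫ (K'.legIso h).hom.app Y :=
  congrArg (fun α : (contRestrict L h ⋙ K.leg T ⟶ K'.leg S) => α.app Y)
    (m.naturality (i := ⟨S⟩) (j := ⟨T⟩) (homOfLE h).toLoc)

/-- At a stage to which `f` lifts, this combines naturality of the component there with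
compatibility of the components with the structural isomorphisms. -/
theorem legHom_transfer {E : ElemTopos.{u, u + 1}}
    {K K' : PseudoCocone (contDiagram L A hC hR) E} (m : K ⟶ K') {X : ContSet (AutOver L S)}
    {Y : ContSet (AutOver L T)} (f : X.realize ⟶ Y.realize) :
    K.transfer f ≫ (legHom m T).app Y = (legHom m S).app X ≫ K'.transfer f := by
  classical
  obtain ⟨U, hU⟩ := exists_lift X Y f
  have hS : S ≤ S ∪ T ∪ U := Finset.subset_union_left.trans Finset.subset_union_left
  have hT : T ≤ S ∪ T ∪ U := Finset.subset_union_right.trans Finset.subset_union_left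
  obtain ⟨φ, hφ⟩ := hU _ Finset.subset_union_right hS hT
  rw [K.transfer_eq hS hT φ hφ, K'.transfer_eq hS hT φ hφ, atStage, atStage, Category.assoc,
    Category.assoc, legHom_legIso, (legHom m _).naturality_assoc,
    ← cancel_epi ((K.legIso hS).hom.app X), Iso.hom_inv_id_app_assoc,
    reassoc_of% (legHom_legIso m hS X), Iso.hom_inv_id_app_assoc]

variable (hZ : IsElementaryTopos (ZFA L A)) {E : ElemTopos.{u, u + 1}}

/-- The functor underlying a logical functor on symmetric sets. -/
abbrev zfaFunctor (F : (⟨ZFA L A, hZ⟩ : ElemTopos.{u, u + 1}) ⟶ E) : ZFA L A ⥤ E.carrier :=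
  ElemTopos.Hom.functor F

/-- The structural isomorphisms of the composed pseudo-cocone are the images under `F` of the
comparisons between realisations. After lifting `f` to a stage, the claim is the image of an
identity between symmetric functions, checked on elements. -/
theorem transfer_precomp (F : (⟨ZFA L A, hZ⟩ : ElemTopos.{u, u + 1}) ⟶ E)
    {X : ContSet (AutOver L S)} {Y : ContSet (AutOver L T)} (f : X.realize ⟶ Y.realize) :
    (((realizeCocone L A hC hR hZ).precomp E).obj F).transfer f = (zfaFunctor hZ F).map f := by
  classical
  let K := ((realizeCocone L A hC hR hZ).precomp E).obj F
  obtain ⟨U, hU⟩ := exists_lift X Y f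
  have hS : S ≤ S ∪ T ∪ U := Finset.subset_union_left.trans Finset.subset_union_left
  have hT : T ≤ S ∪ T ∪ U := Finset.subset_union_right.trans Finset.subset_union_left
  obtain ⟨φ, hφ⟩ := hU _ Finset.subset_union_right hS hT
  have key : ∀ {V : Finset A} (h : V ≤ S ∪ T ∪ U) (Z : ContSet (AutOver L V)),
      (K.legIso h).hom.app Z = (zfaFunctor hZ F).map ((realizeFunctorIso h).hom.app Z) :=
    fun h Z => Category.id_comp _
  have hK : ∀ g : (K.leg S).obj X ⟶ (K.leg T).obj Y, (K.leg (S ∪ T ∪ U)).map φ ≫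
      (K.legIso hT).hom.app Y = (K.legIso hS).hom.app X ≫ g → K.transfer f = g := fun g hg => by
    rw [K.transfer_eq hS hT φ hφ, atStage, hg, Iso.inv_hom_id_app_assoc]
  refine hK _ ((congrArg (fun k => (K.leg (S ∪ T ∪ U)).map φ ≫ k) (key hT Y)).trans
    (Eq.trans ?_ (congrArg (fun k => k ≫ (zfaFunctor hZ F).map f) (key hS X).symm)))
  refine ((zfaFunctor hZ F).map_comp _ _).symm.trans
    (Eq.trans (congrArg _ ?_) ((zfaFunctor hZ F).map_comp _ _))
  refine ZFA.hom_ext (funext fun x => ?_)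
  obtain ⟨x, rfl⟩ := ((contRestrict L hS).obj X).realizeEquiv.surjective x
  have h₁ := ((contRestrict L hS).obj X).realization.corresponds_map
    ((contRestrict L hT).obj Y).realization φ x
  have h₂ := ((contRestrict L hS).obj X).realization.corresponds_map
    (X.realization.restrict hS) (𝟙 _) x
  have h₃ := ((contRestrict L hT).obj Y).realization.corresponds_map
    (Y.realization.restrict hT) (𝟙 _) (φ.toFun x)
  exact (congrArg _ h₁).trans (h₃.trans ((hφ x).symm.trans (congrArg _ h₂.symm)))

/-- Every symmetric set is isomorphic to a realised one, so the components at realised sets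
determine a natural transformation. -/
instance faithful_precomp : ((realizeCocone L A hC hR hZ).precomp E).Faithful where
  map_injective {F F'} η η' h := by
    have h' : ∀ (S : Finset A) (Y : ContSet (AutOver L S)),
        NatTrans.app (F := zfaFunctor hZ F) (G := zfaFunctor hZ F') η Y.realize =
          NatTrans.app (F := zfaFunctor hZ F) (G := zfaFunctor hZ F') η' Y.realize := fun S Y =>
      congrArg (fun m => (legHom m S).app Y) h
    refine NatTrans.ext (F := zfaFunctor hZ F) (G := zfaFunctor hZ F') (funext fun W => ?_)
    rw [← cancel_epi ((zfaFunctor hZ F).map W.presentIso.hom), NatTrans.naturality, h',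
      NatTrans.naturality]

/-- The components of `m` are natural with respect to all symmetric functions between realised sets,
even when these come from different stages; this suffices to extend them to all symmetric sets. -/
instance full_precomp : ((realizeCocone L A hC hR hZ).precomp E).Full where
  map_surjective {F F'} m := by
    have hm : ∀ {S T : Finset A} {X : ContSet (AutOver L S)} {Y : ContSet (AutOver L T)}
        (f : X.realize ⟶ Y.realize), (zfaFunctor hZ F).map f ≫ (legHom m T).app Y =
          (legHom m S).app X ≫ (zfaFunctor hZ F').map f := fun f => by
      have := legHom_transfer m f
      rwa [transfer_precomp, transfer_precomp] at this
    obtain ⟨η, hη⟩ := exists_natTrans (zfaFunctor hZ F) (zfaFunctor hZ F')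
      (fun S Y => (legHom m S).app Y) hm
    exact ⟨η, Hom.ext (funext fun S => NatTrans.ext (funext fun Y => hη S.as Y))⟩

instance essSurj_precomp : ((realizeCocone L A hC hR hZ).precomp E).EssSurj where
  mem_essImage K := by
    let F : (⟨ZFA L A, hZ⟩ : ElemTopos.{u, u + 1}) ⟶ E :=
      ⟨K.transferFunctor, K.isLogical_transferFunctor⟩
    refine ⟨F, ⟨isoOfComponents (fun S => ElemTopos.isoMk (K.realizeTransferIso S.as))
      fun {i j} f => NatTrans.ext (funext fun Y => ?_)⟩⟩
    refine Eq.trans ?_ (K.transferFunctor_map_legIso (leOfHom f.as) Y)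
    exact congrArg (fun k => k ≫ (K.realizeTransferIso _).hom.app Y) (Category.id_comp _)

theorem isBicolimit_realizeCocone : (realizeCocone L A hC hR hZ).IsBicolimit :=
  fun _ => { }

end PseudoCocone

end Bicolimit

/-! ### The transfer principle -/

theorem theoremt (L : FirstOrder.Language.{w₁, w₂}) (A : Type u) [L.Structure A] :
    ∃ (hC : ∀ S : Finset A, IsElementaryTopos (ContSet (AutOver L S)))
      (hR : ∀ (S T : Finset A) (h : S ≤ T), IsLogical (contRestrict L h))
      (hZ : IsElementaryTopos (ZFA L A))
      (J : PseudoCocone (contDiagram L A hC hR) (⟨ZFA L A, hZ⟩ : ElemTopos.{u, u + 1})),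
      -- the legs of `J` are the canonical embeddings
      (∀ S : Finset A, (EquivariantZFA.toCont L S).IsEquivalence) ∧
      (∃ θ : ∀ S : Finset A,
          EquivariantZFA.toCont L S ⋙ J.leg S ≅ EquivariantZFA.inclusion L S,
        ∀ (S T : Finset A) (h : S ≤ T) (X : EquivariantZFA L S),
          (J.legIso h).hom.app ((EquivariantZFA.toCont L S).obj X) ≫ (θ S).hom.app X =
            (J.leg T).map ((toContEnlargeIso L h).hom.app X) ≫
              (θ T).hom.app ((EquivariantZFA.enlarge L h).obj X)) ∧
      (∀ S : Finset A, (J.leg S).Faithful ∧ (J.leg S).ReflectsIsomorphisms) ∧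
      -- `ZFA(A)` is the filtered colimit in the 2-category of elementary toposes
      IsFiltered (Finset A) ∧ J.IsBicolimit ∧
      -- statements transfer back and forth along the legs of `J`
      (∀ (C : Type w₃) [Category.{w₄} C] (S : Finset A) (D : C ⥤ ContSet (AutOver L S))
        (φ : ToposStatement C), φ.Holds D ↔ φ.Holds (D ⋙ J.leg S)) ∧
      -- finitely generated diagrams, with all statements about them, come from a finite stage
      (∀ (C : Type w₃) [Category.{w₄} C], IsFinitelyGenerated C → ∀ D : C ⥤ ZFA L A,
        ∃ (S : Finset A) (D₀ : C ⥤ ContSet (AutOver L S)),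
          Nonempty (D₀ ⋙ J.leg S ≅ D) ∧
          ∀ φ : ToposStatement C, φ.Holds D₀ ↔ φ.Holds D) ∧
      -- and so do the transformations between them
      (∀ (C : Type w₃) [Category.{w₄} C], IsFinitelyGenerated C →
        ∀ (S : Finset A) (D₀ D₁ : C ⥤ ContSet (AutOver L S))
          (α : D₀ ⋙ J.leg S ⟶ D₁ ⋙ J.leg S),
          ∃ (T : Finset A) (h : S ≤ T)
            (β : D₀ ⋙ contRestrict L h ⟶ D₁ ⋙ contRestrict L h),
            ∀ X : C, (J.leg T).map (β.app X) ≫ (J.legIso h).hom.app (D₁.obj X) =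
              (J.legIso h).hom.app (D₀.obj X) ≫ α.app X) := by
  refine ⟨fun S => isElementaryTopos _, fun S T h => isLogical_contRestrict h, isElementaryTopos _,
    realizeCocone L A _ _ _, fun S => inferInstance,
    ⟨fun S => toContRealizeIso, fun S T h X => ?_⟩,
    fun S => ⟨inferInstanceAs (realizeFunctor L S).Faithful,
      inferInstanceAs (realizeFunctor L S).ReflectsIsomorphisms⟩,
    inferInstance, PseudoCocone.isBicolimit_realizeCocone _,
    fun C _ S D φ => (realizeFunctorRealization L S D).diagramEquiv.holds_iff φ,
    fun C _ hC D => ?_, fun C _ hC S D₀ D₁ α => ?_⟩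
  · let Y := (EquivariantZFA.toCont L S).obj X
    let Y₁ := (contRestrict L h).obj Y
    let Y₂ := (EquivariantZFA.toCont L T).obj ((EquivariantZFA.enlarge L h).obj X)
    -- Both composites send the representative of an element of the equivariant set to that element.
    exact ZFA.hom_ext (funext fun _ =>
      (Y.realizeEquiv.symm_apply_apply _).trans (Y₂.realizeEquiv.symm_apply_apply _).symm)
  · obtain ⟨S, D₀, ⟨r⟩⟩ := exists_stageRealization hC D
    exact ⟨S, D₀, ⟨r.natIso⟩, r.diagramEquiv.holds_iff⟩
  · have := hC.1
    -- Only the finitely many objects matter for the choice of `T`: a lift is determined by its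
    -- underlying function, so naturality of the lifts follows from naturality of `α` at once for
    -- all morphisms.
    obtain ⟨T, h, φ, hφ⟩ := exists_lift_of_finite D₀.obj D₁.obj α.app
    refine ⟨T, h, ⟨φ, fun X Y f => ?_⟩, fun X => ?_⟩
    · refine ContSet.hom_ext (funext fun (x : (D₀.obj X).carrier) =>
        (D₁.obj Y).realizeEquiv.injective ?_)
      have h₁ := congrFun (congrArg ZFA.Hom.toFun (α.naturality f)) ((D₀.obj X).realizeEquiv x)
      refine (hφ Y _).symm.trans (Eq.trans ?_ (h₁.trans ?_))
      · exact congrArg (α.app Y).toFun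
          ((D₀.obj X).realization.corresponds_map (D₀.obj Y).realization (D₀.map f) x).symm
      · refine (congrArg ((realizeFunctor L S).map (D₁.map f)).toFun (hφ X x)).trans ?_
        exact (D₁.obj X).realization.corresponds_map (D₁.obj Y).realization (D₁.map f) _
    · refine ZFA.hom_ext (funext fun x => ?_)
      obtain ⟨x, rfl⟩ := ((contRestrict L h).obj (D₀.obj X)).realizeEquiv.surjective x
      have h₁ := ((contRestrict L h).obj (D₀.obj X)).realization.corresponds_map
        ((contRestrict L h).obj (D₁.obj X)).realization (φ X) x
      have h₂ := ((contRestrict L h).obj (D₀.obj X)).realization.corresponds_map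
        ((D₀.obj X).realization.restrict h) (𝟙 _) x
      have h₃ := ((contRestrict L h).obj (D₁.obj X)).realization.corresponds_map
        ((D₁.obj X).realization.restrict h) (𝟙 _) ((φ X).toFun x)
      exact (congrArg _ h₁).trans (h₃.trans ((hφ X x).symm.trans (congrArg _ h₂.symm)))
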